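/- Let $\mathbf p=(p_1,p_2,\dots)$ be indeterminates. **Dessins.** For $k,l,m\ge1$ and $\mu=(\mu_1,\dots,\mu_m)$ with all $\mu_i\ge1$, let $N_{k,l}(\mu)=\sum_\Gamma 1/|\mathrm{Aut}_b\,\Gamma|$, where $\Gamma$ runs over the isomorphism classes of connected dessins d'enfants with $|\mu|=\mu_1+\dots+\mu_m$ edges, $k$ black vertices, $l$ white vertices and $m$ labelled boundary components (faces) of degrees $\mu_1,\dots,\mu_m$, and $\mathrm{Aut}_b\,\Gamma$ is the group of automorphisms that preserve each boundary component. Put $$\langle\tau_{\mu_1}\cdots\tau_{\mu_m}\rangle(u,v,\epsilon)=\sum_{g\ge0,\ k,l\ge1,\ 2g+k+l=|\mu|-m+2}N_{k,l}(\mu)\,u^kv^l\epsilon^{2g-2},$$ $$Z_{\rm dessins}(u,v,\mathbf p;\epsilon)=\exp\Bigl(\sum_{m\ge1}\ \sum_{\mu_1,\dots,\mu_m\ge1}\langle\tau_{\mu_1}\cdots\tau_{\mu_m}\rangle(u,v,\epsilon)\,\frac{p_{\mu_1}\cdots p_{\mu_m}}{m!}\Bigr).$$ **LUE.** For an integer $n\ge1$,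 $\alpha\in\mathbb C$ with $\mathrm{Re}\,\alpha>-1$ and real $\epsilon>0$, let $$Z_n^{\rm LUE1}(\mathbf p;\alpha;\epsilon)=\frac{G(\alpha+1)\,\epsilon^{-n^2-\alpha n}}{\pi^{n(n-1)/2}\,G(n+\alpha+1)}\int_{\mathcal H_n^+}(\det M)^\alpha e^{-\frac1\epsilon\mathrm{tr}\,V(M;\mathbf p)}\,dM,\qquad V(M;\mathbf p)=M-\sum_{j\ge1}\frac{p_j}{j}M^j,$$ where $G$ is the Barnes $G$-function, $\mathcal H_n^+$ is the space of positive Hermitian $n\times n$ matrices, $dM=\prod_i dM_{ii}\prod_{i<j}d\mathrm{Re}M_{ij}\,d\mathrm{Im}M_{ij}$, and the right-hand side is understood as a power series in $\mathbf p$: the integrand is Taylor expanded in $\mathbf p$ and the coefficient of each monomial is integrated. **Statement.** (1) For all $n\ge1$, $\mathrm{Re}\,\alpha>-1$ and $\epsilon>0$, all these integrals converge absolutely, and with $x=n\epsilon$, $a=\alpha\epsilon$, $$Z_{\rm dessins}(x,x+a,\mathbf p;\epsilon)=Z_n^{\rm LUE1}(\mathbf p;\alpha;\epsilon)$$ as power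 series in $\mathbf p$ over $\mathbb C$. (2) There is exactly one power series $Z_{\rm LUE1}(x,\mathbf p;a;\epsilon)$ in $\mathbf p$ with coefficients in $\mathbb C[x,a,\epsilon,\epsilon^{-1}]$ such that $Z_{\rm LUE1}(n\epsilon,\mathbf p;\alpha\epsilon;\epsilon)=Z_n^{\rm LUE1}(\mathbf p;\alpha;\epsilon)$ for all $n\ge1$, $\mathrm{Re}\,\alpha>-1$, $\epsilon>0$, and, with $x,a,\epsilon$ indeterminates, $$Z_{\rm dessins}(x,x+a,\mathbf p;\epsilon)=Z_{\rm LUE1}(x,\mathbf p;a;\epsilon).$$ -/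

import Mathlib

noncomputable section

open MeasureTheory
open scoped LaurentPolynomial ComplexOrder

namespace DessinLUE

/-! ## Formal power series in `p = (p₁, p₂, …)`

The variables `p_j`, `j ≥ 1`, are indexed by `ℕ+`. A monomial `∏ p_j ^ e_j` is an exponent vector
`e : ℕ+ →₀ ℕ`. -/

/-- The monomial `p_{μ₁} ⋯ p_{μ_m}`. -/
def pMonomial {m : ℕ} (μ : Fin m → ℕ+) : ℕ+ →₀ ℕ := ∑ i, Finsupp.single (μ i) 1

/-- The linear series `∑_{j ≥ 1} c_j p_j`. -/
def linearSeries {R : Type*} [CommRing R] (c : ℕ+ → R) : MvPowerSeries ℕ+ R :=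
  fun e => ∑ j ∈ e.support, if e = Finsupp.single j 1 then c j else 0

/-- `exp F` for a power series `F` with zero constant term. -/
def formalExp {R : Type*} [CommRing R] [Algebra ℚ R] (F : MvPowerSeries ℕ+ R) :
    MvPowerSeries ℕ+ R :=
  PowerSeries.subst F (PowerSeries.exp ℚ)

/-- `exp F` for a power series `F` over `ℂ` with constant term `c`, as `e ^ c * exp (F - c)`. -/
def complexFormalExp (F : MvPowerSeries ℕ+ ℂ) : MvPowerSeries ℕ+ ℂ :=
  MvPowerSeries.C (Complex.exp (MvPowerSeries.constantCoeff F)) *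
    formalExp (F - MvPowerSeries.C (MvPowerSeries.constantCoeff F))

/-! ## Dessins d'enfants -/

/-- The cycles of a permutation, fixed points included. -/
abbrev Cycles {E : Type*} (σ : Equiv.Perm E) : Type _ :=
  Quotient (Equiv.Perm.SameCycle.setoid σ)

/-- A dessin d'enfant with set of edges `E`, of type `(k, l, μ)`, with labelled boundary components:
a connected bicoloured graph embedded in a closed oriented surface with cells as complement.
It is given by its rotation system: `black` and `white` send an edge to the next one around
its black, resp. white, end (these are the monodromies of the Belyi function around `0` and `1`).
Black vertices (zeros of `f`), white vertices (preimages of `1`) and boundary components (poles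
of `f`) are the cycles of `black`, of `white` and of `black * white`; lengths of cycles are the
local degrees of `f`. The labelling of boundary components is recorded on edges: `label e` is the
label of the boundary component at `e`. -/
structure LabelledDessin (E : Type*) (k l : ℕ) {m : ℕ} (μ : Fin m → ℕ+) where
  black : Equiv.Perm E
  white : Equiv.Perm E
  connected : MulAction.IsPretransitive (Subgroup.closure {black, white}) E
  card_black : Nat.card (Cycles black) = k
  card_white : Nat.card (Cycles white) = l
  label : E → Fin m
  label_eq_iff : ∀ e e' : E, label e = label e' ↔ (black * white).SameCycle e e'
  card_label : ∀ i : Fin m, Nat.card {e : E // label e = i} = (μ i : ℕ)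

namespace LabelledDessin

variable {E : Type*} {k l m : ℕ} {μ : Fin m → ℕ+}

/-- Isomorphisms of dessins that preserve each labelled boundary component. -/
structure Iso (Γ Γ' : LabelledDessin E k l μ) where
  toEquiv : E ≃ E
  map_black : ∀ e, toEquiv (Γ.black e) = Γ'.black (toEquiv e)
  map_white : ∀ e, toEquiv (Γ.white e) = Γ'.white (toEquiv e)
  map_label : ∀ e, Γ'.label (toEquiv e) = Γ.label e

/-- The automorphisms of a dessin that preserve the boundary component wise. -/
abbrev AutB (Γ : LabelledDessin E k l μ) : Type _ := Iso Γ Γ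

/-- The relation of being isomorphic as labelled dessins. -/
instance isoSetoid (E : Type*) (k l : ℕ) {m : ℕ} (μ : Fin m → ℕ+) :
    Setoid (LabelledDessin E k l μ) where
  r Γ Γ' := Nonempty (Iso Γ Γ')
  iseqv :=
    { refl := fun _ => ⟨⟨Equiv.refl _, fun _ => rfl, fun _ => rfl, fun _ => rfl⟩⟩
      symm := by
        rintro Γ Γ' ⟨τ, hb, hw, hl⟩
        refine ⟨⟨τ.symm, fun e => ?_, fun e => ?_, fun e => ?_⟩⟩
        · rw [Equiv.symm_apply_eq, hb, Equiv.apply_symm_apply]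
        · rw [Equiv.symm_apply_eq, hw, Equiv.apply_symm_apply]
        · rw [← hl, Equiv.apply_symm_apply]
      trans := by
        rintro Γ Γ' Γ'' ⟨τ, hb, hw, hl⟩ ⟨τ', hb', hw', hl'⟩
        refine ⟨⟨τ.trans τ', fun e => ?_, fun e => ?_, fun e => ?_⟩⟩
        · simp [hb, hb']
        · simp [hw, hw']
        · simp [hl, hl'] }

end LabelledDessin

/-- The set `D_{k,l;μ}` of isomorphism classes of labelled dessins of type `(k, l, μ)`; they have
`d = μ₁ + ⋯ + μ_m` edges. -/
abbrev DessinClasses (k l : ℕ) {m : ℕ} (μ : Fin m → ℕ+) : Type :=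
  Quotient (LabelledDessin.isoSetoid (Fin (∑ i, (μ i : ℕ))) k l μ)

/-- The weighted count `N_{k,l}(μ) = ∑_Γ 1 / |Aut_b Γ|` (a finite sum). -/
def dessinCount (k l : ℕ) {m : ℕ} (μ : Fin m → ℕ+) : ℚ :=
  ∑ᶠ Γ : DessinClasses k l μ, (1 : ℚ) / Nat.card (Quotient.out Γ).AutB

section

variable {R : Type*} [CommRing R] [Algebra ℚ R]

/-- The connected correlator `⟨τ_{μ₁} ⋯ τ_{μ_m}⟩(u, v, ε)`, the sum of
`N_{k,l}(μ) u^k v^l ε^(2g-2)` over `g ≥ 0`, `k, l ≥ 1` with `2g + k + l = |μ| - m + 2`.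
The condition bounds `g`, `k`, `l` by `|μ| + 2`. -/
def dessinCorrelator (u v : R) (ε : Rˣ) {m : ℕ} (μ : Fin m → ℕ+) : R :=
  ∑ g ∈ Finset.range ((∑ i, (μ i : ℕ)) + 3),
    ∑ k ∈ Finset.Icc 1 ((∑ i, (μ i : ℕ)) + 2), ∑ l ∈ Finset.Icc 1 ((∑ i, (μ i : ℕ)) + 2),
      if 2 * g + k + l + m = (∑ i, (μ i : ℕ)) + 2 then
        dessinCount k l μ • (u ^ k * v ^ l * ((ε ^ (2 * (g : ℤ) - 2) : Rˣ) : R))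
      else 0

/-- The dessin free energy
`F(u, v, p; ε) = ∑_{m ≥ 1} ∑_{μ₁, …, μ_m ≥ 1} ⟨τ_{μ₁} ⋯ τ_{μ_m}⟩ p_{μ₁} ⋯ p_{μ_m} / m!`.
The monomial `e` only occurs for `m = e.degree` and for `μ` with values in the support of `e`. -/
def dessinFreeEnergy (u v : R) (ε : Rˣ) : MvPowerSeries ℕ+ R := fun e =>
  if e = 0 then 0 else
    ∑ μ ∈ Fintype.piFinset (fun _ : Fin e.degree => e.support),
      if pMonomial μ = e then
        ((Nat.factorial e.degree : ℚ)⁻¹) • dessinCorrelator u v ε μ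
      else 0

/-- The dessin partition function `Z_dessins(u, v, p; ε) = exp F(u, v, p; ε)`. -/
def dessinPartitionFunction (u v : R) (ε : Rˣ) : MvPowerSeries ℕ+ R :=
  formalExp (dessinFreeEnergy u v ε)

end

/-! ## The Laguerre unitary ensemble -/

/-- The Barnes `G`-function, by its Weierstrass product
`G(1+w) = (2π)^(w/2) exp(-(w + (1+γ) w²)/2) ∏_{j ≥ 1} (1 + w/j)^j exp(w²/(2j) - w)`. -/
def barnesG (z : ℂ) : ℂ :=
  (2 * (Real.pi : ℂ)) ^ ((z - 1) / 2) *
    Complex.exp (-((z - 1) + (1 + (Real.eulerMascheroniConstant : ℂ)) * (z - 1) ^ 2) / 2) *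
    ∏' j : ℕ+, ((1 + (z - 1) / (j : ℂ)) ^ (j : ℕ) *
      Complex.exp ((z - 1) ^ 2 / (2 * (j : ℂ)) - (z - 1)))

/-- Real coordinates on Hermitian `n × n` matrices: the diagonal entries, and the pairs
`(Re M_ij, Im M_ij)` for `i < j`. Lebesgue measure in these coordinates is
`dM = ∏ dM_ii ∏_{i<j} dRe M_ij dIm M_ij`. -/
abbrev HermitianCoord (n : ℕ) : Type :=
  (Fin n → ℝ) × ({q : Fin n × Fin n // q.1 < q.2} → ℝ × ℝ)

/-- The Hermitian matrix with the given coordinates. -/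
def hermitianMatrix {n : ℕ} (c : HermitianCoord n) : Matrix (Fin n) (Fin n) ℂ := fun i j =>
  if h : i < j then ⟨(c.2 ⟨(i, j), h⟩).1, (c.2 ⟨(i, j), h⟩).2⟩
  else if h' : j < i then ⟨(c.2 ⟨(j, i), h'⟩).1, -(c.2 ⟨(j, i), h'⟩).2⟩
  else (c.1 i : ℂ)

/-- The space of positive Hermitian matrices, in coordinates. -/
def positiveHermitian (n : ℕ) : Set (HermitianCoord n) := {c | (hermitianMatrix c).PosDef}

/-- `tr V(M; p) = tr M - ∑_{j ≥ 1} (p_j / j) tr M^j`, as a power series in `p`. -/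
def traceV {n : ℕ} (M : Matrix (Fin n) (Fin n) ℂ) : MvPowerSeries ℕ+ ℂ :=
  MvPowerSeries.C M.trace - linearSeries fun j => (M ^ (j : ℕ)).trace / (j : ℂ)

/-- `(det M)^α exp(-(1/ε) tr V(M; p))`, Taylor expanded in `p`. -/
def lueIntegrand {n : ℕ} (α : ℂ) (ε : ℝ) (M : Matrix (Fin n) (Fin n) ℂ) : MvPowerSeries ℕ+ ℂ :=
  MvPowerSeries.C (M.det ^ α) *
    complexFormalExp (MvPowerSeries.C (-(1 / (ε : ℂ))) * traceV M)

/-- The normalized LUE partition function `Z_n^LUE1(p; α; ε)`: the integral over positive Hermitian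
matrices is taken for the coefficient of each monomial in `p`. -/
def luePartitionFunction (n : ℕ) (α : ℂ) (ε : ℝ) : MvPowerSeries ℕ+ ℂ := fun e =>
  barnesG (α + 1) * (ε : ℂ) ^ (-(n : ℂ) ^ 2 - α * n) /
      ((Real.pi : ℂ) ^ (n * (n - 1) / 2 : ℕ) * barnesG (n + α + 1)) *
    ∫ c in positiveHermitian n,
      MvPowerSeries.coeff e (lueIntegrand α ε (hermitianMatrix c))

/-! ## The variables `x`, `a`, `ε` as indeterminates -/

/-- The ring `ℂ[x, a][ε, ε⁻¹]`. -/
abbrev CoeffRing : Type := (MvPolynomial (Fin 2) ℂ)[T;T⁻¹]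

/-- The indeterminate `x`. -/
def xVar : CoeffRing := LaurentPolynomial.C (MvPolynomial.X 0)

/-- The indeterminate `a`. -/
def aVar : CoeffRing := LaurentPolynomial.C (MvPolynomial.X 1)

/-- The invertible indeterminate `ε`. -/
def epsVar : CoeffRingˣ where
  val := LaurentPolynomial.T 1
  inv := LaurentPolynomial.T (-1)
  val_inv := by rw [← LaurentPolynomial.T_add]; simp
  inv_val := by rw [← LaurentPolynomial.T_add]; simp

/-- Evaluation of the indeterminates `x`, `a`, `ε` at complex numbers. -/
def specialize (x a : ℂ) (ε : ℂˣ) : CoeffRing →+* ℂ :=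
  LaurentPolynomial.eval₂ (MvPolynomial.eval ![x, a]) ε

/-- A nonzero real number as a unit of `ℂ`. -/
def realUnit (ε : ℝ) (hε : ε ≠ 0) : ℂˣ := Units.mk0 (ε : ℂ) (Complex.ofReal_ne_zero.mpr hε)

/-- `Z` is the normalized LUE partition function `Z_LUE1(x, p; a; ε)` with `x`, `a`, `ε` viewed as
indeterminates: a series in `p` whose coefficients depend polynomially on `x`, `a`, `ε`, `ε⁻¹` and
with `Z_LUE1(nε, p; αε; ε) = Z_n^LUE1(p; α; ε)` for all matrix sizes `n`, all `α` with
`Re α > -1` and all `ε > 0`. -/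
def IsFormalLUE (Z : MvPowerSeries ℕ+ CoeffRing) : Prop :=
  ∀ (n : ℕ) (α : ℂ) (ε : ℝ) (hε : 0 < ε), 1 ≤ n → -1 < α.re →
    MvPowerSeries.map (specialize (n * ε) (α * ε) (realUnit ε hε.ne')) Z =
      luePartitionFunction n α ε

end DessinLUE

end

/-!
Both partition functions turn out to have the same coefficient at the monomial `p ^ e`. With
`d = wt e = ∑ j * e j`, it is

  `(1 / d!) ∑ x ^ cyc b * (x + a) ^ cyc w * ε ^ (d - cyc b - cyc w - deg e)`,

where `(b, w)` runs over the pairs of permutations of `d` points such that `b * w` has `e j` cycles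
of length `j` for each `j`, and `cyc` is the number of cycles.

For dessins this is `coeff_dessinPartitionFunction`. A dessin on a fixed set of edges is a transitive
pair of permutations with a labelling of the cycles of their product, and the sum of the
`1 / |Aut_b Γ|` counts such dessins up to the factor `1 / d!` by the orbit–stabilizer theorem
(`dessinCount_eq`). The genus condition holds for a unique `g` by Euler's formula
(`exists_genus`), so that it fixes the power of `ε` and excludes nothing. The exponential then
removes the condition of transitivity: the orbit of the first point decomposes an arbitrary pair of
permutations (`MulWeight.total_succ`), and the resulting recursion is the differential equation of
the formal exponential (`MulWeight.formalExp_connSeries`).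

For the matrix integral, the same exponential formula, applied to single permutations, expands
`exp (∑ tr M ^ j p_j / (j ε))` into products of traces over the cycles of a permutation
(`coeff_formalExp_trace`). Two facts about the Laguerre ensemble remain. The normalization integral
is computed by induction on the matrix size: a Schur complement splits off the first row, which
contributes a Gamma integral and Gaussian integrals (`lueWeight_integral`), and the product of Gamma
values is the quotient of Barnes functions in the definition (`barnesG_add_nat`). The moments of the
matrix entries are found from the invariance of the integral under `M ↦ A M Aᴴ`
(`integral_congruence`). Its derivative at `t = 0` along `A = 1 + t z E_{qp}`, for `z = 1` and
`z = i`, is the Schwinger–Dyson equation (`lueMoment_cons`), which expresses a moment of `d + 1`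
entries by moments of `d` entries. It has the form of the recursion for permutations by insertion of
a point, with a factor `n + α` for each cycle (`lueMoment_eq`). Summation over the matrix indices
contributes a factor `n` for each cycle of the other permutation (`integral_traceProd`), and the
powers of `ε` turn `n` and `n + α` into `x` and `x + a`. All integrals converge, since the entries of
a positive matrix are bounded by its trace (`norm_entry_le_trace`), powers of which are absorbed by
the exponential factor of the density (`integrable_trace_pow_mul_exp`).

With `x`, `a`, `ε` as indeterminates, the dessin partition function specializes to the ones above
(`map_specialize_dessin`), and is thus a formal LUE partition function. It is the only one, because
a Laurent polynomial in `ε` over `ℂ[x, a]` is determined by its values at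
`(n ε, α ε, ε)` (`IsFormalLUE.unique`).
-/


noncomputable section

open MeasureTheory
open scoped LaurentPolynomial ComplexOrder

namespace DessinLUE

section

open Equiv

/-! ### Orbits of tuples of permutations -/

/-- `y` can be reached from `x` by successively applying permutations of the family `g`. -/
def Reach {ι E : Type*} (g : ι → Perm E) : E → E → Prop :=
  Relation.ReflTransGen fun a b => ∃ i, g i a = b

/-- The family `g` of permutations is transitive. -/
def IsTransitive {ι E : Type*} (g : ι → Perm E) : Prop := ∀ x y, Reach g x y

section Reach

variable {ι E E' : Type*} {g : ι → Perm E} {g' : ι → Perm E'}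

lemma Reach.refl (x : E) : Reach g x x := Relation.ReflTransGen.refl

lemma Reach.trans {x y z : E} (h : Reach g x y) (h' : Reach g y z) : Reach g x z :=
  Relation.ReflTransGen.trans h h'

lemma Reach.apply (i : ι) (x : E) : Reach g x (g i x) := Relation.ReflTransGen.single ⟨i, rfl⟩

lemma Reach.mem {x y : E} (h : Reach g x y) {T : Set E} (hT : ∀ i, ∀ a ∈ T, g i a ∈ T)
    (hx : x ∈ T) : y ∈ T := by
  induction h with
  | refl => exact hx
  | tail _ hs ih => obtain ⟨i, rfl⟩ := hs; exact hT i _ ih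

lemma Reach.apply_symm [Finite E] (i : ι) (x : E) : Reach g (g i x) x := by
  have key : ∀ (n : ℕ) (y : E), Reach g y ((g i ^ n) y) := by
    intro n
    induction n with
    | zero => intro y; exact Reach.refl y
    | succ n ih =>
      intro y
      rw [pow_succ']
      exact (ih y).trans (Reach.apply i _)
  have h := key (orderOf (g i) - 1) (g i x)
  have h2 : (g i ^ (orderOf (g i) - 1)) (g i x) = x := by
    have hpos : 0 < orderOf (g i) := orderOf_pos (g i)
    rw [← Perm.mul_apply, ← pow_succ, Nat.sub_add_cancel hpos, pow_orderOf_eq_one]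
    rfl
  rwa [h2] at h

lemma Reach.symm [Finite E] {x y : E} (h : Reach g x y) : Reach g y x := by
  induction h with
  | refl => exact Reach.refl _
  | tail _ hs ih => obtain ⟨i, rfl⟩ := hs; exact (Reach.apply_symm i _).trans ih

lemma Reach.map (f : E → E') (hf : ∀ i x, f (g i x) = g' i (f x)) {x y : E} (h : Reach g x y) :
    Reach g' (f x) (f y) := by
  induction h with
  | refl => exact Reach.refl _
  | tail _ hs ih => obtain ⟨i, rfl⟩ := hs; rw [hf]; exact ih.trans (Reach.apply i _)

lemma isTransitive_permCongr (e : E ≃ E') :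
    IsTransitive (fun i => e.permCongr (g i)) ↔ IsTransitive g := by
  constructor
  · intro h x y
    have := (h (e x) (e y)).map (g' := g) e.symm (fun i x => by simp [Equiv.permCongr_apply])
    simpa using this
  · intro h x y
    have := (h (e.symm x) (e.symm y)).map (g' := fun i => e.permCongr (g i)) e
      (fun i x => by simp [Equiv.permCongr_apply])
    simpa using this

lemma reach_sumCongr_inl {x : E} {z : E ⊕ E'} :
    Reach (fun i => Perm.sumCongr (g i) (g' i)) (Sum.inl x) z ↔ ∃ y, z = Sum.inl y ∧ Reach g x y := by
  constructor
  · intro h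
    refine h.mem (T := {z | ∃ y, z = Sum.inl y ∧ Reach g x y}) ?_ ⟨x, rfl, Reach.refl x⟩
    rintro i _ ⟨y, rfl, hy⟩
    exact ⟨g i y, by simp, hy.trans (Reach.apply i y)⟩
  · rintro ⟨y, rfl, hy⟩
    exact hy.map Sum.inl (fun i x => by simp)

lemma isPretransitive_closure_iff [Finite E] :
    MulAction.IsPretransitive (Subgroup.closure (Set.range g)) E ↔ IsTransitive g := by
  constructor
  · intro h x y
    obtain ⟨⟨s, hs⟩, hxy⟩ := h.exists_smul_eq x y
    have key : ∀ s ∈ Subgroup.closure (Set.range g), ∀ x, Reach g x (s x) := by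
      intro s hs
      induction hs using Subgroup.closure_induction with
      | mem s hs => obtain ⟨i, rfl⟩ := hs; exact Reach.apply i
      | one => exact Reach.refl
      | mul a b _ _ ha hb => intro x; exact (hb x).trans (ha (b x))
      | inv a _ ha => intro x; simpa using (ha (a⁻¹ x)).symm
    have := key s hs x
    rw [← hxy]; exact this
  · intro h
    refine ⟨fun x y => ?_⟩
    refine (h x y).mem (T := {y | ∃ s : Subgroup.closure (Set.range g), s • x = y}) ?_
      ⟨1, one_smul _ _⟩
    rintro i _ ⟨s, rfl⟩
    exact ⟨⟨g i, Subgroup.subset_closure ⟨i, rfl⟩⟩ * s, mul_smul _ _ _⟩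

end Reach

/-! ### The exponential formula for weights of tuples of permutations -/

/-- A weight on `ι`-tuples of permutations of finite sets, with values in `S`, that is invariant
under relabelling and multiplicative under disjoint unions. -/
structure MulWeight (ι S : Type*) [CommSemiring S] where
  /-- the weight of a tuple -/
  w : ∀ {E : Type}, (ι → Perm E) → S
  w_congr : ∀ {E E' : Type} [Finite E] (e : E ≃ E') (g : ι → Perm E),
    w (fun i => e.permCongr (g i)) = w g
  w_empty : ∀ {E : Type} [IsEmpty E] (g : ι → Perm E), w g = 1
  w_sum : ∀ {E E' : Type} [Finite E] [Finite E'] (g : ι → Perm E) (g' : ι → Perm E'),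
    w (fun i => Perm.sumCongr (g i) (g' i)) = w g * w g'

namespace MulWeight

open scoped Classical in
/-- The total weight of all tuples of permutations of `Fin d`. -/
def total {ι S : Type*} [CommSemiring S] [Fintype ι] (W : MulWeight ι S) (d : ℕ) : S :=
  ∑ g : ι → Perm (Fin d), W.w g

open scoped Classical in
/-- The total weight of all transitive tuples of permutations of `Fin d`. -/
def conn {ι S : Type*} [CommSemiring S] [Fintype ι] (W : MulWeight ι S) (d : ℕ) : S :=
  ∑ g : ι → Perm (Fin d) with IsTransitive g, W.w g

variable {ι S : Type*} [CommSemiring S] [Fintype ι] (W : MulWeight ι S)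

lemma total_eq (d : ℕ) [Fintype (ι → Perm (Fin d))] :
    W.total d = ∑ g : ι → Perm (Fin d), W.w g := by
  unfold total; congr!

lemma conn_eq (d : ℕ) [Fintype (ι → Perm (Fin d))]
    [DecidablePred fun g : ι → Perm (Fin d) => IsTransitive g] :
    W.conn d = ∑ g : ι → Perm (Fin d), if IsTransitive g then W.w g else 0 := by
  rw [conn, Finset.sum_filter]; congr!

open scoped Classical in
lemma sum_eq_total {E : Type} [Fintype E] {d : ℕ} (h : Fintype.card E = d) :
    ∑ g : ι → Perm E, W.w g = W.total d := by
  have e : E ≃ Fin d := Fintype.equivFinOfCardEq h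
  refine Fintype.sum_equiv (Equiv.piCongrRight fun _ => e.permCongr) _ _ fun g => ?_
  exact (W.w_congr e g).symm

open scoped Classical in
lemma sum_eq_conn {E : Type} [Fintype E] {d : ℕ} (h : Fintype.card E = d) :
    ∑ g : ι → Perm E with IsTransitive g, W.w g = W.conn d := by
  have e : E ≃ Fin d := Fintype.equivFinOfCardEq h
  unfold conn
  rw [Finset.sum_filter, Finset.sum_filter]
  refine Fintype.sum_equiv (Equiv.piCongrRight fun _ => e.permCongr) _ _ fun g => ?_
  have h1 := W.w_congr e g
  have h2 := isTransitive_permCongr (g := g) e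
  change _ = if IsTransitive (fun i => e.permCongr (g i)) then W.w (fun i => e.permCongr (g i)) else 0
  rw [h1]
  simp only [h2]

open scoped Classical in
lemma sum_orbit_eq {E : Type} [Fintype E] (x₀ : E) (s : Finset E) (hs : x₀ ∈ s) :
    ∑ g : ι → Perm E with (∀ y, Reach g x₀ y ↔ y ∈ s), W.w g =
      W.conn s.card * W.total (Fintype.card E - s.card) := by
  have hc : Fintype.card {x // ¬ x ∈ s} = Fintype.card E - s.card := by
    rw [Fintype.card_subtype_compl, Fintype.card_coe]
  rw [← W.sum_eq_conn (Fintype.card_coe s), ← W.sum_eq_total hc, Finset.sum_mul_sum,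
    ← Finset.sum_product']
  symm
  let e : {x // x ∈ s} ⊕ {x // ¬ x ∈ s} ≃ E := Equiv.sumCompl (· ∈ s)
  refine Finset.sum_bij
    (fun (p : (ι → Perm {x // x ∈ s}) × (ι → Perm {x // ¬ x ∈ s})) _ =>
      (fun i => e.permCongr (Perm.sumCongr (p.1 i) (p.2 i)))) ?_ ?_ ?_ ?_
  · rintro ⟨g₁, g₂⟩ hg
    simp only [Finset.mem_product, Finset.mem_filter, Finset.mem_univ, true_and, and_true] at hg
    simp only [Finset.mem_filter, Finset.mem_univ, true_and]
    intro y
    have hr : Reach (fun i => e.permCongr (Perm.sumCongr (g₁ i) (g₂ i))) x₀ y ↔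
        Reach (fun i => Perm.sumCongr (g₁ i) (g₂ i)) (Sum.inl ⟨x₀, hs⟩) (e.symm y) := by
      constructor
      · intro h
        have := h.map (g' := fun i => Perm.sumCongr (g₁ i) (g₂ i)) e.symm
          (fun i x => by simp [Equiv.permCongr_apply])
        rwa [show e.symm x₀ = Sum.inl ⟨x₀, hs⟩ from by rw [Equiv.symm_apply_eq]; rfl] at this
      · intro h
        have := h.map (g' := fun i => e.permCongr (Perm.sumCongr (g₁ i) (g₂ i))) e
          (fun i x => by simp [Equiv.permCongr_apply])
        rwa [e.apply_symm_apply] at this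
    rw [hr, reach_sumCongr_inl]
    constructor
    · rintro ⟨z, hz, _⟩
      rw [Equiv.symm_apply_eq] at hz
      rw [hz]; exact z.2
    · intro hy
      exact ⟨⟨y, hy⟩, by rw [Equiv.symm_apply_eq]; rfl, hg _ _⟩
  · rintro ⟨g₁, g₂⟩ _ ⟨h₁, h₂⟩ _ h
    have : ∀ i, g₁ i = h₁ i ∧ g₂ i = h₂ i := by
      intro i
      have := e.permCongr.injective (congrFun h i)
      have := Perm.sumCongrHom_injective (a₁ := (g₁ i, g₂ i)) (a₂ := (h₁ i, h₂ i)) this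
      exact Prod.ext_iff.mp this
    exact Prod.ext (funext fun i => (this i).1) (funext fun i => (this i).2)
  · intro g hg
    simp only [Finset.mem_filter, Finset.mem_univ, true_and] at hg
    have hinv : ∀ i x, g i x ∈ s ↔ x ∈ s := by
      intro i x
      rw [← hg, ← hg]
      exact ⟨fun h => h.trans (Reach.apply_symm i x), fun h => h.trans (Reach.apply i x)⟩
    have hinv' : ∀ i x, ¬ g i x ∈ s ↔ ¬ x ∈ s := fun i x => not_congr (hinv i x)
    refine ⟨(fun i => (g i).subtypePerm (hinv i), fun i => (g i).subtypePerm (hinv' i)), ?_, ?_⟩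
    · simp only [Finset.mem_product, Finset.mem_filter, Finset.mem_univ, true_and, and_true]
      have key : ∀ y (hy : Reach g x₀ y),
          Reach (fun i => (g i).subtypePerm (hinv i)) ⟨x₀, hs⟩ ⟨y, (hg y).1 hy⟩ := by
        intro y hy
        induction hy with
        | refl => exact Reach.refl _
        | tail h1 h2 ih =>
          obtain ⟨i, rfl⟩ := h2
          exact ih.trans (Reach.apply (g := fun i => (g i).subtypePerm (hinv i)) i ⟨_, (hg _).1 h1⟩)
      intro x y
      exact (key x ((hg _).2 x.2)).symm.trans (key y ((hg _).2 y.2))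
    · funext i
      ext x
      obtain ⟨z, rfl⟩ := e.surjective x
      rcases z with z | z <;> simp [e, Equiv.permCongr_apply]
  · rintro ⟨g₁, g₂⟩ _
    rw [W.w_congr e, W.w_sum]

/-- The exponential formula as a recursion, by the orbit of the first point. -/
theorem total_succ (d : ℕ) :
    W.total (d + 1) = ∑ k ∈ Finset.range (d + 1),
      (d.choose k : S) * (W.conn (k + 1) * W.total (d - k)) := by
  classical
  have h1 : W.total (d + 1) = ∑ s : Finset (Fin (d + 1)) with (0 : Fin (d + 1)) ∈ s,
      W.conn s.card * W.total (d + 1 - s.card) := by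
    rw [total, ← Finset.sum_fiberwise_of_maps_to
      (g := fun g => Finset.univ.filter fun y => Reach g 0 y)
      (t := Finset.univ.filter fun s : Finset (Fin (d + 1)) => (0 : Fin (d + 1)) ∈ s)]
    · refine Finset.sum_congr rfl fun s hs => ?_
      have := W.sum_orbit_eq (0 : Fin (d + 1)) s (Finset.mem_filter.mp hs).2
      rw [Fintype.card_fin] at this
      rw [← this]
      refine Finset.sum_congr ?_ fun _ _ => rfl
      ext g
      simp [Finset.ext_iff]
    · intro g _
      simp [Reach.refl]
  have h2 : ∑ s : Finset (Fin (d + 1)) with (0 : Fin (d + 1)) ∈ s,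
      W.conn s.card * W.total (d + 1 - s.card) =
      ∑ s : Finset (Fin d), W.conn (s.card + 1) * W.total (d - s.card) := by
    symm
    refine Finset.sum_bij
      (fun s _ => insert 0 (s.map (Fin.succEmb d))) ?_ ?_ ?_ ?_
    · intro s _; simp
    · intro s _ t _ h
      have h0 : ∀ u : Finset (Fin d), (0 : Fin (d + 1)) ∉ u.map (Fin.succEmb d) := by
        intro u; simp
      have := congrArg (fun u => u.erase 0) h
      simpa [Finset.erase_insert (h0 _)] using this
    · intro t ht
      have ht := (Finset.mem_filter.mp ht).2
      refine ⟨Finset.univ.filter fun x => Fin.succ x ∈ t, Finset.mem_univ _, ?_⟩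
      ext x
      refine Fin.cases ?_ (fun x => ?_) x
      · simp [ht]
      · simp
    · intro s _
      have h0 : (0 : Fin (d + 1)) ∉ s.map (Fin.succEmb d) := by simp
      rw [Finset.card_insert_of_notMem h0, Finset.card_map]
      congr 2
      omega
  rw [h1, h2, ← Finset.sum_fiberwise_of_maps_to (g := Finset.card) (t := Finset.range (d + 1))]
  · refine Finset.sum_congr rfl fun k _ => ?_
    have : ∀ s ∈ (Finset.univ : Finset (Finset (Fin d))).filter (fun s => s.card = k),
        W.conn (s.card + 1) * W.total (d - s.card) = W.conn (k + 1) * W.total (d - k) := by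
      intro s hs
      rw [(Finset.mem_filter.mp hs).2]
    rw [Finset.sum_congr rfl this, Finset.sum_const, nsmul_eq_mul]
    congr 2
    rw [Finset.univ_filter_card_eq, Finset.card_powersetCard, Finset.card_univ, Fintype.card_fin]
  · intro s _
    have := Finset.card_le_univ s
    rw [Fintype.card_fin] at this
    simp; omega

end MulWeight

end

section

open Equiv

/-! ### Cycles of a permutation -/

/-- The number of cycles of a permutation, fixed points included. -/
def cyc {E : Type*} (σ : Perm E) : ℕ := Nat.card (Cycles σ)

/-- The length of a cycle. -/
def cycLen {E : Type*} (σ : Perm E) (c : Cycles σ) : ℕ :=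
  Nat.card {x : E // (Quotient.mk _ x : Cycles σ) = c}

/-- The cycle type of a permutation as the exponent vector of the monomial `∏ p_j`, over all cycles,
`j` being the length of the cycle. -/
def cycExp {E : Type*} (σ : Perm E) : ℕ+ →₀ ℕ :=
  ∑ᶠ c : Cycles σ, Finsupp.single (cycLen σ c).toPNat' 1

/-- The weighted degree of a monomial, `p_j` having degree `j`. -/
def wt : (ℕ+ →₀ ℕ) →+ ℕ := Finsupp.weight (fun j : ℕ+ => (j : ℕ))

lemma wt_single (j : ℕ+) (k : ℕ) : wt (Finsupp.single j k) = k * j := by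
  simp [wt, Finsupp.weight_single]

section Cycles

variable {E E' : Type*}

/-- Conjugation by `e` carries cycles to cycles. -/
def cyclesCongr (e : E ≃ E') (σ : Perm E) : Cycles σ ≃ Cycles (e.permCongr σ) :=
  Quotient.congr e fun a b => by
    change Perm.SameCycle _ _ _ ↔ Perm.SameCycle _ _ _
    constructor
    · rintro ⟨i, rfl⟩
      refine ⟨i, ?_⟩
      have : (e.permCongr σ) ^ i = e.permCongr (σ ^ i) :=
        (map_zpow (e.permCongrHom) σ i).symm
      rw [this]; simp
    · rintro ⟨i, h⟩
      refine ⟨i, ?_⟩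
      have : (e.permCongr σ) ^ i = e.permCongr (σ ^ i) :=
        (map_zpow (e.permCongrHom) σ i).symm
      rw [this] at h; simpa using h

lemma cyclesCongr_mk (e : E ≃ E') (σ : Perm E) (x : E) :
    cyclesCongr e σ (Quotient.mk _ x) = Quotient.mk _ (e x) := rfl

lemma cyc_permCongr (e : E ≃ E') (σ : Perm E) : cyc (e.permCongr σ) = cyc σ :=
  (Nat.card_congr (cyclesCongr e σ)).symm

lemma cycLen_cyclesCongr (e : E ≃ E') (σ : Perm E) (c : Cycles σ) :
    cycLen (e.permCongr σ) (cyclesCongr e σ c) = cycLen σ c := by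
  refine (Nat.card_congr (Equiv.subtypeEquiv e fun x => ?_)).symm
  rw [← cyclesCongr_mk, (cyclesCongr e σ).apply_eq_iff_eq]

lemma cycExp_permCongr (e : E ≃ E') (σ : Perm E) : cycExp (e.permCongr σ) = cycExp σ := by
  unfold cycExp
  rw [← finsum_comp_equiv (cyclesCongr e σ)]
  simp_rw [cycLen_cyclesCongr]

lemma sumCongr_zpow (σ : Perm E) (τ : Perm E') (i : ℤ) :
    Perm.sumCongr σ τ ^ i = Perm.sumCongr (σ ^ i) (τ ^ i) :=
  (map_zpow (Perm.sumCongrHom E E') (σ, τ) i).symm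

/-- The cycles of a disjoint union of permutations. -/
def cyclesSum (σ : Perm E) (τ : Perm E') : Cycles σ ⊕ Cycles τ ≃ Cycles (Perm.sumCongr σ τ) where
  toFun := Sum.elim
    (Quotient.map Sum.inl fun a b => by rintro ⟨i, rfl⟩; exact ⟨i, by simp [sumCongr_zpow]⟩)
    (Quotient.map Sum.inr fun a b => by rintro ⟨i, rfl⟩; exact ⟨i, by simp [sumCongr_zpow]⟩)
  invFun := Quotient.lift (Sum.map (Quotient.mk _) (Quotient.mk _)) <| by
    rintro (a | a) (b | b) ⟨i, h⟩ <;> rw [sumCongr_zpow] at h <;> simp at h ⊢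
    · exact Quotient.sound ⟨i, h⟩
    · exact Quotient.sound ⟨i, h⟩
  left_inv := by rintro (⟨⟨a⟩⟩ | ⟨⟨a⟩⟩) <;> rfl
  right_inv := by rintro ⟨a | a⟩ <;> rfl

lemma cyc_sumCongr [Finite E] [Finite E'] (σ : Perm E) (τ : Perm E') :
    cyc (Perm.sumCongr σ τ) = cyc σ + cyc τ := by
  unfold cyc
  rw [← Nat.card_congr (cyclesSum σ τ), Nat.card_sum]

lemma cycLen_inl (σ : Perm E) (τ : Perm E') (c : Cycles σ) :
    cycLen (Perm.sumCongr σ τ) (cyclesSum σ τ (Sum.inl c)) = cycLen σ c := by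
  symm
  refine Nat.card_congr (Equiv.ofBijective (fun x => ⟨Sum.inl x.1, ?_⟩) ⟨?_, ?_⟩)
  · exact congrArg (fun c => cyclesSum σ τ (Sum.inl c)) x.2
  · intro x y h; simpa [Subtype.ext_iff] using h
  · rintro ⟨x, hx⟩
    have hx' := (Equiv.symm_apply_eq _).mpr hx
    rcases x with x | x
    · exact ⟨⟨x, Sum.inl_injective hx'⟩, rfl⟩
    · exact absurd hx' (by simp [cyclesSum])

lemma cycLen_inr (σ : Perm E) (τ : Perm E') (c : Cycles τ) :
    cycLen (Perm.sumCongr σ τ) (cyclesSum σ τ (Sum.inr c)) = cycLen τ c := by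
  symm
  refine Nat.card_congr (Equiv.ofBijective (fun x => ⟨Sum.inr x.1, ?_⟩) ⟨?_, ?_⟩)
  · exact congrArg (fun c => cyclesSum σ τ (Sum.inr c)) x.2
  · intro x y h; simpa [Subtype.ext_iff] using h
  · rintro ⟨x, hx⟩
    have hx' := (Equiv.symm_apply_eq _).mpr hx
    rcases x with x | x
    · exact absurd hx' (by simp [cyclesSum])
    · exact ⟨⟨x, Sum.inr_injective hx'⟩, rfl⟩

lemma cycExp_sumCongr [Finite E] [Finite E'] (σ : Perm E) (τ : Perm E') :
    cycExp (Perm.sumCongr σ τ) = cycExp σ + cycExp τ := by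
  have := Fintype.ofFinite (Cycles σ)
  have := Fintype.ofFinite (Cycles τ)
  unfold cycExp
  rw [← finsum_comp_equiv (cyclesSum σ τ)]
  simp only [finsum_eq_sum_of_fintype, Fintype.sum_sum_type, cycLen_inl, cycLen_inr]

lemma cyc_of_isEmpty [IsEmpty E] (σ : Perm E) : cyc σ = 0 := by
  have : IsEmpty (Cycles σ) := ⟨fun c => isEmptyElim c.out⟩
  simp [cyc]

lemma cycExp_of_isEmpty [IsEmpty E] (σ : Perm E) : cycExp σ = 0 := by
  have : IsEmpty (Cycles σ) := ⟨fun c => isEmptyElim c.out⟩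
  rw [cycExp, finsum_of_isEmpty]

lemma cycLen_pos [Finite E] (σ : Perm E) (c : Cycles σ) : 0 < cycLen σ c := by
  have : Nonempty {x : E // (Quotient.mk _ x : Cycles σ) = c} := ⟨⟨c.out, Quotient.out_eq c⟩⟩
  exact Nat.card_pos

lemma coe_cycLen [Finite E] (σ : Perm E) (c : Cycles σ) :
    (((cycLen σ c).toPNat' : ℕ+) : ℕ) = cycLen σ c := by
  simp [(cycLen_pos σ c)]

lemma sum_cycLen [Finite E] (σ : Perm E) : ∑ᶠ c, cycLen σ c = Nat.card E := by
  have := Fintype.ofFinite (Cycles σ)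
  rw [finsum_eq_sum_of_fintype]
  unfold cycLen
  rw [← Nat.card_sigma]
  exact Nat.card_congr (Equiv.sigmaFiberEquiv _)

lemma wt_cycExp [Finite E] (σ : Perm E) : wt (cycExp σ) = Nat.card E := by
  have := Fintype.ofFinite (Cycles σ)
  rw [← sum_cycLen σ, cycExp, finsum_eq_sum_of_fintype, finsum_eq_sum_of_fintype, map_sum]
  simp only [wt_single, coe_cycLen, one_mul]

lemma degree_cycExp [Finite E] (σ : Perm E) : (cycExp σ).degree = cyc σ := by
  have := Fintype.ofFinite (Cycles σ)
  rw [cycExp, finsum_eq_sum_of_fintype, map_sum, cyc, Nat.card_eq_fintype_card]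
  simp

end Cycles

/-! ### Invariant functions and insertion of a point into a permutation -/

/-- Functions that are constant on the cycles of `σ`. -/
def invariantFunEquiv {E X : Type*} (σ : Perm E) :
    {f : E → X // ∀ x, f (σ x) = f x} ≃ (Cycles σ → X) where
  toFun f := Quotient.lift f.1 (by
    rintro a _ ⟨i, rfl⟩
    have hinv : ∀ x, f.1 (σ⁻¹ x) = f.1 x := fun x => by
      rw [← f.2 (σ⁻¹ x)]
      exact congrArg f.1 (σ.apply_symm_apply x)
    induction i using Int.induction_on with
    | zero => simp
    | succ n ih =>
      rw [ih, add_comm, zpow_add, Perm.mul_apply, zpow_one, f.2]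
    | pred n ih =>
      rw [ih, sub_eq_add_neg, add_comm, zpow_add, Perm.mul_apply, zpow_neg_one, hinv])
  invFun h := ⟨fun x => h (Quotient.mk _ x), fun x => congrArg h
    (Quotient.sound (s := Perm.SameCycle.setoid σ)
      (Perm.sameCycle_apply_left.mpr (Perm.SameCycle.refl σ x)))⟩
  left_inv f := rfl
  right_inv h := by funext c; induction c using Quotient.inductionOn; rfl

lemma card_invariantFun {E : Type*} [Finite E] (σ : Perm E) (n : ℕ) :
    Nat.card {f : E → Fin n // ∀ x, f (σ x) = f x} = n ^ cyc σ := by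
  rw [Nat.card_congr (invariantFunEquiv σ), Nat.card_fun, Nat.card_fin, cyc]

/-- Insertion of a point `0` into a permutation `τ`: a new fixed point, or a point inserted in front
of a given point of a cycle. -/
abbrev insertZero {d : ℕ} (p : Fin (d + 1)) (τ : Perm (Fin d)) : Perm (Fin (d + 1)) :=
  Perm.decomposeFin.symm (p, τ)

lemma insertZero_zero {d : ℕ} (p : Fin (d + 1)) (τ : Perm (Fin d)) : insertZero p τ 0 = p :=
  Perm.decomposeFin_symm_apply_zero p τ

lemma insertZero_fixed {d : ℕ} (τ : Perm (Fin d)) (x : Fin d) :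
    insertZero 0 τ x.succ = (τ x).succ := by
  rw [insertZero, Perm.decomposeFin_symm_apply_succ]; simp

lemma insertZero_succ {d : ℕ} (p : Fin d) (τ : Perm (Fin d)) (x : Fin d) :
    insertZero p.succ τ x.succ = if τ x = p then 0 else (τ x).succ := by
  rw [insertZero, Perm.decomposeFin_symm_apply_succ]
  split_ifs with h
  · rw [h, swap_apply_right]
  · rw [swap_apply_of_ne_of_ne (Fin.succ_ne_zero _) (fun h' => h (Fin.succ_injective _ h'))]

/-- The functions invariant under `insertZero p.succ τ` are those invariant under `τ`, extended to
the new point by the value at `p`. -/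
lemma cyc_insertZero_succ {d : ℕ} (p : Fin d) (τ : Perm (Fin d)) :
    cyc (insertZero p.succ τ) = cyc τ := by
  refine Nat.pow_right_injective le_rfl (?_ : 2 ^ _ = 2 ^ _)
  rw [← card_invariantFun, ← card_invariantFun]
  refine Nat.card_congr
    { toFun := fun f => ⟨fun x => f.1 x.succ, fun x => ?_⟩
      invFun := fun f => ⟨Fin.cons (f.1 p) f.1, fun x => ?_⟩
      left_inv := fun f => Subtype.ext (funext fun x => ?_)
      right_inv := fun f => rfl }
  · have h := f.2 x.succ
    rw [insertZero_succ] at h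
    split_ifs at h with hx
    · change f.1 (τ x).succ = f.1 x.succ
      rw [hx, ← h, ← f.2 0, insertZero_zero]
    · exact h
  · refine Fin.cases ?_ (fun x => ?_) x
    · rw [insertZero_zero]; simp
    · rw [insertZero_succ]
      split_ifs with h
      · simp [← h, f.2]
      · simp [f.2]
  · refine Fin.cases ?_ (fun x => ?_) x
    · have := f.2 0
      rw [insertZero_zero] at this
      simpa using this
    · simp

lemma cyc_insertZero_zero {d : ℕ} (τ : Perm (Fin d)) :
    cyc (insertZero 0 τ) = cyc τ + 1 := by
  refine Nat.pow_right_injective le_rfl (?_ : 2 ^ _ = 2 ^ _)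
  rw [← card_invariantFun, pow_succ, ← card_invariantFun, ← Nat.card_fin 2, ← Nat.card_prod,
    Nat.card_fin]
  refine Nat.card_congr
    { toFun := fun f => (⟨fun x => f.1 x.succ, fun x => ?_⟩, f.1 0)
      invFun := fun f => ⟨Fin.cons f.2 f.1.1, fun x => ?_⟩
      left_inv := fun f => Subtype.ext (funext fun x => ?_)
      right_inv := fun f => rfl }
  · have h := f.2 x.succ
    rwa [insertZero_fixed] at h
  · refine Fin.cases ?_ (fun x => ?_) x
    · rw [insertZero_zero]
    · rw [insertZero_fixed]; simp [f.1.2]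
  · refine Fin.cases ?_ (fun x => ?_) x <;> simp

lemma cyc_insertZero {d : ℕ} (p : Fin (d + 1)) (τ : Perm (Fin d)) :
    cyc (insertZero p τ) = cyc τ + if p = 0 then 1 else 0 := by
  refine Fin.cases ?_ (fun p => ?_) p
  · simp [cyc_insertZero_zero]
  · simp [cyc_insertZero_succ]

lemma isTransitive_iff_cyc {E : Type*} [Finite E] [Nonempty E] {g : Unit → Perm E} :
    IsTransitive g ↔ cyc (g ()) = 1 := by
  rw [cyc, Nat.card_eq_one_iff_unique]
  have hr : ∀ x y, Reach g x y ↔ (g ()).SameCycle x y := by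
    intro x y
    constructor
    · intro h
      refine h.mem (T := {y | (g ()).SameCycle x y}) ?_ (Perm.SameCycle.refl _ _)
      rintro ⟨⟩ a ha
      exact Perm.sameCycle_apply_right.mpr ha
    · intro h
      obtain ⟨i, -, rfl⟩ := h.exists_pow_eq'
      clear h
      induction i with
      | zero => exact Reach.refl _
      | succ n ih =>
        rw [pow_succ', Perm.mul_apply]; exact ih.trans (Reach.apply () _)
  constructor
  · intro h
    refine ⟨⟨?_⟩, ⟨Quotient.mk _ (Classical.arbitrary E)⟩⟩
    rintro ⟨a⟩ ⟨b⟩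
    exact Quotient.sound ((hr a b).1 (h a b))
  · rintro ⟨⟨h⟩, _⟩ a b
    exact (hr a b).2 (Quotient.exact (h (Quotient.mk _ a) (Quotient.mk _ b)))

end

section

open Equiv

/-! ### The formal exponential and the Euler derivation -/

lemma wt_eq_zero {e : ℕ+ →₀ ℕ} : wt e = 0 ↔ e = 0 := by
  rw [wt]
  have : Finsupp.NonTorsionWeight ℕ fun j : ℕ+ => (j : ℕ) :=
    Finsupp.nonTorsionWeight_of (R := ℕ) (w := fun j : ℕ+ => (j : ℕ)) fun j => j.pos.ne'
  exact Finsupp.weight_eq_zero_iff_eq_zero _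

section FormalExp

variable {R : Type*} [CommRing R]

/-- The derivation `∑ j p_j ∂/∂p_j`. -/
def euler (F : MvPowerSeries ℕ+ R) : MvPowerSeries ℕ+ R := fun e => (wt e : R) * F e

lemma coeff_euler (F : MvPowerSeries ℕ+ R) (e : ℕ+ →₀ ℕ) :
    MvPowerSeries.coeff e (euler F) = (wt e : R) * MvPowerSeries.coeff e F := rfl

lemma euler_mul (F G : MvPowerSeries ℕ+ R) : euler (F * G) = euler F * G + F * euler G := by
  classical
  ext e
  rw [coeff_euler, map_add, MvPowerSeries.coeff_mul, MvPowerSeries.coeff_mul,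
    MvPowerSeries.coeff_mul, Finset.mul_sum, ← Finset.sum_add_distrib]
  refine Finset.sum_congr rfl fun p hp => ?_
  rw [← Finset.HasAntidiagonal.mem_antidiagonal.mp hp, coeff_euler, coeff_euler, map_add]
  push_cast; ring

lemma euler_one : euler (1 : MvPowerSeries ℕ+ R) = 0 := by
  classical
  ext e
  rw [coeff_euler, MvPowerSeries.coeff_one]
  split_ifs with h
  · simp [h]
  · simp

lemma euler_pow_succ (F : MvPowerSeries ℕ+ R) (m : ℕ) :
    euler (F ^ (m + 1)) = ((m : R) + 1) • (euler F * F ^ m) := by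
  induction m with
  | zero => simp
  | succ m ih =>
    rw [pow_succ, euler_mul, ih]
    simp only [MvPowerSeries.smul_eq_C_mul, map_add, map_one, map_natCast]
    push_cast; ring

variable [Algebra ℚ R]

lemma coeff_formalExp {F : MvPowerSeries ℕ+ R} (hF : MvPowerSeries.constantCoeff F = 0)
    {e : ℕ+ →₀ ℕ} {N : ℕ} (hN : e.degree < N) :
    MvPowerSeries.coeff e (formalExp F) =
      ∑ m ∈ Finset.range N, ((m.factorial : ℚ)⁻¹) • MvPowerSeries.coeff e (F ^ m) := by
  rw [formalExp, PowerSeries.coeff_subst (PowerSeries.HasSubst.of_constantCoeff_zero hF),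
    finsum_eq_sum_of_support_subset _ (s := Finset.range N)]
  · refine Finset.sum_congr rfl fun m _ => ?_
    simp [PowerSeries.coeff_exp]
  · intro m hm
    rw [Function.mem_support] at hm
    simp only [Finset.coe_range, Set.mem_Iio]
    by_contra h
    refine hm ?_
    rw [MvPowerSeries.coeff_of_lt_order, smul_zero]
    have h1 : 1 ≤ F.order := MvPowerSeries.one_le_order_iff_constCoeff_eq_zero.mpr hF
    have h2 := MvPowerSeries.le_order_pow (f := F) m
    refine lt_of_lt_of_le ?_ h2
    refine lt_of_lt_of_le (b := (m : ℕ∞)) (by exact_mod_cast (by omega)) ?_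
    calc (m : ℕ∞) = m • (1 : ℕ∞) := by simp
      _ ≤ m • F.order := nsmul_le_nsmul_right h1 m

lemma constantCoeff_formalExp {F : MvPowerSeries ℕ+ R} (hF : MvPowerSeries.constantCoeff F = 0) :
    MvPowerSeries.constantCoeff (formalExp F) = 1 := by
  rw [← MvPowerSeries.coeff_zero_eq_constantCoeff_apply, coeff_formalExp hF (N := 1) (by simp)]
  simp

lemma euler_formalExp {F : MvPowerSeries ℕ+ R} (hF : MvPowerSeries.constantCoeff F = 0) :
    euler (formalExp F) = euler F * formalExp F := by
  classical
  ext e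
  rw [coeff_euler, coeff_formalExp hF (N := e.degree + 1 + 1) (by omega), Finset.sum_range_succ',
    mul_add, Finset.mul_sum]
  have h0 : (wt e : R) * (((Nat.factorial 0 : ℕ) : ℚ)⁻¹ • MvPowerSeries.coeff e (F ^ 0)) = 0 := by
    rw [mul_smul_comm, ← coeff_euler, pow_zero, euler_one]; simp
  rw [h0, add_zero, MvPowerSeries.coeff_mul]
  have h1 : ∀ p ∈ Finset.HasAntidiagonal.antidiagonal e, MvPowerSeries.coeff p.1 (euler F) *
      MvPowerSeries.coeff p.2 (formalExp F) = ∑ m ∈ Finset.range (e.degree + 1),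
        ((m.factorial : ℚ)⁻¹) • (MvPowerSeries.coeff p.1 (euler F) *
          MvPowerSeries.coeff p.2 (F ^ m)) := by
    intro p hp
    have hd : p.2.degree < e.degree + 1 := by
      rw [← Finset.HasAntidiagonal.mem_antidiagonal.mp hp, map_add]; omega
    rw [coeff_formalExp hF hd, Finset.mul_sum]
    simp_rw [mul_smul_comm]
  rw [Finset.sum_congr rfl h1, Finset.sum_comm]
  refine Finset.sum_congr rfl fun m _ => ?_
  rw [mul_smul_comm, ← coeff_euler, euler_pow_succ, ← Finset.smul_sum, ← MvPowerSeries.coeff_mul,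
    map_smul, smul_eq_mul, Nat.factorial_succ]
  have : ((m : R) + 1) = ((m + 1 : ℕ) : ℚ) • (1 : R) := by
    rw [Nat.cast_smul_eq_nsmul]; simp
  rw [this, smul_mul_assoc, one_mul, smul_smul]
  congr 1
  push_cast
  field_simp

/-- The exponential `Z = exp F` is determined by `Z(0) = 1` and the Euler equation. -/
lemma formalExp_eq {F Z : MvPowerSeries ℕ+ R} (hF : MvPowerSeries.constantCoeff F = 0)
    (hZ : MvPowerSeries.constantCoeff Z = 1) (h : euler Z = euler F * Z) : formalExp F = Z := by
  classical
  have key : ∀ (N : ℕ) (e : ℕ+ →₀ ℕ), wt e = N →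
      MvPowerSeries.coeff e (formalExp F) = MvPowerSeries.coeff e Z := by
    intro N
    induction N using Nat.strong_induction_on with
    | _ N ih =>
    intro e he
    by_cases h0 : e = 0
    · subst h0
      rw [MvPowerSeries.coeff_zero_eq_constantCoeff_apply,
        MvPowerSeries.coeff_zero_eq_constantCoeff_apply, constantCoeff_formalExp hF, hZ]
    · have h1 := congrArg (MvPowerSeries.coeff e) (euler_formalExp hF)
      have h2 := congrArg (MvPowerSeries.coeff e) h
      rw [coeff_euler, MvPowerSeries.coeff_mul] at h1 h2
      have h3 : (wt e : R) * MvPowerSeries.coeff e (formalExp F) =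
          (wt e : R) * MvPowerSeries.coeff e Z := by
        rw [h1, h2]
        refine Finset.sum_congr rfl fun p hp => ?_
        have hp' := Finset.HasAntidiagonal.mem_antidiagonal.mp hp
        by_cases hp0 : p.1 = 0
        · rw [coeff_euler, hp0]; simp
        · congr 1
          refine ih (wt p.2) ?_ _ rfl
          rw [← he, ← hp', map_add]
          have : wt p.1 ≠ 0 := fun h => hp0 (wt_eq_zero.mp h)
          omega
      have h4 : ∀ x : R, (wt e : R) * x = (wt e : ℚ) • x := fun x => by
        rw [Nat.cast_smul_eq_nsmul, nsmul_eq_mul]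
      rw [h4, h4] at h3
      have h5 : (wt e : ℚ) ≠ 0 := by
        exact_mod_cast fun h => h0 (wt_eq_zero.mp h)
      have := congrArg (fun x => (wt e : ℚ)⁻¹ • x) h3
      simpa [smul_smul, inv_mul_cancel₀ h5] using this
  exact MvPowerSeries.ext fun e => key _ e rfl

namespace MulWeight

variable {ι : Type*} [Fintype ι] (W : MulWeight ι (MvPowerSeries ℕ+ R))

/-- The exponential generating series of transitive tuples. -/
def connSeries : MvPowerSeries ℕ+ R := fun e =>
  if e = 0 then 0 else (((wt e).factorial : ℚ)⁻¹) • MvPowerSeries.coeff e (W.conn (wt e))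

/-- The exponential generating series of all tuples. -/
def totalSeries : MvPowerSeries ℕ+ R := fun e =>
  (((wt e).factorial : ℚ)⁻¹) • MvPowerSeries.coeff e (W.total (wt e))

lemma coeff_connSeries {e : ℕ+ →₀ ℕ} (he : e ≠ 0) : MvPowerSeries.coeff e W.connSeries =
    (((wt e).factorial : ℚ)⁻¹) • MvPowerSeries.coeff e (W.conn (wt e)) := if_neg he

lemma coeff_totalSeries (e : ℕ+ →₀ ℕ) : MvPowerSeries.coeff e W.totalSeries =
    (((wt e).factorial : ℚ)⁻¹) • MvPowerSeries.coeff e (W.total (wt e)) := rfl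

/-- The exponential formula: the generating series of all tuples of permutations is the exponential
of the generating series of the transitive ones. -/
theorem formalExp_connSeries
    (hW : ∀ (d : ℕ) (g : ι → Perm (Fin d)) (e : ℕ+ →₀ ℕ), wt e ≠ d →
      MvPowerSeries.coeff e (W.w g) = 0) :
    formalExp W.connSeries = W.totalSeries := by
  classical
  have hconn : ∀ (d : ℕ) (e : ℕ+ →₀ ℕ), wt e ≠ d → MvPowerSeries.coeff e (W.conn d) = 0 := by
    intro d e he
    rw [conn, map_sum]
    exact Finset.sum_eq_zero fun g _ => hW d g e he
  refine formalExp_eq ?_ ?_ ?_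
  · rw [← MvPowerSeries.coeff_zero_eq_constantCoeff_apply]
    change W.connSeries 0 = 0
    simp [connSeries]
  · rw [← MvPowerSeries.coeff_zero_eq_constantCoeff_apply, coeff_totalSeries, map_zero, total,
      Finset.sum_congr rfl fun g _ => W.w_empty g]
    simp
  ext e
  by_cases h0 : e = 0
  · subst h0
    rw [coeff_euler, MvPowerSeries.coeff_mul]
    simp [coeff_euler]
  obtain ⟨d, hd⟩ : ∃ d, wt e = d + 1 :=
    Nat.exists_eq_succ_of_ne_zero fun h => h0 (wt_eq_zero.mp h)
  have hn : ∀ (n : ℕ) (x : R), (n : R) * x = (n : ℚ) • x := fun n x => by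
    rw [Nat.cast_smul_eq_nsmul, nsmul_eq_mul]
  rw [coeff_euler, coeff_totalSeries, hd, W.total_succ, map_sum, MvPowerSeries.coeff_mul]
  have h1 : ∀ k ∈ Finset.range (d + 1), MvPowerSeries.coeff e
      ((d.choose k : MvPowerSeries ℕ+ R) * (W.conn (k + 1) * W.total (d - k))) =
      ∑ p ∈ Finset.HasAntidiagonal.antidiagonal e, (d.choose k : ℚ) •
        (MvPowerSeries.coeff p.1 (W.conn (k + 1)) * MvPowerSeries.coeff p.2 (W.total (d - k))) := by
    intro k _
    rw [← nsmul_eq_mul, map_nsmul, MvPowerSeries.coeff_mul, ← Finset.smul_sum,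
      Nat.cast_smul_eq_nsmul]
  rw [Finset.sum_congr rfl h1, Finset.sum_comm, Finset.smul_sum, Finset.mul_sum]
  refine Finset.sum_congr rfl fun p hp => ?_
  have hp' := congrArg wt (Finset.HasAntidiagonal.mem_antidiagonal.mp hp)
  rw [map_add, hd] at hp'
  by_cases hp0 : p.1 = 0
  · rw [coeff_euler, hp0, Finset.sum_eq_zero]
    · simp
    · intro k _
      rw [hconn (k + 1) 0 (by simp)]; simp
  obtain ⟨k, hk⟩ : ∃ k, wt p.1 = k + 1 :=
    Nat.exists_eq_succ_of_ne_zero fun h => hp0 (wt_eq_zero.mp h)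
  rw [Finset.sum_eq_single_of_mem k (by simp; omega)]
  · have hdk : d - k = wt p.2 := by omega
    rw [coeff_euler, W.coeff_connSeries hp0, coeff_totalSeries, hdk, hk]
    rw [hn, hn, smul_smul, smul_smul, smul_smul, smul_mul_smul_comm]
    congr 1
    have hkd : k ≤ d := by omega
    rw [Nat.cast_choose ℚ hkd, hdk, Nat.factorial_succ, Nat.factorial_succ]
    have a1 : (d.factorial : ℚ) ≠ 0 := by positivity
    have a2 : (k.factorial : ℚ) ≠ 0 := by positivity
    have a3 : ((wt p.2).factorial : ℚ) ≠ 0 := by positivity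
    push_cast
    field_simp
  · intro k' _ hk'
    rw [hconn (k' + 1) p.1 (by omega)]; simp

end MulWeight

end FormalExp

end

section

open Equiv

/-! ### Products of traces of powers -/

section Trace

variable {n : ℕ} {K : Type*} [CommRing K]

/-- The product of `tr M ^ j` over all cycles of `σ`, `j` being the length of the cycle, in the form
of a sum over indices. -/
def traceProd (M : Matrix (Fin n) (Fin n) K) {E : Type*} (σ : Perm E) : K :=
  ∑ᶠ i : E → Fin n, ∏ᶠ e, M (i e) (i (σ e))

lemma traceProd_eq (M : Matrix (Fin n) (Fin n) K) {E : Type*} [Fintype E] [DecidableEq E]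
    (σ : Perm E) : traceProd M σ = ∑ i : E → Fin n, ∏ e, M (i e) (i (σ e)) := by
  simp only [traceProd, finsum_eq_sum_of_fintype, finprod_eq_prod_of_fintype]

lemma traceProd_permCongr (M : Matrix (Fin n) (Fin n) K) {E E' : Type*} (f : E ≃ E') (σ : Perm E) :
    traceProd M (f.permCongr σ) = traceProd M σ := by
  unfold traceProd
  rw [← finsum_comp_equiv (f.arrowCongr (Equiv.refl (Fin n)))]
  refine finsum_congr fun i => ?_
  rw [← finprod_comp_equiv f]
  simp [Equiv.permCongr_apply]

lemma traceProd_sumCongr (M : Matrix (Fin n) (Fin n) K) {E E' : Type*} [Finite E] [Finite E']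
    (σ : Perm E) (τ : Perm E') :
    traceProd M (Perm.sumCongr σ τ) = traceProd M σ * traceProd M τ := by
  classical
  have := Fintype.ofFinite E
  have := Fintype.ofFinite E'
  rw [traceProd_eq, traceProd_eq, traceProd_eq, Finset.sum_mul_sum, ← Fintype.sum_prod_type']
  refine Fintype.sum_equiv (Equiv.sumArrowEquivProdArrow E E' (Fin n)) _ _ fun i => ?_
  rw [Fintype.prod_sum_type]
  rfl

lemma traceProd_of_isEmpty (M : Matrix (Fin n) (Fin n) K) {E : Type*} [IsEmpty E] (σ : Perm E) :
    traceProd M σ = 1 := by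
  classical
  have := Fintype.ofIsEmpty (α := E)
  rw [traceProd_eq]; simp

/-- For a transitive permutation the sum over indices is a trace. The matrix is allowed to carry an
exponent depending on the point, so that the sum over one index merges two points. -/
lemma sum_prod_pow_eq_trace (M : Matrix (Fin n) (Fin n) K) (d : ℕ) :
    ∀ (σ : Perm (Fin (d + 1))) (a : Fin (d + 1) → ℕ), cyc σ = 1 →
      ∑ i : Fin (d + 1) → Fin n, ∏ e, (M ^ a e) (i e) (i (σ e)) = (M ^ ∑ e, a e).trace := by
  induction d with
  | zero =>
    intro σ a _
    rw [Matrix.trace, ← (Equiv.funUnique (Fin 1) (Fin n)).symm.sum_comp]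
    simp
  | succ d ih =>
    intro σ a hσ
    obtain ⟨⟨p, τ⟩, rfl⟩ := Perm.decomposeFin.symm.surjective σ
    change cyc (insertZero p τ) = 1 at hσ
    have hτ0 : cyc τ ≠ 0 := by
      have : Nonempty (Cycles τ) := ⟨Quotient.mk _ 0⟩
      exact Nat.card_pos.ne'
    rw [cyc_insertZero] at hσ
    have hp : p ≠ 0 := by rintro rfl; simp at hσ; exact hτ0 hσ
    obtain ⟨q, rfl⟩ := Fin.exists_succ_eq.mpr hp
    rw [if_neg hp, add_zero] at hσ
    set e₀ := τ.symm q with he₀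
    have hτe : τ e₀ = q := by simp [he₀]
    set a' : Fin (d + 1) → ℕ := Function.update (fun e => a e.succ) e₀ (a e₀.succ + a 0) with ha'
    have hsum : ∑ e, a e = ∑ e, a' e := by
      rw [ha', Finset.sum_update_of_mem (Finset.mem_univ _), Fin.sum_univ_succ,
        ← Finset.add_sum_erase _ _ (Finset.mem_univ e₀), Finset.sdiff_singleton_eq_erase]
      ring
    rw [hsum, ← ih τ a' hσ]
    rw [← (Fin.consEquiv (fun _ => Fin n)).sum_comp, Fintype.sum_prod_type, Finset.sum_comm]
    refine Finset.sum_congr rfl fun i _ => ?_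
    rw [← Finset.mul_prod_erase _ _ (Finset.mem_univ e₀)]
    have hrest : ∀ x : Fin n, ∏ e ∈ Finset.univ.erase e₀,
        (M ^ a e.succ) (i e) (if τ e = q then x else i (τ e)) =
        ∏ e ∈ Finset.univ.erase e₀, (M ^ a' e) (i e) (i (τ e)) := by
      intro x
      refine Finset.prod_congr rfl fun e he => ?_
      have hne : e ≠ e₀ := Finset.ne_of_mem_erase he
      have : τ e ≠ q := fun h => hne (by rw [he₀, ← h, Equiv.symm_apply_apply])
      rw [if_neg this, ha', Function.update_of_ne hne]
    have hterm : ∀ x : Fin n, ∏ e, (M ^ a e) ((Fin.consEquiv fun _ => Fin n) (x, i) e)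
        ((Fin.consEquiv fun _ => Fin n) (x, i) (insertZero q.succ τ e)) =
        ((M ^ a e₀.succ) (i e₀) x * (M ^ a 0) x (i q)) *
          ∏ e ∈ Finset.univ.erase e₀, (M ^ a' e) (i e) (i (τ e)) := by
      intro x
      rw [Fin.prod_univ_succ, insertZero_zero, ← hrest x,
        ← Finset.mul_prod_erase _ _ (Finset.mem_univ e₀), insertZero_succ, if_pos hτe]
      simp only [Fin.consEquiv_apply, Fin.cons_zero, Fin.cons_succ]
      have : ∏ e ∈ Finset.univ.erase e₀, (M ^ a e.succ) (i e)
          ((Fin.cons x i : Fin (d + 2) → Fin n) (insertZero q.succ τ e.succ)) =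
          ∏ e ∈ Finset.univ.erase e₀, (M ^ a e.succ) (i e) (if τ e = q then x else i (τ e)) := by
        refine Finset.prod_congr rfl fun e _ => ?_
        rw [insertZero_succ]
        split_ifs <;> simp
      rw [this]
      ring
    simp only [hterm]
    rw [← Finset.sum_mul, ha', Function.update_self, hτe, pow_add, Matrix.mul_apply]

lemma traceProd_of_cyc_eq_one (M : Matrix (Fin n) (Fin n) K) {d : ℕ} (σ : Perm (Fin (d + 1)))
    (hσ : cyc σ = 1) : traceProd M σ = (M ^ (d + 1)).trace := by
  have := sum_prod_pow_eq_trace M d σ (fun _ => 1) hσ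
  simpa [traceProd_eq] using this

/-- There are `d!` cyclic permutations of `d + 1` points. -/
lemma card_cyc_eq_one (d : ℕ) :
    (Finset.univ.filter fun σ : Perm (Fin (d + 1)) => cyc σ = 1).card = d.factorial := by
  classical
  have hpos : ∀ {d : ℕ} (τ : Perm (Fin (d + 1))), cyc τ ≠ 0 := by
    intro d τ
    have : Nonempty (Cycles τ) := ⟨Quotient.mk _ 0⟩
    exact Nat.card_pos.ne'
  induction d with
  | zero =>
    rw [Finset.filter_true_of_mem]
    · simp
    · intro σ _
      have : Subsingleton (Cycles σ) := by
        refine ⟨?_⟩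
        rintro ⟨a⟩ ⟨b⟩
        rw [Subsingleton.elim (α := Fin 1) a b]
      have : Nonempty (Cycles σ) := ⟨Quotient.mk _ 0⟩
      exact Nat.card_eq_one_iff_unique.mpr ⟨inferInstance, inferInstance⟩
  | succ d ih =>
    rw [Finset.card_filter, ← Perm.decomposeFin.symm.sum_comp, Fintype.sum_prod_type,
      Fin.sum_univ_succ]
    have h0 : ∀ τ : Perm (Fin (d + 1)), ¬ cyc (Perm.decomposeFin.symm (0, τ)) = 1 := by
      intro τ h
      rw [show Perm.decomposeFin.symm (0, τ) = insertZero 0 τ from rfl, cyc_insertZero_zero] at h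
      exact hpos τ (by omega)
    have h1 : ∀ (p : Fin (d + 1)) (τ : Perm (Fin (d + 1))),
        cyc (Perm.decomposeFin.symm (p.succ, τ)) = cyc τ := cyc_insertZero_succ
    simp only [h0, h1, if_false, Finset.sum_const_zero, zero_add, ← Finset.card_filter, ih]
    simp [Nat.factorial_succ]

/-- The weight of a permutation behind the expansion of `exp (s ∑ tr M ^ j p_j / j)`. -/
def traceWeight (s : K) (M : Matrix (Fin n) (Fin n) K) :
    MulWeight Unit (MvPowerSeries ℕ+ K) where
  w g := MvPowerSeries.monomial (cycExp (g ())) (s ^ cyc (g ()) * traceProd M (g ()))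
  w_congr e g := by rw [cycExp_permCongr, cyc_permCongr, traceProd_permCongr]
  w_empty g := by rw [cycExp_of_isEmpty, cyc_of_isEmpty, traceProd_of_isEmpty]; simp
  w_sum g g' := by
    rw [cycExp_sumCongr, cyc_sumCongr, traceProd_sumCongr, MvPowerSeries.monomial_mul_monomial]
    congr 1; ring

lemma cycExp_eq_single {d : ℕ} {σ : Perm (Fin (d + 1))} (hσ : cyc σ = 1) :
    cycExp σ = Finsupp.single d.succPNat 1 := by
  obtain ⟨_, ⟨c⟩⟩ := Nat.card_eq_one_iff_unique.mp hσ
  have : Unique (Cycles σ) := ⟨⟨c⟩, fun _ => Subsingleton.elim _ _⟩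
  have h2 := wt_cycExp σ
  rw [cycExp, finsum_unique] at h2 ⊢
  rw [wt_single] at h2
  congr 1
  apply PNat.eq
  simpa using h2

lemma traceWeight_homogeneous (s : K) (M : Matrix (Fin n) (Fin n) K) (d : ℕ)
    (g : Unit → Perm (Fin d)) (e : ℕ+ →₀ ℕ) (he : wt e ≠ d) :
    MvPowerSeries.coeff e ((traceWeight s M).w g) = 0 := by
  classical
  change MvPowerSeries.coeff e (MvPowerSeries.monomial _ _) = 0
  rw [MvPowerSeries.coeff_monomial, if_neg]
  rintro rfl
  exact he (by rw [wt_cycExp (g ())]; simp)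

end Trace

section TraceExp

variable {n : ℕ} {K : Type*} [Field K] [CharZero K]

lemma connSeries_traceWeight (s : K) (M : Matrix (Fin n) (Fin n) K) :
    (traceWeight s M).connSeries = linearSeries fun j => s * ((M ^ (j : ℕ)).trace / (j : K)) := by
  ext e
  by_cases h0 : e = 0
  · subst h0
    change (traceWeight s M).connSeries 0 =
      linearSeries (fun j => s * ((M ^ (j : ℕ)).trace / (j : K))) 0
    simp [MulWeight.connSeries, linearSeries]
  rw [MulWeight.coeff_connSeries _ h0]
  obtain ⟨d, hd⟩ : ∃ d, wt e = d + 1 :=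
    Nat.exists_eq_succ_of_ne_zero fun h => h0 (wt_eq_zero.mp h)
  have hc : MvPowerSeries.coeff e ((traceWeight s M).conn (d + 1)) =
      if e = Finsupp.single d.succPNat 1 then (d.factorial : K) * (s * (M ^ (d + 1)).trace)
        else 0 := by
    classical
    have hsum : (∑ g : Unit → Perm (Fin (d + 1)),
        if IsTransitive g then (traceWeight s M).w g else 0) =
        ∑ σ : Perm (Fin (d + 1)), if cyc σ = 1 then MvPowerSeries.monomial
          (Finsupp.single d.succPNat 1) (s * (M ^ (d + 1)).trace) else 0 := by
      refine Fintype.sum_equiv (Equiv.funUnique Unit (Perm (Fin (d + 1)))) _ _ fun g => ?_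
      by_cases h : cyc (g ()) = 1
      · rw [if_pos (isTransitive_iff_cyc.mpr h)]
        change MvPowerSeries.monomial _ _ = if cyc (g ()) = 1 then _ else 0
        rw [if_pos h, cycExp_eq_single h, h, traceProd_of_cyc_eq_one M _ h, pow_one]
      · rw [if_neg (fun h' => h (isTransitive_iff_cyc.mp h'))]
        exact (if_neg h).symm
    rw [MulWeight.conn_eq, hsum, ← Finset.sum_filter, Finset.sum_const, card_cyc_eq_one, map_nsmul,
        MvPowerSeries.coeff_monomial, nsmul_eq_mul]
    simp
  rw [hd, hc]
  change _ = ∑ j ∈ e.support, if e = Finsupp.single j 1 then s * ((M ^ (j : ℕ)).trace / (j : K))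
    else 0
  by_cases he : e = Finsupp.single d.succPNat 1
  · rw [if_pos he]
    have hs : e.support = {d.succPNat} := by
      rw [he]; exact Finsupp.support_single _ one_ne_zero
    rw [hs, Finset.sum_singleton, if_pos he]
    have hf : (d.factorial : K) ≠ 0 := by exact_mod_cast d.factorial_ne_zero
    have hd1 : (d : K) + 1 ≠ 0 := by exact_mod_cast d.succ_ne_zero
    rw [← algebraMap_smul K, Nat.factorial_succ]
    simp only [map_inv₀, map_natCast, smul_eq_mul, Nat.succPNat_coe]
    push_cast
    simp only [Nat.succ_eq_add_one]
    field_simp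
  · rw [if_neg he, smul_zero, Finset.sum_eq_zero]
    intro j hj
    rw [if_neg]
    rintro rfl
    rw [wt_single, one_mul] at hd
    exact he (by congr 1; exact PNat.eq hd)

/-- Expansion of `exp (s ∑ tr M ^ j p_j / j)` into products of traces, indexed by permutations. -/
theorem coeff_formalExp_trace (s : K) (M : Matrix (Fin n) (Fin n) K) (e : ℕ+ →₀ ℕ) :
    MvPowerSeries.coeff e
      (formalExp (linearSeries fun j => s * ((M ^ (j : ℕ)).trace / (j : K)))) =
      (((wt e).factorial : ℚ)⁻¹) • ∑ σ : Perm (Fin (wt e)),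
        if cycExp σ = e then s ^ e.degree * traceProd M σ else 0 := by
  rw [← connSeries_traceWeight, MulWeight.formalExp_connSeries _ (traceWeight_homogeneous s M),
    MulWeight.coeff_totalSeries, MulWeight.total_eq, map_sum]
  congr 1
  refine Fintype.sum_equiv (Equiv.funUnique Unit (Perm (Fin (wt e)))) _
    (fun σ : Perm (Fin (wt e)) => if cycExp σ = e then s ^ e.degree * traceProd M σ else 0)
    fun g => ?_
  classical
  change MvPowerSeries.coeff e (MvPowerSeries.monomial _ _) = if cycExp (g ()) = e then
    s ^ e.degree * traceProd M (g ()) else 0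
  rw [MvPowerSeries.coeff_monomial]
  split_ifs with h1 h2 h2
  · rw [← degree_cycExp, ← h1]
  · exact absurd h1.symm h2
  · exact absurd h2.symm h1
  · rfl

end TraceExp

end

section

open Equiv

/-! ### The genus of a transitive pair of permutations -/

section Genus

variable {E : Type*}

/-- Functions on `E` minus their translate by `σ`. -/
def diffMap (σ : Perm E) : (E → ℚ) →ₗ[ℚ] (E → ℚ) := LinearMap.funLeft ℚ ℚ σ - LinearMap.id

lemma diffMap_apply (σ : Perm E) (f : E → ℚ) (x : E) : diffMap σ f x = f (σ x) - f x := rfl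

variable [Fintype E]

lemma finrank_ker_diffMap (σ : Perm E) : Module.finrank ℚ (LinearMap.ker (diffMap σ)) = cyc σ := by
  have := Fintype.ofFinite (Cycles σ)
  have hmem : ∀ f : E → ℚ, f ∈ LinearMap.ker (diffMap σ) ↔ ∀ x, f (σ x) = f x := by
    intro f
    rw [LinearMap.mem_ker, funext_iff]
    exact forall_congr' fun x => by rw [diffMap_apply]; exact sub_eq_zero
  let e : LinearMap.ker (diffMap σ) ≃ₗ[ℚ] (Cycles σ → ℚ) :=
    { toFun := fun f => invariantFunEquiv σ ⟨f.1, (hmem _).1 f.2⟩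
      invFun := fun h => ⟨((invariantFunEquiv σ).symm h).1, (hmem _).2 ((invariantFunEquiv σ).symm h).2⟩
      left_inv := fun f => rfl
      right_inv := fun h => (invariantFunEquiv σ).right_inv h
      map_add' := fun f g => by funext c; induction c using Quotient.inductionOn; rfl
      map_smul' := fun r f => by funext c; induction c using Quotient.inductionOn; rfl }
  rw [e.finrank_eq, Module.finrank_fintype_fun_eq_card, cyc, Nat.card_eq_fintype_card]

lemma finrank_range_diffMap (σ : Perm E) :
    Module.finrank ℚ (LinearMap.range (diffMap σ)) + cyc σ = Fintype.card E := by
  rw [← finrank_ker_diffMap, LinearMap.finrank_range_add_finrank_ker,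
    Module.finrank_fintype_fun_eq_card]

/-- By transitivity all point masses agree modulo the differences. -/
lemma card_le_finrank_sup {b w : Perm E} (h : IsTransitive ![b, w]) [Nonempty E] :
    Fintype.card E ≤
      Module.finrank ℚ ↥(LinearMap.range (diffMap b) ⊔ LinearMap.range (diffMap w)) + 1 := by
  classical
  set R := LinearMap.range (diffMap b) ⊔ LinearMap.range (diffMap w) with hR
  let x₀ : E := Classical.arbitrary E
  have hstep : ∀ (σ : Perm E) (x : E), (Pi.single x 1 - Pi.single (σ x) 1 : E → ℚ) ∈
      LinearMap.range (diffMap σ) := by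
    intro σ x
    refine ⟨Pi.single (σ x) 1, ?_⟩
    funext y
    rw [diffMap_apply, Pi.sub_apply]
    congr 1
    simp only [Pi.single_apply, σ.injective.eq_iff]
  have hall : ∀ x, (Pi.single x₀ 1 - Pi.single x 1 : E → ℚ) ∈ R := by
    intro x
    refine (h x₀ x).mem (T := {x | (Pi.single x₀ 1 - Pi.single x 1 : E → ℚ) ∈ R}) ?_ (by simp)
    intro i a ha
    have h2 : (Pi.single a 1 - Pi.single ((![b, w] : Fin 2 → Perm E) i a) 1 : E → ℚ) ∈ R := by
      fin_cases i
      · exact Submodule.mem_sup_left (hstep b a)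
      · exact Submodule.mem_sup_right (hstep w a)
    simpa using R.add_mem ha h2
  have htop : (⊤ : Submodule ℚ (E → ℚ)) ≤ R ⊔ Submodule.span ℚ {Pi.single x₀ 1} := by
    rw [← (Pi.basisFun ℚ E).span_eq, Submodule.span_le]
    rintro _ ⟨x, rfl⟩
    rw [Pi.basisFun_apply]
    have h0 : (Pi.single x₀ 1 : E → ℚ) ∈ R ⊔ Submodule.span ℚ {Pi.single x₀ 1} :=
      Submodule.mem_sup_right (Submodule.mem_span_singleton_self _)
    simpa using Submodule.sub_mem _ h0 (Submodule.mem_sup_left (hall x))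
  calc Fintype.card E = Module.finrank ℚ (⊤ : Submodule ℚ (E → ℚ)) := by
        rw [finrank_top, Module.finrank_fintype_fun_eq_card]
    _ ≤ Module.finrank ℚ ↥(R ⊔ Submodule.span ℚ {(Pi.single x₀ 1 : E → ℚ)}) :=
        Submodule.finrank_mono htop
    _ ≤ Module.finrank ℚ R + Module.finrank ℚ (Submodule.span ℚ {(Pi.single x₀ 1 : E → ℚ)}) :=
        Submodule.finrank_add_le_finrank_add_finrank _ _
    _ ≤ _ := by gcongr; exact (finrank_span_le_card _).trans (by simp)

/-- The genus is not negative. A function invariant under `b * w` has its differences along `b` in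
the intersection of the ranges of the difference maps of `b` and of `w`, and is constant if these
differences vanish. -/
lemma cyc_add_cyc_add_cyc_le {b w : Perm E} (h : IsTransitive ![b, w]) [Nonempty E] :
    cyc b + cyc w + cyc (b * w) ≤ Fintype.card E + 2 := by
  classical
  have hsup := card_le_finrank_sup h
  have hb := finrank_range_diffMap b
  have hw := finrank_range_diffMap w
  have hdim := Submodule.finrank_sup_add_finrank_inf_eq (LinearMap.range (diffMap b))
    (LinearMap.range (diffMap w))
  set K := LinearMap.ker (diffMap (b * w))
  have hK : ∀ v ∈ K, ∀ x, v (b (w x)) = v x := by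
    intro v hv x
    have := congrFun (LinearMap.mem_ker.mp hv) x
    rw [diffMap_apply] at this
    exact sub_eq_zero.mp this
  have hmem : ∀ v : K, (diffMap b) v.1 ∈
      LinearMap.range (diffMap b) ⊓ LinearMap.range (diffMap w) := by
    rintro ⟨v, hv⟩
    refine ⟨⟨v, rfl⟩, ⟨fun x => -v (b x), ?_⟩⟩
    funext x
    rw [diffMap_apply, diffMap_apply, hK v hv]; ring
  let f : K →ₗ[ℚ] ↥(LinearMap.range (diffMap b) ⊓ LinearMap.range (diffMap w)) :=
    LinearMap.codRestrict _ ((diffMap b).domRestrict K) hmem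
  have hker : Module.finrank ℚ (LinearMap.ker f) ≤ 1 := by
    let x₀ : E := Classical.arbitrary E
    by_cases hc : (fun _ => 1 : E → ℚ) ∈ K
    · have hc' : (⟨fun _ => 1, hc⟩ : K) ∈ LinearMap.ker f := by
        rw [LinearMap.mem_ker]; apply Subtype.ext; funext x; exact sub_self (1 : ℚ)
      refine finrank_le_one (⟨⟨fun _ => 1, hc⟩, hc'⟩ : LinearMap.ker f) ?_
      rintro ⟨⟨v, hv⟩, hv'⟩
      refine ⟨v x₀, ?_⟩
      apply Subtype.ext; apply Subtype.ext; funext x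
      have hbv : ∀ x, v (b x) = v x := by
        intro x
        have := congrFun (congrArg Subtype.val (LinearMap.mem_ker.mp hv')) x
        exact sub_eq_zero.mp this
      have hwv : ∀ x, v (w x) = v x := fun x => by rw [← hbv (w x), hK v hv]
      have : v x = v x₀ := by
        refine (h x₀ x).mem (T := {x | v x = v x₀}) ?_ rfl
        intro i a ha
        fin_cases i
        · exact (hbv a).trans ha
        · exact (hwv a).trans ha
      simp [this]
    · exact absurd (by rw [LinearMap.mem_ker]; funext x; simp [diffMap_apply]) hc
  have hf := LinearMap.finrank_range_add_finrank_ker f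
  rw [finrank_ker_diffMap] at hf
  have hr : Module.finrank ℚ (LinearMap.range f) ≤
      Module.finrank ℚ ↥(LinearMap.range (diffMap b) ⊓ LinearMap.range (diffMap w)) :=
    Submodule.finrank_le _
  omega

lemma sign_eq_neg_one_pow_cyc : ∀ {d : ℕ} (σ : Perm (Fin d)),
    Perm.sign σ = (-1) ^ (d + cyc σ) := by
  intro d
  induction d with
  | zero => intro σ; rw [cyc_of_isEmpty, Subsingleton.elim σ 1]; simp
  | succ d ih =>
    intro σ
    obtain ⟨⟨p, τ⟩, rfl⟩ := Perm.decomposeFin.symm.surjective σ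
    rw [Perm.decomposeFin.symm_sign, ih]
    change _ = (-1) ^ (d + 1 + cyc (insertZero p τ))
    rw [cyc_insertZero]
    split_ifs
    · rw [one_mul, show d + 1 + (cyc τ + 1) = d + cyc τ + 2 by ring, pow_add _ _ 2,
        neg_one_sq, mul_one]
    · rw [← pow_succ']; congr 1; ring

/-- Euler's formula for a transitive pair of permutations. -/
theorem exists_genus {d : ℕ} {b w : Perm (Fin d)} (hd : d ≠ 0) (h : IsTransitive ![b, w]) :
    ∃ g : ℕ, 2 * g + cyc b + cyc w + cyc (b * w) = d + 2 := by
  have : Nonempty (Fin d) := ⟨⟨0, Nat.pos_of_ne_zero hd⟩⟩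
  have hle := cyc_add_cyc_add_cyc_le h
  rw [Fintype.card_fin] at hle
  have hs := Perm.sign_mul b w
  rw [sign_eq_neg_one_pow_cyc, sign_eq_neg_one_pow_cyc, sign_eq_neg_one_pow_cyc, ← pow_add] at hs
  have hs' : ((-1 : ℤˣ)) ^ (d + cyc (b * w) + (d + cyc b + (d + cyc w))) = 1 := by
    rw [pow_add, hs, ← pow_add, ← two_mul, pow_mul]; simp
  have heven : Even (d + cyc (b * w) + (d + cyc b + (d + cyc w))) := by
    by_contra hodd
    rw [Nat.not_even_iff_odd] at hodd
    rw [hodd.neg_one_pow] at hs'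
    exact absurd hs' (by decide)
  obtain ⟨r, hr⟩ := heven
  exact ⟨2 * d + 1 - r, by omega⟩

end Genus

end

section

open Equiv

/-! ### Counting dessins by pairs of permutations -/

namespace LabelledDessin

variable {E : Type*} {k l m : ℕ} {μ : Fin m → ℕ+}

lemma ext' {Γ Γ' : LabelledDessin E k l μ} (h₁ : Γ.black = Γ'.black) (h₂ : Γ.white = Γ'.white)
    (h₃ : Γ.label = Γ'.label) : Γ = Γ' := by
  cases Γ; cases Γ'; simp_all

lemma isPretransitive_pair_iff [Finite E] {b w : Perm E} :
    MulAction.IsPretransitive (Subgroup.closure {b, w}) E ↔ IsTransitive ![b, w] := by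
  rw [← isPretransitive_closure_iff]
  have : Set.range ![b, w] = {b, w} := by simp [Matrix.range_cons, Set.pair_comm]
  rw [this]

lemma isTransitive [Finite E] (Γ : LabelledDessin E k l μ) :
    IsTransitive ![Γ.black, Γ.white] := isPretransitive_pair_iff.mp Γ.connected

/-- Relabelling of the edges of a dessin. -/
def relabel [Finite E] (s : Perm E) (Γ : LabelledDessin E k l μ) : LabelledDessin E k l μ where
  black := s.permCongr Γ.black
  white := s.permCongr Γ.white
  connected := by
    rw [isPretransitive_pair_iff]
    have := (isTransitive_permCongr s).mpr Γ.isTransitive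
    convert this using 2 with i
    fin_cases i <;> rfl
  card_black := (cyc_permCongr s Γ.black).trans Γ.card_black
  card_white := (cyc_permCongr s Γ.white).trans Γ.card_white
  label e := Γ.label (s.symm e)
  label_eq_iff e e' := by
    rw [Γ.label_eq_iff, show s.permCongr Γ.black * s.permCongr Γ.white =
      s.permCongr (Γ.black * Γ.white) from (map_mul s.permCongrHom _ _).symm]
    have h := (cyclesCongr s (Γ.black * Γ.white)).apply_eq_iff_eq
      (x := Quotient.mk _ (s.symm e)) (y := Quotient.mk _ (s.symm e'))
    rw [cyclesCongr_mk, cyclesCongr_mk, apply_symm_apply, apply_symm_apply] at h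
    exact Quotient.eq.symm.trans (h.symm.trans Quotient.eq)
  card_label i := by
    rw [← Γ.card_label i]
    exact Nat.card_congr (Equiv.subtypeEquiv s.symm fun _ => Iff.rfl)

instance [Finite E] : MulAction (Perm E) (LabelledDessin E k l μ) where
  smul := relabel
  one_smul _ := ext' rfl rfl rfl
  mul_smul _ _ _ := ext' rfl rfl rfl

lemma smul_eq_iff [Finite E] {s : Perm E} {Γ Γ' : LabelledDessin E k l μ} :
    s • Γ = Γ' ↔ (∀ e, s (Γ.black e) = Γ'.black (s e)) ∧ (∀ e, s (Γ.white e) = Γ'.white (s e)) ∧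
      ∀ e, Γ'.label (s e) = Γ.label e := by
  constructor
  · rintro rfl
    refine ⟨fun e => ?_, fun e => ?_, fun e => ?_⟩
    · change _ = s.permCongr Γ.black (s e); simp
    · change _ = s.permCongr Γ.white (s e); simp
    · change Γ.label (s.symm (s e)) = _; simp
  · rintro ⟨h₁, h₂, h₃⟩
    refine ext' ?_ ?_ ?_
    · ext e
      change s.permCongr Γ.black e = _
      rw [permCongr_apply, h₁, apply_symm_apply]
    · ext e
      change s.permCongr Γ.white e = _
      rw [permCongr_apply, h₂, apply_symm_apply]
    · funext e
      change Γ.label (s.symm e) = _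
      rw [← h₃, apply_symm_apply]

instance [Finite E] : Finite (LabelledDessin E k l μ) :=
  Finite.of_injective (fun Γ => (Γ.black, Γ.white, Γ.label)) fun Γ Γ' h => by
    simp only [Prod.mk.injEq] at h
    exact ext' h.1 h.2.1 h.2.2

/-- Automorphisms of a dessin are the relabellings that fix it. -/
def stabilizerEquiv [Finite E] (Γ : LabelledDessin E k l μ) :
    MulAction.stabilizer (Perm E) Γ ≃ Γ.AutB where
  toFun s := ⟨s.1, (smul_eq_iff.mp s.2).1, (smul_eq_iff.mp s.2).2.1, (smul_eq_iff.mp s.2).2.2⟩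
  invFun τ := ⟨τ.toEquiv, smul_eq_iff.mpr ⟨τ.map_black, τ.map_white, τ.map_label⟩⟩
  left_inv _ := rfl
  right_inv _ := rfl

lemma orbitRel_eq [Finite E] :
    MulAction.orbitRel (Perm E) (LabelledDessin E k l μ) = isoSetoid E k l μ := by
  ext Γ Γ'
  rw [MulAction.orbitRel_apply, MulAction.mem_orbit_iff]
  constructor
  · rintro ⟨s, hs⟩
    obtain ⟨h₁, h₂, h₃⟩ := smul_eq_iff.mp hs
    exact Setoid.symm' _ ⟨⟨s, h₁, h₂, h₃⟩⟩
  · intro h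
    obtain ⟨τ⟩ := Setoid.symm' _ h
    exact ⟨τ.toEquiv, smul_eq_iff.mpr ⟨τ.map_black, τ.map_white, τ.map_label⟩⟩

end LabelledDessin

/-- The weighted count of dessins is the number of dessins on a fixed set of edges, divided by the
number of relabellings of the edges (orbit-stabilizer). -/
theorem dessinCount_eq (k l : ℕ) {m : ℕ} (μ : Fin m → ℕ+) :
    dessinCount k l μ = (Nat.card (LabelledDessin (Fin (∑ i, (μ i : ℕ))) k l μ) : ℚ) /
      (∑ i, (μ i : ℕ)).factorial := by
  classical
  set d := ∑ i, (μ i : ℕ)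
  set X := LabelledDessin (Fin d) k l μ
  have hfin := Fintype.ofFinite X
  have hq : Fintype (DessinClasses k l μ) := Fintype.ofFinite _
  have hst : ∀ Γ : X, Fintype (MulAction.stabilizer (Perm (Fin d)) Γ) := fun Γ => Fintype.ofFinite _
  rw [dessinCount, finsum_eq_sum_of_fintype]
  have hdis : (Nat.card X : ℚ) = ∑ c : DessinClasses k l μ,
      (Nat.card {Γ : X // (Quotient.mk _ Γ : DessinClasses k l μ) = c} : ℚ) := by
    rw [← Nat.card_congr (Equiv.sigmaFiberEquiv (fun Γ : X => (Quotient.mk _ Γ : DessinClasses k l μ))),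
      Nat.card_sigma]
    push_cast; rfl
  rw [hdis, Finset.sum_div]
  refine Finset.sum_congr rfl fun c _ => ?_
  have horb : Nat.card {Γ : X // (Quotient.mk _ Γ : DessinClasses k l μ) = c} =
      Nat.card (MulAction.orbit (Perm (Fin d)) (Quotient.out c)) := by
    refine Nat.card_congr (Equiv.subtypeEquivRight fun Γ => ?_)
    rw [← MulAction.orbitRel_apply, LabelledDessin.orbitRel_eq]
    conv_lhs => rw [← Quotient.out_eq c]
    exact Quotient.eq
  have hos := MulAction.card_orbit_mul_card_stabilizer_eq_card_group (Perm (Fin d)) (Quotient.out c : X)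
  rw [← Nat.card_eq_fintype_card, ← Nat.card_eq_fintype_card, Fintype.card_perm, Fintype.card_fin,
    Nat.card_congr (LabelledDessin.stabilizerEquiv _), ← horb] at hos
  rw [← hos]
  have h1 : (Nat.card (Quotient.out c).AutB : ℚ) ≠ 0 := by
    intro h
    have h' : Nat.card (Quotient.out c).AutB = 0 := by exact_mod_cast h
    rw [h', mul_zero] at hos
    exact Nat.factorial_ne_zero _ hos.symm
  have h2 : (Nat.card {Γ : X // (Quotient.mk _ Γ : DessinClasses k l μ) = c} : ℚ) ≠ 0 := by
    intro h
    have h' : Nat.card {Γ : X // (Quotient.mk _ Γ : DessinClasses k l μ) = c} = 0 := by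
      exact_mod_cast h
    rw [h', zero_mul] at hos
    exact Nat.factorial_ne_zero _ hos.symm
  push_cast
  field_simp

/-- Pairs of permutations of given cycle numbers and given type of the product. -/
def IsPairOfType {E : Type*} (k l : ℕ) (e : ℕ+ →₀ ℕ) (p : Perm E × Perm E) : Prop :=
  IsTransitive ![p.1, p.2] ∧ cyc p.1 = k ∧ cyc p.2 = l ∧ cycExp (p.1 * p.2) = e

section Label

variable {E : Type*} [Finite E] {m : ℕ}

/-- Labellings of the cycles of `σ`, as functions on points. -/
def IsLabel (σ : Perm E) (f : E → Fin m) : Prop :=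
  (∀ x y, f x = f y ↔ σ.SameCycle x y) ∧ Function.Surjective f

/-- A labelling of the cycles as a bijection. -/
def labelEquiv (σ : Perm E) : {f : E → Fin m // IsLabel σ f} ≃ (Cycles σ ≃ Fin m) where
  toFun f := Equiv.ofBijective
    (Quotient.lift f.1 fun a b h => (f.2.1 a b).2 h) <| by
      constructor
      · rintro ⟨a⟩ ⟨b⟩ h
        exact Quotient.sound ((f.2.1 a b).1 h)
      · intro i
        obtain ⟨x, hx⟩ := f.2.2 i
        exact ⟨Quotient.mk _ x, hx⟩
  invFun g := ⟨fun x => g (Quotient.mk _ x), fun x y => by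
    rw [g.apply_eq_iff_eq]; exact Quotient.eq, fun i => by
      obtain ⟨x, hx⟩ := Quotient.exists_rep (g.symm i)
      exact ⟨x, (congrArg g hx).trans (g.apply_symm_apply i)⟩⟩
  left_inv f := rfl
  right_inv g := by ext c; induction c using Quotient.inductionOn; rfl

lemma card_isLabel (σ : Perm E) (h : cyc σ = m) :
    Nat.card {f : E → Fin m // IsLabel σ f} = m.factorial := by
  classical
  have := Fintype.ofFinite (Cycles σ)
  rw [Nat.card_congr (labelEquiv σ), Nat.card_eq_fintype_card]
  have hc : Fintype.card (Cycles σ) = m := by rw [← h, cyc, Nat.card_eq_fintype_card]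
  rw [Fintype.card_equiv (Fintype.equivFinOfCardEq hc), hc]

/-- The sizes of the fibres of a labelling. -/
def fibreSize (f : E → Fin m) (i : Fin m) : ℕ+ := (Nat.card {x // f x = i}).toPNat'

lemma pMonomial_fibreSize {σ : Perm E} {f : E → Fin m} (hf : IsLabel σ f) :
    pMonomial (fibreSize f) = cycExp σ := by
  have := Fintype.ofFinite (Cycles σ)
  rw [pMonomial, cycExp, finsum_eq_sum_of_fintype,
    ← (labelEquiv σ ⟨f, hf⟩).sum_comp (fun i => Finsupp.single (fibreSize f i) 1)]
  refine Finset.sum_congr rfl fun c _ => ?_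
  congr 1
  unfold fibreSize cycLen
  congr 1
  refine Nat.card_congr (Equiv.subtypeEquivRight fun x => ?_)
  change labelEquiv σ ⟨f, hf⟩ (Quotient.mk _ x) = _ ↔ _
  exact (labelEquiv σ ⟨f, hf⟩).apply_eq_iff_eq

lemma coe_fibreSize {σ : Perm E} {f : E → Fin m} (hf : IsLabel σ f) (i : Fin m) :
    (fibreSize f i : ℕ) = Nat.card {x // f x = i} := by
  obtain ⟨x, hx⟩ := hf.2 i
  have : Nonempty {x // f x = i} := ⟨⟨x, hx⟩⟩
  simp [fibreSize]

end Label

section Count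

variable {E : Type*} [Finite E] {k l m : ℕ}

/-- A dessin as a pair of permutations with a labelling of the cycles of the product. -/
def dessinEquiv {μ : Fin m → ℕ+} {e : ℕ+ →₀ ℕ} (hμ : pMonomial μ = e) :
    LabelledDessin E k l μ ≃ {t : (Σ p : {p : Perm E × Perm E // IsPairOfType k l e p},
      {f : E → Fin m // IsLabel (p.1.1 * p.1.2) f}) // fibreSize t.2.1 = μ} where
  toFun Γ := by
    have hl : IsLabel (Γ.black * Γ.white) Γ.label := ⟨Γ.label_eq_iff, fun i => by
      have h := Γ.card_label i
      have : Nonempty {e // Γ.label e = i} := by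
        by_contra hne
        rw [not_nonempty_iff] at hne
        rw [Nat.card_of_isEmpty] at h
        exact (μ i).pos.ne h
      exact ⟨_, this.some.2⟩⟩
    have hf : fibreSize Γ.label = μ := by
      funext i
      apply PNat.eq
      rw [coe_fibreSize hl, Γ.card_label]
    exact ⟨⟨⟨(Γ.black, Γ.white), Γ.isTransitive, Γ.card_black, Γ.card_white,
      (pMonomial_fibreSize hl).symm.trans ((congrArg pMonomial hf).trans hμ)⟩, ⟨Γ.label, hl⟩⟩, hf⟩
  invFun t :=
    { black := t.1.1.1.1
      white := t.1.1.1.2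
      connected := LabelledDessin.isPretransitive_pair_iff.mpr t.1.1.2.1
      card_black := t.1.1.2.2.1
      card_white := t.1.1.2.2.2.1
      label := t.1.2.1
      label_eq_iff := t.1.2.2.1
      card_label := fun i => by rw [← coe_fibreSize t.1.2.2, t.2] }
  left_inv Γ := rfl
  right_inv t := rfl

/-- Dessins with any numbering of their boundary components, counted by pairs of permutations. -/
theorem sum_card_dessin (e : ℕ+ →₀ ℕ) (k l : ℕ) :
    ∑ μ ∈ Fintype.piFinset (fun _ : Fin e.degree => e.support),
      (if pMonomial μ = e then Nat.card (LabelledDessin E k l μ) else 0) =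
      e.degree.factorial * Nat.card {p : Perm E × Perm E // IsPairOfType k l e p} := by
  classical
  set T := Σ p : {p : Perm E × Perm E // IsPairOfType k l e p},
      {f : E → Fin e.degree // IsLabel (p.1.1 * p.1.2) f}
  have hT : Fintype T := Fintype.ofFinite _
  have hP : Fintype {p : Perm E × Perm E // IsPairOfType k l e p} := Fintype.ofFinite _
  have h1 : Nat.card T = e.degree.factorial *
      Nat.card {p : Perm E × Perm E // IsPairOfType k l e p} := by
    rw [Nat.card_sigma, Finset.sum_congr rfl fun p _ => card_isLabel (m := e.degree) (p.1.1 * p.1.2)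
      ((degree_cycExp _).symm.trans (congrArg _ p.2.2.2.2))]
    rw [Finset.sum_const, smul_eq_mul, Nat.card_eq_fintype_card, mul_comm]; rfl
  have hmono : ∀ t : T, pMonomial (fibreSize t.2.1) = e := fun t => by
    rw [pMonomial_fibreSize t.2.2, t.1.2.2.2.2]
  rw [← h1, Nat.card_eq_fintype_card, ← Finset.card_univ,
    Finset.card_eq_sum_card_fiberwise (f := fun t : T => fibreSize t.2.1)
      (t := Fintype.piFinset (fun _ : Fin e.degree => e.support))]
  · refine Finset.sum_congr rfl fun μ _ => ?_
    split_ifs with hμ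
    · rw [Nat.card_congr (dessinEquiv hμ), ← Fintype.card_subtype, Nat.card_eq_fintype_card]
    · symm
      rw [Finset.card_eq_zero, Finset.filter_eq_empty_iff]
      intro t _ ht
      exact hμ (by rw [← ht]; exact hmono t)
  · intro t _
    rw [Finset.mem_coe, Fintype.mem_piFinset]
    intro i
    rw [Finsupp.mem_support_iff]
    have happ := congrArg (fun f => f (fibreSize t.2.1 i)) (hmono t)
    simp only [pMonomial, Finsupp.finsetSum_apply] at happ
    have : (1 : ℕ) ≤ ∑ j, (Finsupp.single (fibreSize t.2.1 j) 1 : ℕ+ →₀ ℕ) (fibreSize t.2.1 i) := by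
      refine le_trans ?_ (Finset.single_le_sum (fun _ _ => Nat.zero_le _) (Finset.mem_univ i))
      simp
    change e (fibreSize t.2.1 i) ≠ 0
    omega

end Count

end

section

open Equiv

/-! ### The dessin partition function as a sum over pairs of permutations -/

section Dessin

variable {R : Type*} [CommRing R]

/-- The weight `u ^ k v ^ l ε ^ (d - k - l - m)` of a pair of permutations of `d` points with `k`, `l`
and `m` the numbers of cycles of the permutations and of their product; the exponent of `ε` is
`2 g - 2` for a transitive pair. -/
def dessinWeight (u v : R) (ε : Rˣ) : MulWeight (Fin 2) (MvPowerSeries ℕ+ R) where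
  w {E} g := MvPowerSeries.monomial (cycExp (g 0 * g 1)) (u ^ cyc (g 0) * v ^ cyc (g 1) *
    ((ε ^ ((Nat.card E : ℤ) - cyc (g 0) - cyc (g 1) - cyc (g 0 * g 1)) : Rˣ) : R))
  w_congr {E E'} _ e g := by
    rw [show e.permCongr (g 0) * e.permCongr (g 1) = e.permCongr (g 0 * g 1) from
      (map_mul e.permCongrHom _ _).symm, cycExp_permCongr, cyc_permCongr, cyc_permCongr,
      cyc_permCongr, Nat.card_congr e]
  w_empty g := by simp [cycExp_of_isEmpty, cyc_of_isEmpty]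
  w_sum {E E'} _ _ g g' := by
    rw [Perm.sumCongr_mul, cycExp_sumCongr, cyc_sumCongr, cyc_sumCongr, cyc_sumCongr,
      MvPowerSeries.monomial_mul_monomial, Nat.card_sum]
    congr 1
    have : (((Nat.card E + Nat.card E' : ℕ) : ℤ) - ((cyc (g 0) + cyc (g' 0) : ℕ) : ℤ) -
        ((cyc (g 1) + cyc (g' 1) : ℕ) : ℤ) - ((cyc (g 0 * g 1) + cyc (g' 0 * g' 1) : ℕ) : ℤ)) =
        ((Nat.card E : ℤ) - cyc (g 0) - cyc (g 1) - cyc (g 0 * g 1)) +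
        ((Nat.card E' : ℤ) - cyc (g' 0) - cyc (g' 1) - cyc (g' 0 * g' 1)) := by push_cast; ring
    rw [this, zpow_add, Units.val_mul]
    ring

lemma dessinWeight_homogeneous (u v : R) (ε : Rˣ) (d : ℕ)
    (g : Fin 2 → Perm (Fin d)) (e : ℕ+ →₀ ℕ) (he : wt e ≠ d) :
    MvPowerSeries.coeff e ((dessinWeight u v ε).w g) = 0 := by
  classical
  change MvPowerSeries.coeff e (MvPowerSeries.monomial _ _) = 0
  rw [MvPowerSeries.coeff_monomial, if_neg]
  rintro rfl
  exact he (by rw [wt_cycExp (g 0 * g 1)]; simp)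

lemma coeff_dessinWeight (u v : R) (ε : Rˣ) {d : ℕ} (g : Fin 2 → Perm (Fin d)) (e : ℕ+ →₀ ℕ) :
    MvPowerSeries.coeff e ((dessinWeight u v ε).w g) =
      if cycExp (g 0 * g 1) = e then u ^ cyc (g 0) * v ^ cyc (g 1) *
        ((ε ^ ((d : ℤ) - cyc (g 0) - cyc (g 1) - cyc (g 0 * g 1)) : Rˣ) : R) else 0 := by
  classical
  change MvPowerSeries.coeff e (MvPowerSeries.monomial _ _) = _
  rw [MvPowerSeries.coeff_monomial, Nat.card_fin]
  simp only [eq_comm]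

lemma cyc_pos {d : ℕ} (hd : d ≠ 0) (σ : Perm (Fin d)) : 0 < cyc σ := by
  have : Nonempty (Cycles σ) := ⟨Quotient.mk _ ⟨0, Nat.pos_of_ne_zero hd⟩⟩
  exact Nat.card_pos

lemma wt_pMonomial {m : ℕ} (μ : Fin m → ℕ+) : wt (pMonomial μ) = ∑ i, (μ i : ℕ) := by
  rw [pMonomial, map_sum]; simp [wt_single]

open scoped Classical in
/-- The weight of one pair of permutations, spread over the values of the genus and of the numbers of
vertices. -/
lemma sum_genus_eq (u v : R) (ε : Rˣ) {d : ℕ} (hd : d ≠ 0) (e : ℕ+ →₀ ℕ) (b w : Perm (Fin d)) :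
    (if IsTransitive ![b, w] then (if cycExp (b * w) = e then u ^ cyc b * v ^ cyc w *
        ((ε ^ ((d : ℤ) - cyc b - cyc w - cyc (b * w)) : Rˣ) : R) else 0) else 0) =
    ∑ g ∈ Finset.range (d + 3), ∑ k ∈ Finset.Icc 1 (d + 2), ∑ l ∈ Finset.Icc 1 (d + 2),
      if 2 * g + k + l + e.degree = d + 2 then
        (if IsPairOfType k l e (b, w) then u ^ k * v ^ l * ((ε ^ (2 * (g : ℤ) - 2) : Rˣ) : R) else 0)
      else 0 := by
  by_cases ht : IsTransitive ![b, w] ∧ cycExp (b * w) = e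
  · obtain ⟨ht, he⟩ := ht
    have hdeg : e.degree = cyc (b * w) := by rw [← he, degree_cycExp]
    obtain ⟨g, hg⟩ := exists_genus hd ht
    have h1 := cyc_pos hd b
    have h2 := cyc_pos hd w
    have hp : ∀ k l, IsPairOfType k l e (b, w) ↔ cyc b = k ∧ cyc w = l := fun k l =>
      ⟨fun h => ⟨h.2.1, h.2.2.1⟩, fun h => ⟨ht, h.1, h.2, he⟩⟩
    rw [if_pos ht, if_pos he, Finset.sum_eq_single_of_mem g (by simp; omega),
      Finset.sum_eq_single_of_mem (cyc b) (by simp; omega),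
      Finset.sum_eq_single_of_mem (cyc w) (by simp; omega), if_pos (by omega),
      if_pos ((hp _ _).2 ⟨rfl, rfl⟩)]
    · have hexp : (d : ℤ) - cyc b - cyc w - cyc (b * w) = 2 * (g : ℤ) - 2 := by omega
      rw [hexp]
    · intro l _ hl
      rw [if_neg (c := IsPairOfType _ _ _ _) (fun h => hl ((hp _ _).1 h).2.symm), ite_self]
    · intro k _ hk
      refine Finset.sum_eq_zero fun l _ => ?_
      rw [if_neg (c := IsPairOfType _ _ _ _) (fun h => hk ((hp _ _).1 h).1.symm), ite_self]
    · intro g' _ hg'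
      refine Finset.sum_eq_zero fun k _ => Finset.sum_eq_zero fun l _ => ?_
      by_cases h : IsPairOfType k l e (b, w)
      · obtain ⟨h1, h2⟩ := (hp _ _).1 h
        rw [if_neg]
        omega
      · rw [if_neg h, ite_self]
  · rw [Finset.sum_eq_zero]
    · rw [← ite_and, if_neg ht]
    · intro g _
      refine Finset.sum_eq_zero fun k _ => Finset.sum_eq_zero fun l _ => ?_
      rw [if_neg (c := IsPairOfType _ _ _ _) (fun h => ht ⟨h.1, h.2.2.2⟩), ite_self]

variable [Algebra ℚ R]

/-- The dessin free energy is the generating series of transitive pairs of permutations. -/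
theorem dessinFreeEnergy_eq (u v : R) (ε : Rˣ) :
    dessinFreeEnergy u v ε = (dessinWeight u v ε).connSeries := by
  classical
  ext e
  by_cases h0 : e = 0
  · subst h0
    change dessinFreeEnergy u v ε 0 = (dessinWeight u v ε).connSeries 0
    simp [MulWeight.connSeries, dessinFreeEnergy]
  set d := wt e with hd
  have hd0 : d ≠ 0 := fun h => h0 (wt_eq_zero.mp h)
  rw [MulWeight.coeff_connSeries _ h0, ← hd, MulWeight.conn_eq, map_sum]
  -- the right-hand side, with the pairs sorted by genus and numbers of vertices
  have hR : ∑ g : Fin 2 → Perm (Fin d), MvPowerSeries.coeff e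
      (if IsTransitive g then (dessinWeight u v ε).w g else 0) =
      ∑ g ∈ Finset.range (d + 3), ∑ k ∈ Finset.Icc 1 (d + 2), ∑ l ∈ Finset.Icc 1 (d + 2),
        if 2 * g + k + l + e.degree = d + 2 then
          (Nat.card {p : Perm (Fin d) × Perm (Fin d) // IsPairOfType k l e p} : ℚ) •
            (u ^ k * v ^ l * ((ε ^ (2 * (g : ℤ) - 2) : Rˣ) : R)) else 0 := by
    rw [Fintype.sum_equiv (finTwoArrowEquiv (Perm (Fin d))) _
      (fun p => ∑ g ∈ Finset.range (d + 3), ∑ k ∈ Finset.Icc 1 (d + 2), ∑ l ∈ Finset.Icc 1 (d + 2),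
      if 2 * g + k + l + e.degree = d + 2 then
        (if IsPairOfType k l e p then u ^ k * v ^ l * ((ε ^ (2 * (g : ℤ) - 2) : Rˣ) : R) else 0)
      else 0)]
    · rw [Finset.sum_comm]
      refine Finset.sum_congr rfl fun g _ => ?_
      rw [Finset.sum_comm]
      refine Finset.sum_congr rfl fun k _ => ?_
      rw [Finset.sum_comm]
      refine Finset.sum_congr rfl fun l _ => ?_
      split_ifs with h
      · rw [← Finset.sum_filter, Finset.sum_const, Nat.card_eq_fintype_card, Fintype.card_subtype,
          Nat.cast_smul_eq_nsmul]
      · simp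
    · intro g
      have hg : g = ![g 0, g 1] := by funext i; fin_cases i <;> rfl
      rw [apply_ite (MvPowerSeries.coeff e), map_zero, coeff_dessinWeight]
      have := sum_genus_eq u v ε hd0 e (g 0) (g 1)
      rw [← hg] at this
      exact this
  rw [hR]
  change dessinFreeEnergy u v ε e = _
  rw [dessinFreeEnergy, if_neg h0]
  have hL : ∀ μ ∈ Fintype.piFinset (fun _ : Fin e.degree => e.support),
      (if pMonomial μ = e then ((Nat.factorial e.degree : ℚ)⁻¹) • dessinCorrelator u v ε μ else 0) =
      ∑ g ∈ Finset.range (d + 3), ∑ k ∈ Finset.Icc 1 (d + 2), ∑ l ∈ Finset.Icc 1 (d + 2),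
        if 2 * g + k + l + e.degree = d + 2 then
          ((Nat.factorial e.degree : ℚ)⁻¹ * ((Nat.factorial d : ℚ)⁻¹ *
          ((if pMonomial μ = e then Nat.card (LabelledDessin (Fin d) k l μ) else 0 : ℕ) : ℚ))) •
            (u ^ k * v ^ l * ((ε ^ (2 * (g : ℤ) - 2) : Rˣ) : R)) else 0 := by
    intro μ _
    split_ifs with hμ
    · have hsum : ∑ i, (μ i : ℕ) = d := by rw [← wt_pMonomial, hμ]
      rw [dessinCorrelator]
      simp only [dessinCount_eq, hsum, Finset.smul_sum, smul_ite, smul_zero, smul_smul]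
      simp only [div_eq_inv_mul]
    · simp
  rw [Finset.sum_congr rfl hL, Finset.smul_sum, Finset.sum_comm]
  refine Finset.sum_congr rfl fun g _ => ?_
  rw [Finset.smul_sum, Finset.sum_comm]
  refine Finset.sum_congr rfl fun k _ => ?_
  rw [Finset.smul_sum, Finset.sum_comm]
  refine Finset.sum_congr rfl fun l _ => ?_
  split_ifs with h
  · rw [← Finset.sum_smul, ← Finset.mul_sum, ← Finset.mul_sum, ← Nat.cast_sum, sum_card_dessin,
      smul_smul]
    congr 1
    have : (e.degree.factorial : ℚ) ≠ 0 := by positivity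
    push_cast
    field_simp
  · simp

/-- The coefficients of the dessin partition function count all pairs of permutations. -/
theorem coeff_dessinPartitionFunction (u v : R) (ε : Rˣ) (e : ℕ+ →₀ ℕ) :
    MvPowerSeries.coeff e (dessinPartitionFunction u v ε) =
      (((wt e).factorial : ℚ)⁻¹) • ∑ p : Perm (Fin (wt e)) × Perm (Fin (wt e)),
        if cycExp (p.1 * p.2) = e then u ^ cyc p.1 * v ^ cyc p.2 *
          ((ε ^ ((wt e : ℤ) - cyc p.1 - cyc p.2 - e.degree) : Rˣ) : R) else 0 := by
  rw [dessinPartitionFunction, dessinFreeEnergy_eq,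
    MulWeight.formalExp_connSeries _ (dessinWeight_homogeneous u v ε),
    MulWeight.coeff_totalSeries, MulWeight.total_eq, map_sum]
  congr 1
  refine Fintype.sum_equiv (finTwoArrowEquiv (Perm (Fin (wt e)))) _ _ fun g => ?_
  rw [coeff_dessinWeight]
  change _ = if cycExp (g 0 * g 1) = e then _ else 0
  split_ifs with h
  · have hc : cyc (g 0 * g 1) = e.degree := (degree_cycExp _).symm.trans (congrArg _ h)
    rw [hc]; rfl
  · rfl

lemma map_dessinPartitionFunction {S : Type*} [CommRing S] [Algebra ℚ S] (f : R →+* S)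
    (u v : R) (ε : Rˣ) : MvPowerSeries.map f (dessinPartitionFunction u v ε) =
      dessinPartitionFunction (f u) (f v) (Units.map f ε) := by
  ext e
  rw [MvPowerSeries.coeff_map, coeff_dessinPartitionFunction, coeff_dessinPartitionFunction,
    map_rat_smul f, map_sum]
  congr 1
  refine Finset.sum_congr rfl fun p _ => ?_
  split_ifs with h
  · rw [map_mul, map_mul, map_pow, map_pow, ← map_zpow]; rfl
  · exact map_zero f

end Dessin

end

/-! ### Polynomial dependence on the parameters -/

lemma specialize_toLaurent (x a : ℂ) (ε : ℂˣ) (g : Polynomial (MvPolynomial (Fin 2) ℂ)) :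
    specialize x a ε (Polynomial.toLaurent g) =
      MvPolynomial.eval ![x, a] (Polynomial.eval (MvPolynomial.C (ε : ℂ)) g) := by
  rw [specialize, LaurentPolynomial.eval₂_toLaurent, ← Polynomial.eval₂_hom, MvPolynomial.eval_C]

/-- An element of `ℂ[x, a, ε, ε⁻¹]` is determined by its values at the parameters of the LUE. -/
lemma eq_zero_of_specialize (f : CoeffRing)
    (h : ∀ (n : ℕ) (α : ℂ) (ε : ℝ) (hε : 0 < ε), 1 ≤ n → -1 < α.re →
      specialize (n * ε) (α * ε) (realUnit ε hε.ne') f = 0) : f = 0 := by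
  obtain ⟨N, g, hg⟩ := LaurentPolynomial.exists_T_pow f
  have hroot : ∀ ε : ℝ, 0 < ε → Polynomial.eval (MvPolynomial.C (ε : ℂ)) g = 0 := by
    intro ε hε
    have hε' : (ε : ℂ) ≠ 0 := Complex.ofReal_ne_zero.mpr hε.ne'
    refine MvPolynomial.funext_set ![(fun n : ℕ => (n : ℂ) * ε) '' Set.Ici 1,
      (fun α : ℂ => α * ε) '' {α | -1 < α.re}] ?_ ?_
    · intro i
      fin_cases i
      · exact (Set.Ici_infinite 1).image fun a _ b _ hab => by
          exact_mod_cast mul_right_cancel₀ hε' hab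
      · refine Set.Infinite.image (fun a _ b _ hab => mul_right_cancel₀ hε' hab) ?_
        refine Set.Infinite.mono (s := Set.range fun n : ℕ => (n : ℂ)) ?_
          (Set.infinite_range_of_injective Nat.cast_injective)
        rintro _ ⟨n, rfl⟩
        have : (0 : ℝ) ≤ n := Nat.cast_nonneg n
        simp; linarith
    · intro y hy
      obtain ⟨n, hn, hn'⟩ := hy 0 (Set.mem_univ _)
      obtain ⟨α, hα, hα'⟩ := hy 1 (Set.mem_univ _)
      have hyy : y = ![(n : ℂ) * ε, α * ε] := by
        funext i; fin_cases i
        · exact hn'.symm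
        · exact hα'.symm
      have := specialize_toLaurent (n * ε) (α * ε) (realUnit ε hε.ne') g
      rw [hg, map_mul, h n α ε hε hn hα, zero_mul] at this
      rw [hyy, map_zero]
      exact this.symm
  have hg0 : g = 0 := by
    refine Polynomial.eq_zero_of_infinite_isRoot g ?_
    refine Set.Infinite.mono (s := (fun ε : ℝ => (MvPolynomial.C (ε : ℂ) : MvPolynomial (Fin 2) ℂ)) ''
      Set.Ioi 0) ?_ ?_
    · rintro _ ⟨ε, hε, rfl⟩; exact hroot ε hε
    · exact (Set.Ioi_infinite 0).image fun a _ b _ hab =>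
        Complex.ofReal_injective (MvPolynomial.C_injective _ _ hab)
  rw [hg0, map_zero] at hg
  exact (LaurentPolynomial.isUnit_T (N : ℤ)).mul_left_eq_zero.mp hg.symm

lemma IsFormalLUE.unique {Z Z' : MvPowerSeries ℕ+ CoeffRing} (h : IsFormalLUE Z)
    (h' : IsFormalLUE Z') : Z = Z' := by
  refine MvPowerSeries.ext fun e => ?_
  rw [← sub_eq_zero]
  refine eq_zero_of_specialize _ fun n α ε hε hn hα => ?_
  have := congrArg (MvPowerSeries.coeff e) ((h n α ε hε hn hα).trans (h' n α ε hε hn hα).symm)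
  rw [MvPowerSeries.coeff_map, MvPowerSeries.coeff_map] at this
  rw [map_sub, this, sub_self]

/-- Evaluation of the dessin partition function in indeterminates. -/
lemma map_specialize_dessin (x a : ℂ) (ε : ℂˣ) :
    MvPowerSeries.map (specialize x a ε) (dessinPartitionFunction xVar (xVar + aVar) epsVar) =
      dessinPartitionFunction x (x + a) ε := by
  have hx : specialize x a ε xVar = x := by
    simp [specialize, xVar]
  have ha : specialize x a ε aVar = a := by
    simp [specialize, aVar]
  have he : Units.map (specialize x a ε : CoeffRing →* ℂ) epsVar = ε := by
    ext; simp [specialize, epsVar]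
  rw [map_dessinPartitionFunction, map_add, hx, ha, he]

section

open Filter Topology

/-! ### The functional equation of the Barnes function -/

/-- The factors of the Weierstrass product of `G (1 + w)`. -/
def barnesFactor (w : ℂ) (j : ℕ) : ℂ :=
  (1 + w / (j : ℂ)) ^ j * Complex.exp (w ^ 2 / (2 * (j : ℂ)) - w)

/-- The logarithms of the factors of the Weierstrass product. -/
def barnesLog (w : ℂ) (j : ℕ) : ℂ :=
  j * (Complex.log (1 + w / (j : ℂ)) - Complex.logTaylor 3 (w / (j : ℂ)))

lemma one_add_div_ne_zero {w : ℂ} (hw : -1 < w.re) (j : ℕ) : 1 + w / ((j + 1 : ℕ) : ℂ) ≠ 0 := by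
  intro h
  have hj : ((j + 1 : ℕ) : ℂ) ≠ 0 := by exact_mod_cast j.succ_ne_zero
  have h2 : w = -((j + 1 : ℕ) : ℂ) := by
    field_simp at h
    linear_combination h
  rw [h2] at hw
  have : (0 : ℝ) ≤ j := Nat.cast_nonneg j
  simp at hw
  linarith

lemma exp_barnesLog {w : ℂ} (hw : -1 < w.re) (j : ℕ) :
    Complex.exp (barnesLog w (j + 1)) = barnesFactor w (j + 1) := by
  have hj : ((j + 1 : ℕ) : ℂ) ≠ 0 := by exact_mod_cast j.succ_ne_zero
  have h : barnesLog w (j + 1) = ((j + 1 : ℕ) : ℂ) * Complex.log (1 + w / ((j + 1 : ℕ) : ℂ)) +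
      (w ^ 2 / (2 * ((j + 1 : ℕ) : ℂ)) - w) := by
    rw [barnesLog, mul_sub, sub_eq_add_neg]
    congr 1
    simp only [Complex.logTaylor_succ, Complex.logTaylor_zero, Pi.add_apply]
    field_simp
    push_cast
    ring
  rw [h, Complex.exp_add, Complex.exp_nat_mul, Complex.exp_log (one_add_div_ne_zero hw j),
    barnesFactor]

lemma summable_barnesLog (w : ℂ) : Summable (barnesLog w) := by
  refine summable_of_isBigO_nat (g := fun n : ℕ => 1 / (n : ℝ) ^ 2)
    (Real.summable_one_div_nat_pow.mpr (by norm_num)) ?_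
  have hlim : Tendsto (fun n : ℕ => w / (n : ℂ)) atTop (𝓝 0) :=
    tendsto_const_div_atTop_nhds_zero_nat w
  have h1 := (Complex.log_sub_logTaylor_isBigO 2).comp_tendsto hlim
  have h2 : (fun n : ℕ => barnesLog w n) =O[atTop] fun n : ℕ => (n : ℂ) * (w / (n : ℂ)) ^ 3 :=
    (Asymptotics.isBigO_refl (fun n : ℕ => (n : ℂ)) atTop).mul h1
  refine h2.trans ?_
  refine Asymptotics.IsBigO.of_bound (‖w‖ ^ 3) ?_
  filter_upwards [eventually_gt_atTop 0] with n hn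
  have hn' : (0 : ℝ) < n := by exact_mod_cast hn
  rw [norm_mul, norm_pow, norm_div, Complex.norm_natCast, Real.norm_of_nonneg (by positivity)]
  apply le_of_eq
  field_simp

/-- The value of the Weierstrass product. -/
def barnesProd (w : ℂ) : ℂ := Complex.exp (∑' j : ℕ, barnesLog w (j + 1))

lemma hasProd_barnesFactor {w : ℂ} (hw : -1 < w.re) :
    HasProd (fun j : ℕ => barnesFactor w (j + 1)) (barnesProd w) := by
  have h := ((summable_nat_add_iff 1).mpr (summable_barnesLog w)).hasSum.cexp
  have he : (Complex.exp ∘ fun j => barnesLog w (j + 1)) = fun j => barnesFactor w (j + 1) :=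
    funext fun j => exp_barnesLog hw j
  rwa [he] at h

lemma barnesG_eq {w : ℂ} (hw : -1 < w.re) : barnesG (w + 1) =
    (2 * (Real.pi : ℂ)) ^ (w / 2) *
    Complex.exp (-(w + (1 + (Real.eulerMascheroniConstant : ℂ)) * w ^ 2) / 2) * barnesProd w := by
  rw [barnesG, add_sub_cancel_right, ← (hasProd_barnesFactor hw).tprod_eq,
    ← tprod_pnat_eq_tprod_succ]
  rfl

lemma barnesG_ne_zero {w : ℂ} (hw : -1 < w.re) : barnesG (w + 1) ≠ 0 := by
  rw [barnesG_eq hw]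
  refine mul_ne_zero (mul_ne_zero ?_ (Complex.exp_ne_zero _)) (Complex.exp_ne_zero _)
  rw [Complex.cpow_def_of_ne_zero (by simp [Real.pi_ne_zero])]
  exact Complex.exp_ne_zero _

/-- The quotient of the partial Weierstrass products at `w + 1` and at `w`; it telescopes. -/
lemma prod_barnesFactor_add_one (w : ℂ) (N : ℕ) :
    (∏ j ∈ Finset.range N, barnesFactor (w + 1) (j + 1)) *
      ∏ j ∈ Finset.range N, (w + 1 + (j : ℂ)) =
    (∏ j ∈ Finset.range N, barnesFactor w (j + 1)) * (((N : ℂ) + 1 + w) ^ N *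
      Complex.exp ((w + 1 / 2) * ((harmonic N : ℝ) : ℂ) - N)) := by
  induction N with
  | zero => simp
  | succ N ih =>
    have hj : ((N : ℂ) + 1) ≠ 0 := by exact_mod_cast N.succ_ne_zero
    have hstep : barnesFactor (w + 1) (N + 1) * ((N : ℂ) + 1 + w) ^ (N + 1) =
        barnesFactor w (N + 1) * (((N : ℂ) + 1 + 1 + w) ^ (N + 1) *
          Complex.exp ((w + 1 / 2) * (1 / ((N : ℂ) + 1)) - 1)) := by
      have e1 : (w + 1) ^ 2 / (2 * ((N + 1 : ℕ) : ℂ)) - (w + 1) =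
          (w ^ 2 / (2 * ((N + 1 : ℕ) : ℂ)) - w) + ((w + 1 / 2) * (1 / ((N : ℂ) + 1)) - 1) := by
        push_cast
        field_simp
        ring
      have e2 : (1 + (w + 1) / ((N + 1 : ℕ) : ℂ)) = ((N : ℂ) + 1 + 1 + w) / ((N : ℂ) + 1) := by
        push_cast
        field_simp
        ring
      have e3 : (1 + w / ((N + 1 : ℕ) : ℂ)) = ((N : ℂ) + 1 + w) / ((N : ℂ) + 1) := by
        push_cast
        field_simp
      rw [barnesFactor, barnesFactor, e1, e2, e3, Complex.exp_add, div_pow, div_pow]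
      field_simp
    rw [Finset.prod_range_succ, Finset.prod_range_succ, Finset.prod_range_succ, harmonic_succ]
    have hexp : Complex.exp ((w + 1 / 2) * (((harmonic N + ((N + 1 : ℕ) : ℚ)⁻¹ : ℚ) : ℝ) : ℂ) -
        ((N + 1 : ℕ) : ℂ)) = Complex.exp ((w + 1 / 2) * ((harmonic N : ℝ) : ℂ) - N) *
          Complex.exp ((w + 1 / 2) * (1 / ((N : ℂ) + 1)) - 1) := by
      rw [← Complex.exp_add]
      congr 1
      push_cast
      ring
    rw [hexp]
    push_cast
    linear_combination (barnesFactor (w + 1) (N + 1) * (w + 1 + N)) * ih +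
      (∏ j ∈ Finset.range N, barnesFactor w (j + 1)) *
        Complex.exp ((w + 1 / 2) * ((harmonic N : ℝ) : ℂ) - N) * hstep

/-- The factor by which the Weierstrass product changes under `w ↦ w + 1`. -/
lemma barnesProd_add_one {w : ℂ} (hw : -1 < w.re) :
    barnesProd (w + 1) = barnesProd w * (Complex.Gamma (w + 1) * Complex.exp (1 + w) *
      (((√(2 * Real.pi))⁻¹ : ℝ) : ℂ) *
      Complex.exp ((w + 1 / 2) * (Real.eulerMascheroniConstant : ℂ))) := by
  have hw1 : -1 < (w + 1).re := by simp; linarith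
  have hl := (hasProd_barnesFactor hw1).tendsto_prod_nat
  have hr := (hasProd_barnesFactor hw).tendsto_prod_nat
  refine tendsto_nhds_unique hl ?_
  have t1 := Complex.GammaSeq_tendsto_Gamma (w + 1)
  have t2 := Complex.tendsto_one_add_div_pow_exp (1 + w)
  have t3 : Tendsto (fun N : ℕ => 1 + (1 + w) / (N : ℂ)) atTop (𝓝 1) := by
    simpa using (tendsto_const_div_atTop_nhds_zero_nat (1 + w)).const_add 1
  have t4 : Tendsto (fun N : ℕ => (((√2)⁻¹ * (Stirling.stirlingSeq N)⁻¹ : ℝ) : ℂ)) atTop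
      (𝓝 (((√(2 * Real.pi))⁻¹ : ℝ) : ℂ)) := by
    refine (Complex.continuous_ofReal.tendsto _).comp ?_
    rw [Real.sqrt_mul (by norm_num), mul_inv]
    exact (Stirling.tendsto_stirlingSeq_sqrt_pi.inv₀ (by positivity)).const_mul _
  have t5 : Tendsto (fun N : ℕ => Complex.exp ((w + 1 / 2) *
      (((harmonic N : ℝ) - Real.log N : ℝ) : ℂ))) atTop
      (𝓝 (Complex.exp ((w + 1 / 2) * (Real.eulerMascheroniConstant : ℂ)))) := by
    refine (Complex.continuous_exp.tendsto _).comp (Tendsto.const_mul _ ?_)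
    exact (Complex.continuous_ofReal.tendsto _).comp Real.tendsto_harmonic_sub_log
  have t := hr.mul ((((t1.mul t2).mul t4).mul t5).mul t3)
  rw [mul_one] at t
  refine t.congr' ?_
  filter_upwards [eventually_gt_atTop 0] with N hN
  have hN0 : (N : ℂ) ≠ 0 := by exact_mod_cast hN.ne'
  have hNr : (0 : ℝ) < N := by exact_mod_cast hN
  have hne : ∀ j : ℕ, w + 1 + (j : ℂ) ≠ 0 := by
    intro j h
    have := congrArg Complex.re h
    have hj : (0 : ℝ) ≤ j := Nat.cast_nonneg j
    simp at this
    linarith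
  have hprod : ∏ j ∈ Finset.range N, (w + 1 + (j : ℂ)) ≠ 0 :=
    Finset.prod_ne_zero_iff.mpr fun j _ => hne j
  refine mul_right_cancel₀ hprod ?_
  rw [prod_barnesFactor_add_one w, Complex.GammaSeq, Finset.prod_range_succ, mul_assoc]
  congr 1
  have hf : (N.factorial : ℂ) ≠ 0 := by exact_mod_cast N.factorial_ne_zero
  -- the power of `N` of the Gamma product against the exponential of the logarithm
  have hpow : (N : ℂ) ^ (w + 1) = N * Complex.exp (w * (Real.log N : ℂ)) := by
    rw [Complex.cpow_add _ _ hN0, Complex.cpow_one, Complex.cpow_def_of_ne_zero hN0,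
      Complex.natCast_log, mul_comm, mul_comm w]
  have hsq : ((√(N : ℝ) : ℝ) : ℂ) = Complex.exp (1 / 2 * (Real.log N : ℂ)) := by
    rw [Real.sqrt_eq_rpow, Real.rpow_def_of_pos hNr, Complex.ofReal_exp]
    congr 1
    push_cast
    ring
  have hst : (((√2)⁻¹ * (Stirling.stirlingSeq N)⁻¹ : ℝ) : ℂ) =
      Complex.exp (1 / 2 * (Real.log N : ℂ)) * (N : ℂ) ^ N * Complex.exp (-N) / N.factorial := by
    have h2 : (√2)⁻¹ * (Stirling.stirlingSeq N)⁻¹ =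
        √N * (N : ℝ) ^ N * Real.exp (-N) / N.factorial := by
      have hf' : (N.factorial : ℝ) ≠ 0 := by positivity
      have hs2 : √(2 : ℝ) ≠ 0 := by positivity
      have hsN : √(N : ℝ) ≠ 0 := by positivity
      rw [Stirling.stirlingSeq, Real.sqrt_mul (by norm_num), div_pow, Real.exp_neg,
        ← Real.exp_nat_mul, mul_one]
      field_simp
    rw [h2, ← hsq]
    push_cast
    rfl
  have hH : Complex.exp ((w + 1 / 2) * (((harmonic N : ℝ) - Real.log N : ℝ) : ℂ)) =
      Complex.exp ((w + 1 / 2) * ((harmonic N : ℝ) : ℂ)) *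
        (Complex.exp (w * (Real.log N : ℂ)) * Complex.exp (1 / 2 * (Real.log N : ℂ)))⁻¹ := by
    rw [← Complex.exp_add, ← Complex.exp_neg, ← Complex.exp_add]
    congr 1
    push_cast
    ring
  have hH' : Complex.exp ((w + 1 / 2) * ((harmonic N : ℝ) : ℂ) - N) =
      Complex.exp ((w + 1 / 2) * ((harmonic N : ℝ) : ℂ)) * Complex.exp (-N) := by
    rw [← Complex.exp_add, sub_eq_add_neg]
  have hq : 1 + (1 + w) / (N : ℂ) = (w + 1 + N) / N := by field_simp; ring
  have hq' : (N : ℂ) + 1 + w = w + 1 + N := by ring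
  have hw1N := hne N
  have hE1 := Complex.exp_ne_zero (w * (Real.log N : ℂ))
  have hE2 := Complex.exp_ne_zero (1 / 2 * (Real.log N : ℂ))
  rw [hpow, hst, hH, hH', hq, hq', div_pow]
  generalize Complex.exp (w * (Real.log N : ℂ)) = E1 at *
  generalize Complex.exp (1 / 2 * (Real.log N : ℂ)) = E2 at *
  generalize ∏ j ∈ Finset.range N, (w + 1 + (j : ℂ)) = Q at *
  field_simp

/-- The functional equation `G (z + 1) = Γ (z) G (z)` for `z = w + 1`. -/
theorem barnesG_add_one {w : ℂ} (hw : -1 < w.re) :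
    barnesG (w + 1 + 1) = Complex.Gamma (w + 1) * barnesG (w + 1) := by
  have hw1 : -1 < (w + 1).re := by simp; linarith
  have h2π : (2 * (Real.pi : ℂ)) ≠ 0 := by simp [Real.pi_ne_zero]
  have hs : (((√(2 * Real.pi)) : ℝ) : ℂ) = (2 * (Real.pi : ℂ)) ^ (1 / 2 : ℂ) := by
    rw [Real.sqrt_eq_rpow, Complex.ofReal_cpow (by positivity)]
    push_cast
    rfl
  have hs0 : (((√(2 * Real.pi)) : ℝ) : ℂ) ≠ 0 := by
    have : √(2 * Real.pi) ≠ 0 := by positivity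
    exact_mod_cast this
  rw [barnesG_eq hw1, barnesG_eq hw, barnesProd_add_one hw, add_div, Complex.cpow_add _ _ h2π, ← hs]
  have hexp : Complex.exp (-(w + (1 + (Real.eulerMascheroniConstant : ℂ)) * w ^ 2) / 2) =
      Complex.exp (-(w + 1 + (1 + (Real.eulerMascheroniConstant : ℂ)) * (w + 1) ^ 2) / 2) *
      (Complex.exp (1 + w) * Complex.exp ((w + 1 / 2) * (Real.eulerMascheroniConstant : ℂ))) := by
    rw [← Complex.exp_add, ← Complex.exp_add]
    congr 1
    ring
  rw [hexp]
  push_cast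
  field_simp

/-- Iterated functional equation. -/
theorem barnesG_add_nat {w : ℂ} (hw : -1 < w.re) (n : ℕ) :
    barnesG (n + w + 1) = (∏ j ∈ Finset.range n, Complex.Gamma (w + j + 1)) * barnesG (w + 1) := by
  induction n with
  | zero => simp
  | succ n ih =>
    have h : -1 < (w + n).re := by
      have : (0 : ℝ) ≤ n := Nat.cast_nonneg n
      simp; linarith
    have := barnesG_add_one h
    rw [Finset.prod_range_succ, show ((n + 1 : ℕ) : ℂ) + w + 1 = w + n + 1 + 1 by push_cast; ring,
      this, show w + (n : ℂ) + 1 = n + w + 1 by ring, ih]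
    ring

end

section

open Matrix

/-! ### Hermitian matrices in coordinates -/

lemma hermitianMatrix_of_lt {n : ℕ} (c : HermitianCoord n) {i j : Fin n} (h : i < j) :
    hermitianMatrix c i j = ⟨(c.2 ⟨(i, j), h⟩).1, (c.2 ⟨(i, j), h⟩).2⟩ := by
  simp [hermitianMatrix, h]

lemma hermitianMatrix_of_gt {n : ℕ} (c : HermitianCoord n) {i j : Fin n} (h : j < i) :
    hermitianMatrix c i j = ⟨(c.2 ⟨(j, i), h⟩).1, -(c.2 ⟨(j, i), h⟩).2⟩ := by
  simp [hermitianMatrix, h, h.le]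

lemma hermitianMatrix_diag {n : ℕ} (c : HermitianCoord n) (i : Fin n) :
    hermitianMatrix c i i = c.1 i := by
  simp [hermitianMatrix]

/-- `hermitianMatrix` as a linear map. -/
def hermLin (n : ℕ) : HermitianCoord n →ₗ[ℝ] Matrix (Fin n) (Fin n) ℂ where
  toFun := hermitianMatrix
  map_add' c c' := by
    ext i j
    rcases lt_trichotomy i j with h | rfl | h
    · simp only [Matrix.add_apply, hermitianMatrix_of_lt _ h]; apply Complex.ext <;> simp
    · simp only [Matrix.add_apply, hermitianMatrix_diag]; simp
    · simp only [Matrix.add_apply, hermitianMatrix_of_gt _ h]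
      apply Complex.ext <;> simp
      ring
  map_smul' r c := by
    ext i j
    rcases lt_trichotomy i j with h | rfl | h
    · simp only [Matrix.smul_apply, hermitianMatrix_of_lt _ h]; apply Complex.ext <;> simp
    · simp only [Matrix.smul_apply, hermitianMatrix_diag]; simp
    · simp only [Matrix.smul_apply, hermitianMatrix_of_gt _ h]; apply Complex.ext <;> simp

/-- The coordinates of a matrix, read off from its upper triangle. -/
def coordOf (n : ℕ) : Matrix (Fin n) (Fin n) ℂ →ₗ[ℝ] HermitianCoord n where
  toFun M := (fun i => (M i i).re, fun q => ((M q.1.1 q.1.2).re, (M q.1.1 q.1.2).im))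
  map_add' M M' := by ext <;> simp
  map_smul' r M := by ext <;> simp

lemma coordOf_hermitianMatrix {n : ℕ} (c : HermitianCoord n) :
    coordOf n (hermitianMatrix c) = c := by
  refine Prod.ext (funext fun i => ?_) (funext fun q => ?_)
  · simp [coordOf, hermitianMatrix_diag]
  · simp [coordOf, hermitianMatrix_of_lt c q.2]

lemma hermitianMatrix_isHermitian {n : ℕ} (c : HermitianCoord n) :
    (hermitianMatrix c).IsHermitian := by
  ext i j
  rw [conjTranspose_apply]
  rcases lt_trichotomy i j with h | rfl | h
  · rw [hermitianMatrix_of_lt c h, hermitianMatrix_of_gt c h]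
    apply Complex.ext <;> simp
  · rw [hermitianMatrix_diag]; simp
  · rw [hermitianMatrix_of_lt c h, hermitianMatrix_of_gt c h]
    apply Complex.ext <;> simp

lemma hermitianMatrix_coordOf {n : ℕ} {M : Matrix (Fin n) (Fin n) ℂ} (hM : M.IsHermitian) :
    hermitianMatrix (coordOf n M) = M := by
  ext i j
  rcases lt_trichotomy i j with h | rfl | h
  · rw [hermitianMatrix_of_lt _ h]; rfl
  · rw [hermitianMatrix_diag]
    have := hM.apply i i
    exact (Complex.conj_eq_iff_re.mp this)
  · rw [hermitianMatrix_of_gt _ h]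
    rw [← hM.apply i j]
    apply Complex.ext <;> simp [coordOf]

lemma continuous_hermitianMatrix (n : ℕ) :
    Continuous (hermitianMatrix : HermitianCoord n → Matrix (Fin n) (Fin n) ℂ) :=
  (hermLin n).continuous_of_finiteDimensional

/-- The entries of a positive semidefinite matrix are bounded by its trace, because its `2 × 2`
principal minors are nonnegative. -/
lemma norm_entry_le_trace {n : ℕ} {M : Matrix (Fin n) (Fin n) ℂ} (hM : M.PosSemidef)
    (i j : Fin n) : ‖M i j‖ ≤ M.trace.re := by
  have hdiag : ∀ k, 0 ≤ (M k k).re ∧ M k k = ((M k k).re : ℂ) := fun k => by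
    have h := Complex.nonneg_iff.mp (hM.diag_nonneg (i := k))
    exact ⟨h.1, Complex.ext (by simp) (by simp [h.2])⟩
  have hle : ∀ k, (M k k).re ≤ M.trace.re := fun k => by
    rw [Matrix.trace, Complex.re_sum]
    exact Finset.single_le_sum (f := fun k => (M k k).re) (fun l _ => (hdiag l).1)
      (Finset.mem_univ k)
  -- the principal minor of the rows `i`, `j` is nonnegative
  have hdet := (hM.submatrix ![i, j]).det_nonneg
  rw [det_fin_two] at hdet
  simp only [submatrix_apply, cons_val_zero, cons_val_one] at hdet
  rw [← hM.1.apply j i, Complex.star_def, Complex.mul_conj', (hdiag i).2, (hdiag j).2] at hdet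
  have hdet' : ‖M i j‖ ^ 2 ≤ (M i i).re * (M j j).re := by
    have := sub_nonneg.mp hdet
    exact_mod_cast this
  refine abs_le_of_sq_le_sq' (hdet'.trans ?_) ((hdiag i).1.trans (hle i)) |>.2
  rw [sq]
  exact mul_le_mul (hle i) (hle j) (hdiag j).1 ((hdiag i).1.trans (hle i))

lemma isClosed_posSemidef (n : ℕ) :
    IsClosed {c : HermitianCoord n | (hermitianMatrix c).PosSemidef} := by
  have : {c : HermitianCoord n | (hermitianMatrix c).PosSemidef} =
      ⋂ x : Fin n → ℂ, {c | 0 ≤ star x ⬝ᵥ (hermitianMatrix c *ᵥ x)} := by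
    ext c
    simp only [Set.mem_ofPred_eq, Set.mem_iInter]
    exact ⟨fun h x => h.dotProduct_mulVec_nonneg x,
      fun h => .of_dotProduct_mulVec_nonneg (hermitianMatrix_isHermitian c) h⟩
  rw [this]
  refine isClosed_iInter fun x => ?_
  refine isClosed_le continuous_const ?_
  exact continuous_const.dotProduct ((continuous_hermitianMatrix n).matrix_mulVec continuous_const)

lemma measurableSet_positiveHermitian (n : ℕ) : MeasurableSet (positiveHermitian n) := by
  have : positiveHermitian n = {c : HermitianCoord n | (hermitianMatrix c).PosSemidef} ∩
      {c | (hermitianMatrix c).det ≠ 0} := by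
    ext c
    constructor
    · intro h
      have h' : (hermitianMatrix c).PosDef := h
      exact ⟨h'.posSemidef, h'.det_pos.ne'⟩
    · rintro ⟨h1, h2⟩
      exact h1.posDef_iff_det_ne_zero.mpr h2
  rw [this]
  refine (isClosed_posSemidef n).measurableSet.inter ?_
  exact (isOpen_ne.preimage (continuous_hermitianMatrix n).matrix_det).measurableSet

lemma det_eq_ofReal {n : ℕ} {M : Matrix (Fin n) (Fin n) ℂ} (hM : M.PosDef) :
    0 < M.det.re ∧ M.det = (M.det.re : ℂ) := by
  have h := Complex.pos_iff.mp hM.det_pos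
  exact ⟨h.1, Complex.ext (by simp) (by simp [h.2])⟩

lemma trace_eq_ofReal {n : ℕ} {M : Matrix (Fin n) (Fin n) ℂ} (hM : M.PosSemidef) :
    0 ≤ M.trace.re ∧ M.trace = (M.trace.re : ℂ) := by
  have h := Complex.nonneg_iff.mp hM.trace_nonneg
  exact ⟨h.1, Complex.ext (by simp) (by simp [h.2])⟩

/-- The density `(det M) ^ α exp (-tr M / ε)` of the Laguerre ensemble. -/
def lueDensity {n : ℕ} (α : ℂ) (ε : ℝ) (c : HermitianCoord n) : ℂ :=
  (hermitianMatrix c).det ^ α * Complex.exp (-(1 / (ε : ℂ)) * (hermitianMatrix c).trace)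

lemma measurable_lueDensity {n : ℕ} (α : ℂ) (ε : ℝ) :
    Measurable (lueDensity α ε : HermitianCoord n → ℂ) := by
  have h1 : Measurable fun c : HermitianCoord n => (hermitianMatrix c).det :=
    (continuous_hermitianMatrix n).matrix_det.measurable
  have h2 : Measurable fun c : HermitianCoord n => (hermitianMatrix c).trace :=
    (continuous_hermitianMatrix n).matrix_trace.measurable
  unfold lueDensity
  fun_prop

lemma norm_lueDensity {n : ℕ} (α : ℂ) (ε : ℝ) {c : HermitianCoord n}
    (hc : c ∈ positiveHermitian n) : ‖lueDensity α ε c‖ =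
      (hermitianMatrix c).det.re ^ α.re * Real.exp (-(1 / ε) * (hermitianMatrix c).trace.re) := by
  have hc' : (hermitianMatrix c).PosDef := hc
  obtain ⟨h1, h2⟩ := det_eq_ofReal hc'
  obtain ⟨h3, h4⟩ := trace_eq_ofReal hc'.posSemidef
  rw [lueDensity, norm_mul, h2, Complex.norm_cpow_eq_rpow_re_of_pos h1, Complex.norm_exp, h4]
  congr 2
  rw [← Complex.ofReal_one, ← Complex.ofReal_div, ← Complex.ofReal_neg, ← Complex.ofReal_mul,
    Complex.ofReal_re, Complex.ofReal_re]

end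

section

open Matrix

/-! ### The normalization integral, by Schur complements -/

/-- The positions above the diagonal in a matrix of size `n`. -/
abbrev UpperIndex (n : ℕ) : Type := {q : Fin n × Fin n // q.1 < q.2}

/-- Positions above the diagonal in size `n + 1`: the first row, and those of the remaining block. -/
def upperIndexSucc (n : ℕ) : Fin n ⊕ UpperIndex n ≃ UpperIndex (n + 1) :=
  Equiv.ofBijective
    (Sum.elim (fun j => ⟨(0, j.succ), Fin.succ_pos j⟩)
      (fun q => ⟨(q.1.1.succ, q.1.2.succ), Fin.succ_lt_succ_iff.mpr q.2⟩)) <| by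
    constructor
    · rintro (i | ⟨⟨i, i'⟩, hi⟩) (j | ⟨⟨j, j'⟩, hj⟩) h
      · simpa using h
      · have := congrArg (fun q => q.1.1) h
        exact absurd this.symm (Fin.succ_ne_zero _)
      · have := congrArg (fun q => q.1.1) h
        exact absurd this (Fin.succ_ne_zero _)
      · simpa using h
    · rintro ⟨⟨i, j⟩, h⟩
      have hj : j ≠ 0 := (lt_of_le_of_lt (Fin.zero_le i) h).ne'
      obtain ⟨j, rfl⟩ := Fin.exists_succ_eq.mpr hj
      by_cases hi : i = 0
      · subst hi; exact ⟨Sum.inl j, rfl⟩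
      · obtain ⟨i, rfl⟩ := Fin.exists_succ_eq.mpr hi
        exact ⟨Sum.inr ⟨(i, j), Fin.succ_lt_succ_iff.mp h⟩, rfl⟩

/-- Coordinates in size `n + 1` from the first diagonal entry and the rest of the first row, and the
coordinates of the remaining block. -/
def borderCoord {n : ℕ} (p : (ℝ × (Fin n → ℝ × ℝ)) × HermitianCoord n) : HermitianCoord (n + 1) :=
  ((MeasurableEquiv.piFinSuccAbove (fun _ => ℝ) 0).symm (p.1.1, p.2.1),
    MeasurableEquiv.piCongrLeft (fun _ => ℝ × ℝ) (upperIndexSucc n)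
      ((MeasurableEquiv.sumPiEquivProdPi fun _ => ℝ × ℝ).symm (p.1.2, p.2.2)))

lemma measurePreserving_borderCoord (n : ℕ) :
    MeasurePreserving (borderCoord : _ → HermitianCoord (n + 1)) volume volume := by
  have h1 := (volume_preserving_piFinSuccAbove (fun _ : Fin (n + 1) => ℝ) 0).symm
  have h2 := (volume_measurePreserving_piCongrLeft (fun _ => ℝ × ℝ) (upperIndexSucc n)).comp
    (volume_measurePreserving_sumPiEquivProdPi_symm fun _ : Fin n ⊕ UpperIndex n => ℝ × ℝ)
  have h3 := h1.prod h2
  -- the exchange of the two middle factors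
  have e1 : MeasurePreserving
      (MeasurableEquiv.prodAssoc : (ℝ × (Fin n → ℝ × ℝ)) × HermitianCoord n ≃ᵐ _) volume volume :=
    measurePreserving_prodAssoc _ _ _
  have e2 : MeasurePreserving (MeasurableEquiv.prodAssoc.symm :
      (Fin n → ℝ × ℝ) × (Fin n → ℝ) × (UpperIndex n → ℝ × ℝ) ≃ᵐ _) volume volume :=
    (measurePreserving_prodAssoc _ _ _).symm _
  have e3 : MeasurePreserving
      (Prod.swap : (Fin n → ℝ × ℝ) × (Fin n → ℝ) → _) volume volume :=
    Measure.measurePreserving_swap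
  have e4 : MeasurePreserving (MeasurableEquiv.prodAssoc :
      ((Fin n → ℝ) × (Fin n → ℝ × ℝ)) × (UpperIndex n → ℝ × ℝ) ≃ᵐ _) volume volume :=
    measurePreserving_prodAssoc _ _ _
  have e5 : MeasurePreserving (MeasurableEquiv.prodAssoc.symm :
      ℝ × (Fin n → ℝ) × ((Fin n → ℝ × ℝ) × (UpperIndex n → ℝ × ℝ)) ≃ᵐ _) volume volume :=
    (measurePreserving_prodAssoc _ _ _).symm _
  have hm := (MeasurePreserving.id (volume : Measure ℝ)).prod
    (e4.comp ((e3.prod (MeasurePreserving.id (volume : Measure (UpperIndex n → ℝ × ℝ)))).comp e2))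
  exact h3.comp (e5.comp (hm.comp e1))

section Border

variable {n : ℕ} (a : ℝ) (z : Fin n → ℝ × ℝ) (d : HermitianCoord n)

lemma borderCoord_diag_zero : (borderCoord ((a, z), d)).1 0 = a := rfl

lemma borderCoord_row (j : Fin n) :
    (borderCoord ((a, z), d)).2 ⟨(0, j.succ), Fin.succ_pos j⟩ = z j :=
  Equiv.piCongrLeft_apply_apply (fun _ => ℝ × ℝ) (upperIndexSucc n) _ (Sum.inl j)

lemma borderCoord_block (q : UpperIndex n) :
    (borderCoord ((a, z), d)).2 ⟨(q.1.1.succ, q.1.2.succ), Fin.succ_lt_succ_iff.mpr q.2⟩ = d.2 q :=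
  Equiv.piCongrLeft_apply_apply (fun _ => ℝ × ℝ) (upperIndexSucc n) _ (Sum.inr q)

/-- The first row without its diagonal entry, as a matrix. -/
def rowMatrix (z : Fin n → ℝ × ℝ) : Matrix Unit (Fin n) ℂ := fun _ j => ⟨(z j).1, (z j).2⟩

/-- Indices in size `n + 1` as the first one and the others. -/
def borderEquiv (n : ℕ) : Unit ⊕ Fin n ≃ Fin (n + 1) :=
  Equiv.ofBijective (Sum.elim (fun _ => 0) Fin.succ) <| by
    constructor
    · rintro (i | i) (j | j) h
      · rfl
      · exact absurd h.symm (Fin.succ_ne_zero _)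
      · exact absurd h (Fin.succ_ne_zero _)
      · simpa using h
    · intro i
      refine Fin.cases ?_ (fun i => ?_) i
      · exact ⟨Sum.inl (), rfl⟩
      · exact ⟨Sum.inr i, rfl⟩

/-- A real number as a matrix of size one. -/
def scalarMatrix (a : ℝ) : Matrix Unit Unit ℂ := diagonal fun _ => (a : ℂ)

lemma hermitianMatrix_borderCoord :
    (hermitianMatrix (borderCoord ((a, z), d))).submatrix (borderEquiv n) (borderEquiv n) =
      fromBlocks (scalarMatrix a) (rowMatrix z) (rowMatrix z)ᴴ (hermitianMatrix d) := by
  ext i j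
  rcases i with i | i <;> rcases j with j | j
  · change hermitianMatrix (borderCoord ((a, z), d)) 0 0 = scalarMatrix a () ()
    rw [hermitianMatrix_diag, scalarMatrix, diagonal_apply_eq]; rfl
  · change hermitianMatrix (borderCoord ((a, z), d)) 0 j.succ = _
    rw [hermitianMatrix_of_lt _ (Fin.succ_pos j), borderCoord_row]; rfl
  · change hermitianMatrix (borderCoord ((a, z), d)) i.succ 0 = _
    rw [hermitianMatrix_of_gt _ (Fin.succ_pos i), borderCoord_row]; rfl
  · change hermitianMatrix (borderCoord ((a, z), d)) i.succ j.succ = hermitianMatrix d i j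
    rcases lt_trichotomy i j with h | rfl | h
    · rw [hermitianMatrix_of_lt _ h, hermitianMatrix_of_lt _ (Fin.succ_lt_succ_iff.mpr h)]
      have := borderCoord_block a z d ⟨(i, j), h⟩
      rw [this]
    · rw [hermitianMatrix_diag, hermitianMatrix_diag]; rfl
    · rw [hermitianMatrix_of_gt _ h, hermitianMatrix_of_gt _ (Fin.succ_lt_succ_iff.mpr h)]
      have := borderCoord_block a z d ⟨(j, i), h⟩
      rw [this]

/-- The rank one correction in the Schur complement, in coordinates. -/
def schurShift (p : ℝ × (Fin n → ℝ × ℝ)) : HermitianCoord n :=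
  coordOf n (((p.1 : ℂ)⁻¹) • ((rowMatrix p.2)ᴴ * rowMatrix p.2))

lemma hermitianMatrix_schurShift (p : ℝ × (Fin n → ℝ × ℝ)) :
    hermitianMatrix (schurShift p) = ((p.1 : ℂ)⁻¹) • ((rowMatrix p.2)ᴴ * rowMatrix p.2) := by
  refine hermitianMatrix_coordOf ?_
  rw [IsHermitian, conjTranspose_smul, conjTranspose_mul, conjTranspose_conjTranspose]
  simp

lemma hermitianMatrix_sub (c c' : HermitianCoord n) :
    hermitianMatrix (c - c') = hermitianMatrix c - hermitianMatrix c' := (hermLin n).map_sub c c'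

lemma scalarMatrix_inv (ha : a ≠ 0) : (scalarMatrix a)⁻¹ = diagonal fun _ => (a : ℂ)⁻¹ := by
  refine inv_eq_left_inv ?_
  rw [scalarMatrix, diagonal_mul_diagonal, ← diagonal_one]
  congr 1
  funext _
  exact inv_mul_cancel₀ (by exact_mod_cast ha)

lemma schurComplement_eq (ha : a ≠ 0) :
    hermitianMatrix d - (rowMatrix z)ᴴ * (scalarMatrix a)⁻¹ * rowMatrix z =
      hermitianMatrix (d - schurShift (a, z)) := by
  rw [hermitianMatrix_sub, hermitianMatrix_schurShift, scalarMatrix_inv a ha]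
  congr 1
  ext i j
  simp [Matrix.mul_apply]
  ring

lemma posDef_scalarMatrix (ha : 0 < a) : (scalarMatrix a).PosDef := by
  rw [scalarMatrix, posDef_diagonal_iff]
  intro _
  exact_mod_cast ha

lemma det_scalarMatrix : (scalarMatrix a).det = a := by simp [scalarMatrix]

lemma det_borderCoord (ha : a ≠ 0) : (hermitianMatrix (borderCoord ((a, z), d))).det =
    a * (hermitianMatrix (d - schurShift (a, z))).det := by
  have : Invertible (scalarMatrix a) :=
    invertibleOfIsUnitDet _ (by rw [det_scalarMatrix]; simpa using ha)
  rw [← det_submatrix_equiv_self (borderEquiv n), hermitianMatrix_borderCoord, det_fromBlocks₁₁,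
    invOf_eq_nonsing_inv, schurComplement_eq a z d ha, det_scalarMatrix]

lemma mem_positiveHermitian_borderCoord : borderCoord ((a, z), d) ∈ positiveHermitian (n + 1) ↔
    0 < a ∧ d - schurShift (a, z) ∈ positiveHermitian n := by
  have hpsd : (hermitianMatrix (borderCoord ((a, z), d))).PosSemidef ↔
      (fromBlocks (scalarMatrix a) (rowMatrix z) (rowMatrix z)ᴴ (hermitianMatrix d)).PosSemidef := by
    rw [← hermitianMatrix_borderCoord, posSemidef_submatrix_equiv]
  have key : ∀ ha : 0 < a, ((hermitianMatrix (borderCoord ((a, z), d))).PosSemidef ↔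
      (hermitianMatrix (d - schurShift (a, z))).PosSemidef) := by
    intro ha
    have : Invertible (scalarMatrix a) :=
      invertibleOfIsUnitDet _ (by rw [det_scalarMatrix]; simpa using ha.ne')
    rw [hpsd, (posDef_scalarMatrix a ha).fromBlocks₁₁, schurComplement_eq a z d ha.ne']
  constructor
  · intro h
    have h' : (hermitianMatrix (borderCoord ((a, z), d))).PosDef := h
    have ha : 0 < a := by
      have := h'.diag_pos (i := 0)
      rw [hermitianMatrix_diag, borderCoord_diag_zero] at this
      exact_mod_cast this
    refine ⟨ha, ((key ha).1 h'.posSemidef).posDef_iff_det_ne_zero.mpr fun h0 => ?_⟩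
    have := h'.det_pos.ne'
    rw [det_borderCoord a z d ha.ne', h0, mul_zero] at this
    exact this rfl
  · rintro ⟨ha, h⟩
    have h' : (hermitianMatrix (d - schurShift (a, z))).PosDef := h
    refine ((key ha).2 h'.posSemidef).posDef_iff_det_ne_zero.mpr ?_
    rw [det_borderCoord a z d ha.ne']
    exact mul_ne_zero (by exact_mod_cast ha.ne') h'.det_pos.ne'

lemma trace_borderCoord : (hermitianMatrix (borderCoord ((a, z), d))).trace =
    a + (∑ j, ((z j).1 ^ 2 + (z j).2 ^ 2) / a : ℝ) +
      (hermitianMatrix (d - schurShift (a, z))).trace := by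
  have h1 : (hermitianMatrix (borderCoord ((a, z), d))).trace =
      a + (hermitianMatrix d).trace := by
    rw [Matrix.trace, Fin.sum_univ_succ, Matrix.trace]
    congr 1
    refine Finset.sum_congr rfl fun i _ => ?_
    rw [diag_apply, diag_apply, hermitianMatrix_diag, hermitianMatrix_diag]; rfl
  rw [h1, hermitianMatrix_sub, hermitianMatrix_schurShift, trace_sub, trace_smul]
  have h2 : ((rowMatrix z)ᴴ * rowMatrix z).trace = ((∑ j, ((z j).1 ^ 2 + (z j).2 ^ 2) : ℝ) : ℂ) := by
    rw [Matrix.trace, Complex.ofReal_sum]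
    refine Finset.sum_congr rfl fun j _ => ?_
    rw [diag_apply, Matrix.mul_apply]
    simp only [conjTranspose_apply, Finset.univ_unique, Finset.sum_singleton, rowMatrix,
      Complex.star_def]
    rw [Complex.conj_mul', ← Complex.ofReal_pow, Complex.sq_norm, Complex.normSq_mk]
    congr 1
    ring
  rw [h2, ← Finset.sum_div]
  push_cast
  rw [smul_eq_mul]
  ring

end Border

lemma measurable_schurShift (n : ℕ) : Measurable (schurShift : ℝ × (Fin n → ℝ × ℝ) → _) := by
  have h0 : ∀ i j, Measurable fun p : ℝ × (Fin n → ℝ × ℝ) =>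
      (((p.1 : ℂ)⁻¹) • ((rowMatrix p.2)ᴴ * rowMatrix p.2)) i j := by
    intro i j
    have hrow : ∀ j, Continuous fun p : ℝ × (Fin n → ℝ × ℝ) => rowMatrix p.2 () j := by
      intro j
      have h1 : Continuous fun p : ℝ × (Fin n → ℝ × ℝ) =>
          (((p.2 j).1 : ℂ) + ((p.2 j).2 : ℂ) * Complex.I) := by fun_prop
      refine h1.congr fun p => ?_
      exact (Complex.mk_eq_add_mul_I _ _).symm
    have h2 : Measurable fun p : ℝ × (Fin n → ℝ × ℝ) =>
        (p.1 : ℂ)⁻¹ * (star (rowMatrix p.2 () i) * rowMatrix p.2 () j) :=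
      (Complex.measurable_ofReal.comp measurable_fst).inv.mul
        ((hrow i).star.mul (hrow j)).measurable
    convert h2 using 2
    simp [Matrix.mul_apply]
  refine Measurable.prodMk (measurable_pi_lambda _ fun i => ?_) (measurable_pi_lambda _ fun q => ?_)
  · exact Complex.measurable_re.comp (h0 i i)
  · exact (Complex.measurable_re.comp (h0 _ _)).prodMk (Complex.measurable_im.comp (h0 _ _))

instance isAddHaarMeasure_volume_real_prod : (volume : Measure (ℝ × ℝ)).IsAddHaarMeasure :=
  inferInstanceAs ((volume : Measure ℝ).prod volume).IsAddHaarMeasure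

instance isAddHaarMeasure_hermitianCoord (n : ℕ) :
    (volume : Measure (HermitianCoord n)).IsAddHaarMeasure :=
  Measure.prod.instIsAddHaarMeasure (volume : Measure (Fin n → ℝ))
    (volume : Measure (UpperIndex n → ℝ × ℝ))

/-- The Schur complement coordinates preserve the measure. -/
lemma measurePreserving_shear (n : ℕ) : MeasurePreserving
    (fun p : (ℝ × (Fin n → ℝ × ℝ)) × HermitianCoord n => (p.1, p.2 - schurShift p.1))
    volume volume := by
  refine MeasurePreserving.skew_product (MeasurePreserving.id _)
    (g := fun a d => d - schurShift a) ?_ ?_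
  · exact measurable_snd.sub ((measurable_schurShift n).comp measurable_fst)
  · refine Filter.Eventually.of_forall fun a => ?_
    exact (measurePreserving_sub_right volume (schurShift a)).map_eq

end

section

open Matrix

/-- The density of the Laguerre ensemble, extended by zero. -/
def lueWeight {n : ℕ} (α : ℂ) (ε : ℝ) : HermitianCoord n → ℂ :=
  (positiveHermitian n).indicator (lueDensity α ε)

/-- The factor of the Laguerre density that depends on the corner entry. -/
def cornerWeight (α : ℂ) (ε : ℝ) : ℝ → ℂ :=
  (Set.Ioi 0).indicator fun a => (a : ℂ) ^ α * Complex.exp (-(1 / (ε : ℂ)) * a)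

/-- The factor of the Laguerre density that depends on the rest of the first row. -/
def rowWeight {n : ℕ} (ε a : ℝ) (z : Fin n → ℝ × ℝ) : ℝ :=
  ∏ j, Real.exp (-(1 / (a * ε)) * (z j).1 ^ 2) * Real.exp (-(1 / (a * ε)) * (z j).2 ^ 2)

/-- Factorization of the Laguerre density: `M` is positive if and only if the corner entry `a` and its
Schur complement are, the determinants multiply, and `tr M` exceeds the trace of the Schur complement
by `a + |z|² / a`. -/
lemma lueWeight_borderCoord {n : ℕ} (α : ℂ) (ε a : ℝ) (z : Fin n → ℝ × ℝ)
    (d : HermitianCoord n) :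
    lueWeight α ε (borderCoord ((a, z), d)) =
      cornerWeight α ε a * rowWeight ε a z * lueWeight α ε (d - schurShift (a, z)) := by
  have hmem := mem_positiveHermitian_borderCoord a z d
  by_cases ha : 0 < a
  swap
  · rw [lueWeight, Set.indicator_of_notMem (fun h => ha (hmem.1 h).1), cornerWeight,
      Set.indicator_of_notMem (by simpa using ha), zero_mul, zero_mul]
  by_cases hd : d - schurShift (a, z) ∈ positiveHermitian n
  swap
  · rw [lueWeight, Set.indicator_of_notMem (fun h => hd (hmem.1 h).2), lueWeight,
      Set.indicator_of_notMem hd, mul_zero]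
  rw [lueWeight, Set.indicator_of_mem (hmem.2 ⟨ha, hd⟩), lueWeight, Set.indicator_of_mem hd,
    cornerWeight, Set.indicator_of_mem (by simpa using ha), lueDensity, lueDensity,
    det_borderCoord a z d ha.ne', trace_borderCoord]
  have hdet := det_eq_ofReal (M := hermitianMatrix (d - schurShift (a, z))) hd
  rw [hdet.2, Complex.mul_cpow_ofReal_nonneg ha.le hdet.1.le, mul_add, mul_add, Complex.exp_add,
    Complex.exp_add]
  have hrow : Complex.exp (-(1 / (ε : ℂ)) * ((∑ j, ((z j).1 ^ 2 + (z j).2 ^ 2) / a : ℝ) : ℂ)) =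
      rowWeight ε a z := by
    have : (-(1 / (ε : ℂ)) * ((∑ j, ((z j).1 ^ 2 + (z j).2 ^ 2) / a : ℝ) : ℂ)) =
        ((-(1 / ε) * ∑ j, ((z j).1 ^ 2 + (z j).2 ^ 2) / a : ℝ) : ℂ) := by push_cast; ring
    rw [this, ← Complex.ofReal_exp, Finset.mul_sum, Real.exp_sum, rowWeight]
    congr 1
    refine Finset.prod_congr rfl fun j _ => ?_
    rw [← Real.exp_add]
    congr 1
    rw [one_div, one_div, mul_inv]
    ring
  rw [hrow]
  ring

lemma gaussian_prod_integral {b : ℝ} (hb : 0 < b) :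
    Integrable (fun p : ℝ × ℝ => Real.exp (-b * p.1 ^ 2) * Real.exp (-b * p.2 ^ 2)) ∧
      ∫ p : ℝ × ℝ, Real.exp (-b * p.1 ^ 2) * Real.exp (-b * p.2 ^ 2) = Real.pi / b := by
  refine ⟨(integrable_exp_neg_mul_sq hb).mul_prod (integrable_exp_neg_mul_sq hb), ?_⟩
  have := integral_prod_mul (μ := (volume : Measure ℝ)) (ν := (volume : Measure ℝ))
    (fun x : ℝ => Real.exp (-b * x ^ 2)) fun x : ℝ => Real.exp (-b * x ^ 2)
  rw [Measure.volume_eq_prod, this, integral_gaussian, Real.mul_self_sqrt (by positivity)]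

lemma rowWeight_integral (n : ℕ) {ε a : ℝ} (hε : 0 < ε) (ha : 0 < a) :
    Integrable (rowWeight (n := n) ε a) ∧
      ∫ z : Fin n → ℝ × ℝ, rowWeight ε a z = (Real.pi * a * ε) ^ n := by
  have hb : 0 < 1 / (a * ε) := by positivity
  obtain ⟨h1, h2⟩ := gaussian_prod_integral hb
  refine ⟨Integrable.fintype_prod (f := fun (_ : Fin n) (p : ℝ × ℝ) =>
    Real.exp (-(1 / (a * ε)) * p.1 ^ 2) * Real.exp (-(1 / (a * ε)) * p.2 ^ 2)) fun _ => h1, ?_⟩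
  have := integral_fintype_prod_volume_eq_pow (ι := Fin n) fun p : ℝ × ℝ =>
    Real.exp (-(1 / (a * ε)) * p.1 ^ 2) * Real.exp (-(1 / (a * ε)) * p.2 ^ 2)
  rw [show (∫ z : Fin n → ℝ × ℝ, rowWeight ε a z) = _ from this, h2, Fintype.card_fin]
  congr 1
  field_simp

lemma rowWeight_nonneg {n : ℕ} (ε a : ℝ) (z : Fin n → ℝ × ℝ) : 0 ≤ rowWeight ε a z :=
  Finset.prod_nonneg fun _ _ => by positivity

lemma integrableOn_cpow_mul_exp {s : ℂ} (hs : -1 < s.re) {ε : ℝ} (hε : 0 < ε) :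
    IntegrableOn (fun a : ℝ => (a : ℂ) ^ s * Complex.exp (-(1 / (ε : ℂ)) * a)) (Set.Ioi 0) := by
  have h := integrableOn_rpow_mul_exp_neg_mul_rpow (s := s.re) (p := 1) (b := 1 / ε) hs one_pos
    (by positivity)
  refine Integrable.mono' h ?_ ?_
  · refine Measurable.aestronglyMeasurable ?_
    exact (Complex.measurable_ofReal.pow_const s).mul (by fun_prop)
  · refine (ae_restrict_iff' measurableSet_Ioi).2 (Filter.Eventually.of_forall fun a ha => ?_)
    rw [norm_mul, Complex.norm_cpow_eq_rpow_re_of_pos ha, Complex.norm_exp, Real.rpow_one]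
    refine le_of_eq ?_
    congr 2
    have : (-(1 / (ε : ℂ)) * a) = ((-(1 / ε) * a : ℝ) : ℂ) := by push_cast; ring
    rw [this, Complex.ofReal_re]

lemma cornerWeight_mul_pow (α : ℂ) (ε : ℝ) (n : ℕ) (a : ℝ) :
    cornerWeight α ε a * (Real.pi * a * ε : ℝ) ^ n =
      (Real.pi * ε : ℂ) ^ n * cornerWeight (α + n) ε a := by
  by_cases ha : 0 < a
  · have ha' : (a : ℂ) ≠ 0 := by exact_mod_cast ha.ne'
    rw [cornerWeight, cornerWeight, Set.indicator_of_mem (by simpa using ha),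
      Set.indicator_of_mem (by simpa using ha), Complex.cpow_add _ _ ha', Complex.cpow_natCast]
    push_cast
    ring
  · rw [cornerWeight, cornerWeight, Set.indicator_of_notMem (by simpa using ha),
      Set.indicator_of_notMem (by simpa using ha)]
    simp

lemma integrable_cornerWeight {α : ℂ} (hα : -1 < α.re) {ε : ℝ} (hε : 0 < ε) :
    Integrable (cornerWeight α ε) :=
  (integrable_indicator_iff measurableSet_Ioi).2 (integrableOn_cpow_mul_exp hα hε)

lemma integral_cornerWeight {α : ℂ} (hα : -1 < α.re) {ε : ℝ} (hε : 0 < ε) :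
    ∫ a, cornerWeight α ε a = (ε : ℂ) ^ (α + 1) * Complex.Gamma (α + 1) := by
  rw [cornerWeight, integral_indicator measurableSet_Ioi]
  have := Complex.integral_cpow_mul_exp_neg_mul_Ioi (a := α + 1) (r := 1 / ε)
    (by simp; linarith) (by positivity)
  rw [Complex.ofReal_div, Complex.ofReal_one, one_div_one_div] at this
  rw [← this]
  refine setIntegral_congr_fun measurableSet_Ioi fun a _ => ?_
  simp only [add_sub_cancel_right, neg_mul]

lemma measurable_cornerWeight (α : ℂ) (ε : ℝ) : Measurable (cornerWeight α ε) := by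
  refine Measurable.indicator ?_ measurableSet_Ioi
  exact (Complex.measurable_ofReal.pow_const α).mul (by fun_prop)

lemma measurable_rowWeight (n : ℕ) (ε : ℝ) :
    Measurable fun p : ℝ × (Fin n → ℝ × ℝ) => rowWeight ε p.1 p.2 := by
  unfold rowWeight
  refine Finset.measurable_prod _ fun j _ => ?_
  fun_prop

/-- The integral over the first row. Each of the `n` Gaussian integrals over the off-diagonal entries
equals `π a ε`, where `a` is the corner entry, which shifts the exponent of `a` from `α` to `α + n`. -/
lemma firstRow_integral (n : ℕ) {α : ℂ} (hα : -1 < α.re) {ε : ℝ} (hε : 0 < ε) :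
    Integrable (fun p : ℝ × (Fin n → ℝ × ℝ) => cornerWeight α ε p.1 * (rowWeight ε p.1 p.2 : ℂ)) ∧
      ∫ p : ℝ × (Fin n → ℝ × ℝ), cornerWeight α ε p.1 * (rowWeight ε p.1 p.2 : ℂ) =
        (Real.pi * ε : ℂ) ^ n * ((ε : ℂ) ^ (α + n + 1) * Complex.Gamma (α + n + 1)) := by
  have hαn : -1 < (α + n).re := by simp; linarith [(Nat.cast_nonneg n : (0 : ℝ) ≤ n)]
  have hint : ∀ a, ∫ z : Fin n → ℝ × ℝ, cornerWeight α ε a * (rowWeight ε a z : ℂ) =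
      (Real.pi * ε : ℂ) ^ n * cornerWeight (α + n) ε a := by
    intro a
    rw [integral_const_mul, integral_complex_ofReal, ← cornerWeight_mul_pow]
    by_cases ha : 0 < a
    · rw [(rowWeight_integral n hε ha).2]
      push_cast
      rfl
    · rw [cornerWeight, Set.indicator_of_notMem (by simpa using ha), zero_mul, zero_mul]
  have hI : Integrable
      (fun p : ℝ × (Fin n → ℝ × ℝ) => cornerWeight α ε p.1 * (rowWeight ε p.1 p.2 : ℂ)) := by
    rw [Measure.volume_eq_prod, integrable_prod_iff]
    · constructor
      · refine Filter.Eventually.of_forall fun a => ?_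
        by_cases ha : 0 < a
        · exact ((rowWeight_integral n hε ha).1.ofReal (𝕜 := ℂ)).const_mul (cornerWeight α ε a)
        · simp [cornerWeight, ha]
      · refine ((integrable_cornerWeight hαn hε).norm.const_mul ((Real.pi * ε) ^ n)).congr ?_
        refine Filter.Eventually.of_forall fun a => ?_
        have h1 : ∀ z : Fin n → ℝ × ℝ, ‖cornerWeight α ε a * (rowWeight ε a z : ℂ)‖ =
            ‖cornerWeight α ε a‖ * rowWeight ε a z := fun z => by
          rw [norm_mul, Complex.norm_of_nonneg (rowWeight_nonneg ε a z)]
        simp only [h1]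
        rw [integral_const_mul]
        by_cases ha : 0 < a
        · rw [(rowWeight_integral n hε ha).2]
          have h2 := congrArg norm (cornerWeight_mul_pow α ε n a)
          rw [norm_mul, norm_mul, norm_pow, norm_pow, Complex.norm_of_nonneg (by positivity),
            ← Complex.ofReal_mul, Complex.norm_of_nonneg (by positivity)] at h2
          exact h2.symm
        · simp [cornerWeight, ha]
    · refine Measurable.aestronglyMeasurable ?_
      exact ((measurable_cornerWeight α ε).comp measurable_fst).mul
        (Complex.measurable_ofReal.comp (measurable_rowWeight n ε))
  refine ⟨hI, ?_⟩
  rw [Measure.volume_eq_prod] at hI ⊢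
  rw [integral_prod _ hI]
  simp only [hint]
  rw [integral_const_mul, integral_cornerWeight hαn hε]

lemma measurable_lueWeight (n : ℕ) (α : ℂ) (ε : ℝ) :
    Measurable (lueWeight α ε : HermitianCoord n → ℂ) :=
  (measurable_lueDensity α ε).indicator (measurableSet_positiveHermitian n)

/-- The normalization integral. In the step from `n` to `n + 1`, the density splits by a Schur
complement into a Gamma integral, `n` complex Gaussian integrals and the density in size `n`. -/
theorem lueWeight_integral (n : ℕ) {α : ℂ} (hα : -1 < α.re) {ε : ℝ} (hε : 0 < ε) :
    Integrable (lueWeight α ε : HermitianCoord n → ℂ) ∧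
      ∫ c : HermitianCoord n, lueWeight α ε c =
        (Real.pi : ℂ) ^ (n * (n - 1) / 2) * (ε : ℂ) ^ ((n : ℂ) ^ 2 + α * n) *
          ∏ j ∈ Finset.range n, Complex.Gamma (α + j + 1) := by
  induction n with
  | zero =>
    have hv : (volume : Measure (HermitianCoord 0)) = Measure.dirac default := by
      rw [Measure.volume_eq_prod, Measure.volume_pi_eq_dirac default,
        Measure.volume_pi_eq_dirac default, Measure.dirac_prod_dirac]
      rfl
    have hw : ∀ c : HermitianCoord 0, lueWeight α ε c = 1 := fun c => by
      have hc : c ∈ positiveHermitian 0 := by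
        change (hermitianMatrix c).PosDef
        exact PosDef.of_dotProduct_mulVec_pos (hermitianMatrix_isHermitian c)
          fun x hx => absurd (Subsingleton.elim x 0) hx
      rw [lueWeight, Set.indicator_of_mem hc, lueDensity]
      simp
    simp only [hw, hv]
    constructor
    · rw [show (lueWeight α ε : HermitianCoord 0 → ℂ) = fun _ => 1 from funext hw]
      exact integrable_const _
    · simp
  | succ n ih =>
    obtain ⟨ih1, ih2⟩ := ih
    obtain ⟨hr1, hr2⟩ := firstRow_integral n hα hε
    set g : (ℝ × (Fin n → ℝ × ℝ)) × HermitianCoord n → ℂ := fun p =>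
      cornerWeight α ε p.1.1 * (rowWeight ε p.1.1 p.1.2 : ℂ) * lueWeight α ε p.2 with hg
    have hgI : Integrable g := hr1.mul_prod ih1
    have hb := measurePreserving_borderCoord n
    have hs := measurePreserving_shear n
    have hcomp : lueWeight α ε ∘ borderCoord =
        g ∘ fun p : (ℝ × (Fin n → ℝ × ℝ)) × HermitianCoord n => (p.1, p.2 - schurShift p.1) :=
      funext fun p => lueWeight_borderCoord α ε p.1.1 p.1.2 p.2
    have hmeas := (measurable_lueWeight (n + 1) α ε).aestronglyMeasurable
      (μ := (volume : Measure (HermitianCoord (n + 1))))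
    constructor
    · rw [← hb.integrable_comp hmeas, hcomp, hs.integrable_comp hgI.aestronglyMeasurable]
      exact hgI
    · have e1 : ∫ c : HermitianCoord (n + 1), lueWeight α ε c = ∫ p, (lueWeight α ε ∘ borderCoord (n := n)) p := by
        conv_lhs => rw [← hb.map_eq]
        exact integral_map hb.measurable.aemeasurable (by rw [hb.map_eq]; exact hmeas)
      have e2 : ∫ p, g p = ∫ p : (ℝ × (Fin n → ℝ × ℝ)) × HermitianCoord n,
          g (p.1, p.2 - schurShift p.1) := by
        conv_lhs => rw [← hs.map_eq]
        exact integral_map hs.measurable.aemeasurable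
          (by rw [hs.map_eq]; exact hgI.aestronglyMeasurable)
      have e3 : ∫ p, g p = _ := integral_prod_mul (μ := volume) (ν := volume)
        (fun p : ℝ × (Fin n → ℝ × ℝ) => cornerWeight α ε p.1 * (rowWeight ε p.1 p.2 : ℂ))
        (lueWeight α ε)
      rw [e1, hcomp]
      change ∫ p : (ℝ × (Fin n → ℝ × ℝ)) × HermitianCoord n, g (p.1, p.2 - schurShift p.1) = _
      rw [← e2, e3, hr2, ih2, Finset.prod_range_succ]
      have hε' : (ε : ℂ) ≠ 0 := by exact_mod_cast hε.ne'
      have hexp : (ε : ℂ) ^ (((n + 1 : ℕ) : ℂ) ^ 2 + α * (n + 1 : ℕ)) =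
          (ε : ℂ) ^ n * (ε : ℂ) ^ (α + n + 1) * (ε : ℂ) ^ ((n : ℂ) ^ 2 + α * n) := by
        rw [← Complex.cpow_natCast (ε : ℂ) n, ← Complex.cpow_add _ _ hε', ← Complex.cpow_add _ _ hε']
        congr 1
        push_cast
        ring
      have hpi : (n + 1) * (n + 1 - 1) / 2 = n + n * (n - 1) / 2 := by
        rw [Nat.triangle_succ, add_comm]
      rw [hexp, hpi, pow_add, mul_pow]
      ring

end

section

open Matrix

/-! ### The action of matrices on Hermitian matrices by congruence -/

/-- The action `M ↦ A M Aᴴ` on Hermitian matrices, in coordinates. -/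
def congruence {n : ℕ} (A : Matrix (Fin n) (Fin n) ℂ) : HermitianCoord n →ₗ[ℝ] HermitianCoord n :=
  coordOf n ∘ₗ (LinearMap.mulRight ℝ Aᴴ ∘ₗ LinearMap.mulLeft ℝ A) ∘ₗ hermLin n

lemma hermitianMatrix_congruence {n : ℕ} (A : Matrix (Fin n) (Fin n) ℂ) (c : HermitianCoord n) :
    hermitianMatrix (congruence A c) = A * hermitianMatrix c * Aᴴ :=
  hermitianMatrix_coordOf (isHermitian_mul_mul_conjTranspose A (hermitianMatrix_isHermitian c))

lemma hermitianMatrix_injective (n : ℕ) :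
    Function.Injective (hermitianMatrix : HermitianCoord n → Matrix (Fin n) (Fin n) ℂ) :=
  Function.LeftInverse.injective coordOf_hermitianMatrix

lemma congruence_mul {n : ℕ} (A B : Matrix (Fin n) (Fin n) ℂ) :
    congruence (A * B) = congruence A ∘ₗ congruence B := by
  refine LinearMap.ext fun c => hermitianMatrix_injective n ?_
  rw [LinearMap.comp_apply]
  simp only [hermitianMatrix_congruence, conjTranspose_mul, Matrix.mul_assoc]

lemma congruence_one (n : ℕ) : congruence (1 : Matrix (Fin n) (Fin n) ℂ) = LinearMap.id := by
  refine LinearMap.ext fun c => hermitianMatrix_injective n ?_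
  simp [hermitianMatrix_congruence]

lemma det_congruence_mul {n : ℕ} (A B : Matrix (Fin n) (Fin n) ℂ) :
    LinearMap.det (congruence (A * B)) =
      LinearMap.det (congruence A) * LinearMap.det (congruence B) := by
  rw [congruence_mul, LinearMap.det_comp]

/-- Multiplication by a complex number, on pairs of real numbers. -/
def mulPair (a : ℂ) : ℝ × ℝ →ₗ[ℝ] ℝ × ℝ :=
  (Complex.equivRealProdLm : ℂ →ₗ[ℝ] ℝ × ℝ) ∘ₗ LinearMap.mul ℝ ℂ a ∘ₗ
    (Complex.equivRealProdLm.symm : ℝ × ℝ →ₗ[ℝ] ℂ)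

lemma det_mulPair (a : ℂ) : LinearMap.det (mulPair a) = ‖a‖ ^ 2 := by
  rw [mulPair, LinearMap.det_conj, ← Complex.normSq_eq_norm_sq, ← Algebra.norm_complex_apply,
    Algebra.norm_apply]
  rfl

/-- The power of `|det A|` in the Jacobian of `M ↦ A M Aᴴ` for a diagonal matrix `A`: each index
occurs in `2 n` factors. -/
lemma prod_lt_mul_self {n : ℕ} (r : Fin n → ℝ) :
    (∏ i, r i ^ 2) * ∏ q : UpperIndex n, (r q.1.1 * r q.1.2) ^ 2 = (∏ i, r i) ^ (2 * n) := by
  set g : Fin n × Fin n → ℝ := fun x => if x.1 < x.2 then r x.1 * r x.2 else 1 with hg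
  have h1 : ∏ q : UpperIndex n, (r q.1.1 * r q.1.2) = ∏ x, g x := by
    rw [hg, ← Finset.prod_filter]
    exact (Finset.prod_subtype (Finset.univ.filter fun x : Fin n × Fin n => x.1 < x.2)
      (by simp) fun x => r x.1 * r x.2).symm
  have h2 : ∏ x, g x = ∏ x : Fin n × Fin n, g x.swap :=
    (Equiv.prod_comp (Equiv.prodComm (Fin n) (Fin n)) g).symm
  have h3 : ∏ i, r i ^ 2 = ∏ x : Fin n × Fin n, if x.1 = x.2 then r x.1 * r x.2 else 1 := by
    rw [Fintype.prod_prod_type]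
    refine Finset.prod_congr rfl fun i _ => ?_
    rw [Finset.prod_ite_eq]
    simp [sq]
  have h4 : (∏ i, r i) ^ (2 * n) = ∏ x : Fin n × Fin n, r x.1 * r x.2 := by
    rw [Fintype.prod_prod_type]
    simp only [Finset.prod_mul_distrib, Finset.prod_const, Finset.card_univ, Fintype.card_fin]
    rw [Finset.prod_pow]
    ring
  rw [Finset.prod_pow _ 2 fun q : UpperIndex n => r q.1.1 * r q.1.2, h1, sq (∏ x, g x), h3]
  nth_rewrite 2 [h2]
  rw [h4, ← Finset.prod_mul_distrib, ← Finset.prod_mul_distrib]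
  refine Finset.prod_congr rfl fun x _ => ?_
  simp only [hg, Prod.fst_swap, Prod.snd_swap]
  rcases lt_trichotomy x.1 x.2 with h | h | h
  · simp [h, h.ne, h.not_gt]
  · simp [h]
  · simp [h, h.ne', h.not_gt, mul_comm]

lemma det_congruence_diagonal {n : ℕ} (a : Fin n → ℂ) :
    LinearMap.det (congruence (diagonal a)) = ‖(diagonal a).det‖ ^ (2 * n) := by
  have h : congruence (diagonal a) = LinearMap.prodMap
      (LinearMap.pi fun i => (LinearMap.lsmul ℝ ℝ (‖a i‖ ^ 2)).comp (LinearMap.proj i))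
      (LinearMap.pi fun q : UpperIndex n => (mulPair (a q.1.1 * star (a q.1.2))).comp
        (LinearMap.proj q)) := by
    refine LinearMap.ext fun c => ?_
    have hM : ∀ i j, (diagonal a * hermitianMatrix c * (diagonal a)ᴴ) i j =
        a i * star (a j) * hermitianMatrix c i j := fun i j => by
      rw [diagonal_conjTranspose, mul_diagonal, diagonal_mul]
      simp only [Pi.star_apply]
      ring
    refine Prod.ext (funext fun i => ?_) (funext fun q => ?_)
    · change ((diagonal a * hermitianMatrix c * (diagonal a)ᴴ) i i).re = ‖a i‖ ^ 2 * c.1 i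
      rw [hM, hermitianMatrix_diag, Complex.star_def, Complex.mul_conj', ← Complex.ofReal_pow,
        ← Complex.ofReal_mul, Complex.ofReal_re]
    · change (((diagonal a * hermitianMatrix c * (diagonal a)ᴴ) q.1.1 q.1.2).re,
        ((diagonal a * hermitianMatrix c * (diagonal a)ᴴ) q.1.1 q.1.2).im) =
          mulPair (a q.1.1 * star (a q.1.2)) (c.2 q)
      rw [hM, hermitianMatrix_of_lt _ q.2]
      rfl
  rw [h, LinearMap.det_prodMap, LinearMap.det_pi, LinearMap.det_pi, det_diagonal, norm_prod,
    ← prod_lt_mul_self]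
  congr 1
  · refine Finset.prod_congr rfl fun i _ => ?_
    simp [LinearMap.det_ring]
  · refine Finset.prod_congr rfl fun q _ => ?_
    rw [det_mulPair, norm_mul, norm_star]

/-- Transvections act on Hermitian matrices with determinant one, because conjugation by a diagonal
matrix turns a transvection into its square. -/
lemma det_congruence_transvection {n : ℕ} {p q : Fin n} (h : q ≠ p) (z : ℂ) :
    LinearMap.det (congruence (transvection q p z)) = 1 := by
  -- `D` has the entry `2` at `q`, so that it conjugates the transvection by `z` into that by `2 z`
  set D : Matrix (Fin n) (Fin n) ℂ := diagonal fun k => if k = q then 2 else 1 with hD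
  have hconj : D * transvection q p z = transvection q p (2 * z) * D := by
    ext i j
    rw [hD, diagonal_mul, mul_diagonal, transvection, transvection, Matrix.add_apply, Matrix.add_apply,
      one_apply, single_apply, single_apply]
    rcases eq_or_ne i q with rfl | hi
    · rcases eq_or_ne i j with rfl | hj
      · rw [if_pos rfl, if_pos rfl, if_neg fun hp => h hp.2.symm, if_neg fun hp => h hp.2.symm]
        ring
      · simp only [hj, hj.symm, true_and, if_true, if_false]
        split_ifs <;> ring
    · rcases eq_or_ne i j with rfl | hj
      · simp [hi, Ne.symm hi]
      · simp [hj, Ne.symm hi]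
  have hDdet : LinearMap.det (congruence D) ≠ 0 := by
    rw [det_congruence_diagonal, det_diagonal]
    refine pow_ne_zero _ (norm_ne_zero_iff.mpr (Finset.prod_ne_zero_iff.mpr fun k _ => ?_))
    split_ifs <;> norm_num
  have h1 := congrArg (fun A => LinearMap.det (congruence A)) hconj
  have h2 := congrArg (fun A => LinearMap.det (congruence A))
    (transvection_mul_transvection_same q p h z z)
  have h3 := congrArg (fun A => LinearMap.det (congruence A))
    (transvection_mul_transvection_same q p h z (-z))
  simp only [det_congruence_mul] at h1 h2 h3
  rw [add_neg_cancel, transvection_zero, congruence_one, LinearMap.det_id] at h3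
  rw [mul_comm (LinearMap.det (congruence (transvection q p (2 * z)))), two_mul] at h1
  have h4 := mul_left_cancel₀ hDdet h1
  rw [← h2] at h4
  exact (mul_eq_left₀ (left_ne_zero_of_mul_eq_one h3)).mp h4.symm

lemma one_add_single_self {n : ℕ} (q : Fin n) (z : ℂ) : (1 + single q q z : Matrix _ _ ℂ) =
    diagonal fun k => if k = q then 1 + z else 1 := by
  ext i j
  rw [Matrix.add_apply, one_apply, single_apply, diagonal_apply]
  rcases eq_or_ne i j with rfl | hij
  · rcases eq_or_ne i q with rfl | hi
    · simp
    · simp [hi, Ne.symm hi]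
  · rw [if_neg hij, if_neg hij, if_neg fun h => hij (h.1.symm.trans h.2), add_zero]

/-- The Jacobian of the congruence action of an elementary matrix. -/
lemma det_congruence_one_add_single {n : ℕ} (p q : Fin n) (z : ℂ) :
    LinearMap.det (congruence (1 + single q p z)) = ‖(1 + single q p z).det‖ ^ (2 * n) := by
  by_cases h : q = p
  · subst h
    rw [one_add_single_self, det_congruence_diagonal]
  · have h1 := det_congruence_transvection h z
    have h2 := det_transvection_of_ne q p h z
    rw [transvection] at h1 h2
    rw [h1, h2, norm_one, one_pow]

lemma det_one_add_single {n : ℕ} (p q : Fin n) (z : ℂ) :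
    (1 + single q p z : Matrix (Fin n) (Fin n) ℂ).det = 1 + if p = q then z else 0 := by
  by_cases h : q = p
  · subst h
    rw [one_add_single_self, det_diagonal]
    simp
  · have h2 := det_transvection_of_ne q p h z
    rw [transvection] at h2
    rw [h2, if_neg (Ne.symm h), add_zero]

/-- The change of variables `M ↦ A M Aᴴ` in an integral against the Laguerre density: the density
`(det M) ^ α` and the Jacobian contribute the power `α + n` of `|det A| ^ 2`. -/
lemma integral_congruence {n : ℕ} (α : ℂ) (ε : ℝ) {A : Matrix (Fin n) (Fin n) ℂ}
    (hA : A.det ≠ 0) (hJ : LinearMap.det (congruence A) = ‖A.det‖ ^ (2 * n))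
    {f : HermitianCoord n → ℂ} (hf : Measurable f) :
    ((‖A.det‖ ^ 2 : ℝ) : ℂ) ^ (α + n) * ∫ c, f (congruence A c) * lueWeight α ε c *
      Complex.exp (-(1 / (ε : ℂ)) * ((hermitianMatrix (congruence A c)).trace -
        (hermitianMatrix c).trace)) = ∫ c, f c * lueWeight α ε c := by
  have hpos : 0 < ‖A.det‖ := norm_pos_iff.mpr hA
  have hw : ∀ c, lueWeight α ε (congruence A c) = ((‖A.det‖ ^ 2 : ℝ) : ℂ) ^ α * (lueWeight α ε c *
      Complex.exp (-(1 / (ε : ℂ)) * ((hermitianMatrix (congruence A c)).trace -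
        (hermitianMatrix c).trace))) := by
    intro c
    have hmem : congruence A c ∈ positiveHermitian n ↔ c ∈ positiveHermitian n := by
      change (hermitianMatrix (congruence A c)).PosDef ↔ (hermitianMatrix c).PosDef
      rw [hermitianMatrix_congruence]
      exact IsUnit.posDef_star_right_conjugate_iff
        ((isUnit_iff_isUnit_det A).mpr (isUnit_iff_ne_zero.mpr hA))
    by_cases hc : c ∈ positiveHermitian n
    · rw [lueWeight, Set.indicator_of_mem (hmem.2 hc), Set.indicator_of_mem hc, lueDensity,
        lueDensity]
      have hdet : (hermitianMatrix (congruence A c)).det =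
          ((‖A.det‖ ^ 2 : ℝ) : ℂ) * (hermitianMatrix c).det := by
        rw [hermitianMatrix_congruence, det_mul, det_mul, det_conjTranspose, Complex.ofReal_pow,
          ← Complex.mul_conj', Complex.star_def]
        ring
      obtain ⟨h1, h2⟩ := det_eq_ofReal (M := hermitianMatrix c) hc
      rw [hdet, h2, Complex.mul_cpow_ofReal_nonneg (by positivity) h1.le, mul_assoc, mul_assoc,
        ← Complex.exp_add]
      congr 4
      ring
    · rw [lueWeight, Set.indicator_of_notMem (fun h => hc (hmem.1 h)),
        Set.indicator_of_notMem hc, zero_mul, mul_zero]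
  have hJ0 : LinearMap.det (congruence A) ≠ 0 := by rw [hJ]; positivity
  have hmap := Measure.map_linearMap_addHaar_eq_smul_addHaar
    (volume : Measure (HermitianCoord n)) hJ0
  have hLm : Measurable (congruence A) := (congruence A).continuous_of_finiteDimensional.measurable
  have h1 : ∫ c, f (congruence A c) * lueWeight α ε (congruence A c) =
      ((‖A.det‖ ^ (2 * n))⁻¹ : ℝ) * ∫ c, f c * lueWeight α ε c := by
    have hm : Measurable fun c => f c * lueWeight α ε c := hf.mul (measurable_lueWeight n α ε)
    rw [← integral_map (f := fun c => f c * lueWeight α ε c) hLm.aemeasurable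
      hm.aestronglyMeasurable, hmap, integral_smul_measure, hJ,
      ENNReal.toReal_ofReal (abs_nonneg _), abs_of_nonneg (by positivity), Complex.real_smul]
  have h2 : ∫ c, f (congruence A c) * lueWeight α ε (congruence A c) =
      ((‖A.det‖ ^ 2 : ℝ) : ℂ) ^ α * ∫ c, f (congruence A c) * lueWeight α ε c *
      Complex.exp (-(1 / (ε : ℂ)) * ((hermitianMatrix (congruence A c)).trace -
        (hermitianMatrix c).trace)) := by
    rw [← integral_const_mul]
    refine integral_congr_ae (Filter.Eventually.of_forall fun c => ?_)
    simp only [hw c]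
    ring
  have hne : ((‖A.det‖ ^ 2 : ℝ) : ℂ) ≠ 0 := by
    have : (‖A.det‖ ^ 2 : ℝ) ≠ 0 := by positivity
    exact_mod_cast this
  rw [Complex.cpow_add _ _ hne, Complex.cpow_natCast, mul_comm (_ ^ α), mul_assoc, ← h2, h1]
  have hne' : ((‖A.det‖ : ℝ) : ℂ) ≠ 0 := by exact_mod_cast hpos.ne'
  push_cast
  rw [← pow_mul, mul_inv_cancel_left₀ (pow_ne_zero _ hne')]

end

section

open Matrix Topology

/-! ### Moments of the Laguerre ensemble -/

lemma lueWeight_eq_zero {n : ℕ} (α : ℂ) (ε : ℝ) {c : HermitianCoord n}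
    (hc : c ∉ positiveHermitian n) : lueWeight α ε c = 0 := Set.indicator_of_notMem hc _

lemma continuous_entry {n : ℕ} (i j : Fin n) :
    Continuous fun c : HermitianCoord n => hermitianMatrix c i j :=
  (continuous_hermitianMatrix n).matrix_elem i j

lemma continuous_traceRe (n : ℕ) :
    Continuous fun c : HermitianCoord n => (hermitianMatrix c).trace.re :=
  Complex.continuous_re.comp (continuous_hermitianMatrix n).matrix_trace

/-- The Laguerre density at `ε` beats polynomials and `exp (tr M / (2 ε))`, by comparison with the
density at `4 ε`. -/
lemma integrable_trace_pow_mul_exp (n : ℕ) {α : ℂ} (hα : -1 < α.re) {ε : ℝ} (hε : 0 < ε) (d : ℕ) :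
    Integrable fun c : HermitianCoord n => (hermitianMatrix c).trace.re ^ d *
      Real.exp ((hermitianMatrix c).trace.re / (2 * ε)) * ‖lueWeight α ε c‖ := by
  have h4 : 0 < 4 * ε := by positivity
  refine Integrable.mono' (((lueWeight_integral n hα h4).1.norm).const_mul
    ((d.factorial : ℝ) * (4 * ε) ^ d)) ?_ (Filter.Eventually.of_forall fun c => ?_)
  · refine Measurable.aestronglyMeasurable ?_
    have h1 := (continuous_traceRe n).measurable
    have h2 := measurable_lueWeight n α ε
    fun_prop
  · by_cases hc : c ∈ positiveHermitian n
    swap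
    · rw [lueWeight_eq_zero _ _ hc, lueWeight_eq_zero _ _ hc]
      simp
    have hτ := (trace_eq_ofReal (M := hermitianMatrix c) (PosDef.posSemidef hc)).1
    have hdet := (det_eq_ofReal (M := hermitianMatrix c) hc).1
    rw [lueWeight, Set.indicator_of_mem hc, lueWeight, Set.indicator_of_mem hc,
      norm_lueDensity α ε hc, norm_lueDensity α (4 * ε) hc, Real.norm_of_nonneg (by positivity)]
    set τ := (hermitianMatrix c).trace.re
    set D := (hermitianMatrix c).det.re ^ α.re
    have hpow : τ ^ d ≤ (d.factorial : ℝ) * (4 * ε) ^ d * Real.exp (τ / (4 * ε)) := by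
      have := Real.pow_div_factorial_le_exp (τ / (4 * ε)) (by positivity) d
      rw [div_pow, div_div, div_le_iff₀ (by positivity)] at this
      linarith
    have hexp : Real.exp (τ / (4 * ε)) * Real.exp (τ / (2 * ε)) * Real.exp (-(1 / ε) * τ) =
        Real.exp (-(1 / (4 * ε)) * τ) := by
      rw [← Real.exp_add, ← Real.exp_add]
      congr 1
      field_simp
      ring
    calc τ ^ d * Real.exp (τ / (2 * ε)) * (D * Real.exp (-(1 / ε) * τ))
        ≤ (d.factorial : ℝ) * (4 * ε) ^ d * Real.exp (τ / (4 * ε)) * Real.exp (τ / (2 * ε)) *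
          (D * Real.exp (-(1 / ε) * τ)) := by gcongr
      _ = (d.factorial : ℝ) * (4 * ε) ^ d * (D * (Real.exp (τ / (4 * ε)) * Real.exp (τ / (2 * ε)) *
          Real.exp (-(1 / ε) * τ))) := by ring
      _ = _ := by rw [hexp]

/-- Differentiation under the integral sign of a product of quadratic polynomials and the
exponential of a quadratic polynomial, all of whose coefficients are controlled by `τ`. -/
lemma hasDerivAt_integral_prod_mul_exp {Ω : Type*} [MeasurableSpace Ω] {μ : Measure Ω} {d : ℕ}
    {ε : ℝ} (hε : 0 < ε) {τ : Ω → ℝ} {a b g : Fin d → Ω → ℂ} {u v w : Ω → ℂ}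
    (ha : ∀ e, Measurable (a e)) (hb : ∀ e, Measurable (b e)) (hg : ∀ e, Measurable (g e))
    (hu : Measurable u) (hv : Measurable v) (hw : Measurable w)
    (hint : ∀ k, Integrable (fun x => τ x ^ k * Real.exp (τ x / (2 * ε)) * ‖w x‖) μ)
    (hbound : ∀ x, w x = 0 ∨ (0 ≤ τ x ∧ (∀ e, ‖a e x‖ ≤ 2 * τ x ∧ ‖b e x‖ ≤ 2 * τ x ∧
      ‖g e x‖ ≤ 2 * τ x) ∧ ‖u x‖ ≤ 2 * τ x ∧ ‖v x‖ ≤ 2 * τ x)) :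
    HasDerivAt (fun t : ℝ => ∫ x, (∏ e, (a e x + t * b e x + t ^ 2 * g e x)) * w x *
        Complex.exp (-(1 / (ε : ℂ)) * (t * u x + t ^ 2 * v x)) ∂μ)
      (∫ x, (∑ e, (∏ e' ∈ Finset.univ.erase e, a e' x) * b e x) * w x -
        (1 / (ε : ℂ)) * (u x * (∏ e, a e x) * w x) ∂μ) 0 := by
  set m : ℝ → Fin d → Ω → ℂ := fun t e x => a e x + t * b e x + t ^ 2 * g e x with hm
  set m' : ℝ → Fin d → Ω → ℂ := fun t e x => b e x + 2 * t * g e x with hm'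
  set E : ℝ → Ω → ℂ := fun t x => Complex.exp (-(1 / (ε : ℂ)) * (t * u x + t ^ 2 * v x)) with hE
  set F : ℝ → Ω → ℂ := fun t x => (∏ e, m t e x) * w x * E t x with hF
  set F' : ℝ → Ω → ℂ := fun t x =>
    (∑ e, (∏ e' ∈ Finset.univ.erase e, m t e' x) * m' t e x) * w x * E t x +
      (∏ e, m t e x) * w x * (E t x * (-(1 / (ε : ℂ)) * (u x + 2 * t * v x))) with hF'
  have hmm : ∀ t e, Measurable (m t e) := fun t e => by
    have := ha e; have := hb e; have := hg e
    fun_prop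
  have hmm' : ∀ t e, Measurable (m' t e) := fun t e => by
    have := hb e; have := hg e
    fun_prop
  have hEm : ∀ t, Measurable (E t) := fun t => by fun_prop
  have hFm : ∀ t, Measurable (F t) := fun t =>
    ((Finset.measurable_prod _ fun e _ => hmm t e).mul hw).mul (hEm t)
  have hFm' : Measurable (F' 0) := by
    refine Measurable.add (((Finset.measurable_sum _ fun e _ =>
      (Finset.measurable_prod _ fun e' _ => hmm 0 e').mul (hmm' 0 e)).mul hw).mul (hEm 0)) ?_
    refine ((Finset.measurable_prod _ fun e _ => hmm 0 e).mul hw).mul ((hEm 0).mul ?_)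
    fun_prop
  have hderm : ∀ t e x, HasDerivAt (fun t => m t e x) (m' t e x) t := fun t e x => by
    have h1 : HasDerivAt (fun t : ℝ => (t : ℂ)) 1 t := Complex.ofRealCLM.hasDerivAt
    have := ((h1.mul_const (b e x)).const_add (a e x)).add ((h1.pow 2).mul_const (g e x))
    refine this.congr_deriv ?_
    simp only [hm']
    push_cast
    ring
  have hderE : ∀ t x, HasDerivAt (fun t => E t x)
      (E t x * (-(1 / (ε : ℂ)) * (u x + 2 * t * v x))) t := fun t x => by
    have h1 : HasDerivAt (fun t : ℝ => (t : ℂ)) 1 t := Complex.ofRealCLM.hasDerivAt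
    have h2 : HasDerivAt (fun t : ℝ => -(1 / (ε : ℂ)) * (t * u x + t ^ 2 * v x))
        (-(1 / (ε : ℂ)) * (u x + 2 * t * v x)) t :=
      (((h1.mul_const (u x)).add ((h1.pow 2).mul_const (v x))).const_mul _).congr_deriv
        (by push_cast; ring)
    exact h2.cexp
  have hder : ∀ t x, HasDerivAt (fun t => F t x) (F' t x) t := fun t x => by
    have h1 : HasDerivAt (fun t => ∏ e, m t e x)
        (∑ e, (∏ e' ∈ Finset.univ.erase e, m t e' x) * m' t e x) t :=
      HasDerivAt.fun_finsetProd fun e _ => hderm t e x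
    exact (h1.mul_const (w x)).mul (hderE t x)
  -- for `|t| ≤ 1 / 16`, the exponent is at most `τ / (2 ε)`, which the density can absorb
  have hest : ∀ x, w x ≠ 0 → ∀ t : ℝ, |t| ≤ 1 / 16 →
      (∀ e, ‖m t e x‖ ≤ 4 * τ x ∧ ‖m' t e x‖ ≤ 4 * τ x) ∧
      ‖E t x‖ ≤ Real.exp (τ x / (2 * ε)) ∧ ‖u x + 2 * t * v x‖ ≤ 4 * τ x := by
    intro x hx t ht
    obtain ⟨hτ, h1, h2, h3⟩ := (hbound x).resolve_left hx
    have ht0 := abs_nonneg t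
    have ht2 : |t| ^ 2 ≤ 1 / 16 := by nlinarith
    have nt : ‖(t : ℂ)‖ = |t| := by rw [Complex.norm_real, Real.norm_eq_abs]
    have lin : ∀ {y z : ℂ}, ‖y‖ ≤ 2 * τ x → ‖z‖ ≤ 2 * τ x → ‖y + 2 * t * z‖ ≤ 4 * τ x := by
      intro y z hy hz
      refine (norm_add_le _ _).trans ?_
      rw [norm_mul, norm_mul, nt, Complex.norm_ofNat]
      nlinarith [norm_nonneg z]
    have quad : ∀ {y z : ℂ}, ‖y‖ ≤ 2 * τ x → ‖z‖ ≤ 2 * τ x →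
        ‖t * y + t ^ 2 * z‖ ≤ τ x / 2 := by
      intro y z hy hz
      refine (norm_add_le _ _).trans ?_
      rw [norm_mul, norm_mul, norm_pow, nt]
      have e1 := mul_le_mul ht hy (norm_nonneg y) (by norm_num)
      have e2 := mul_le_mul ht2 hz (norm_nonneg z) (by norm_num)
      linarith
    refine ⟨fun e => ⟨?_, lin (h1 e).2.1 (h1 e).2.2⟩, ?_, lin h2 h3⟩
    · have := quad (h1 e).2.1 (h1 e).2.2
      simp only [hm]
      rw [add_assoc]
      exact (norm_add_le _ _).trans (by linarith [(h1 e).1])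
    · refine (Complex.norm_exp_le_exp_norm _).trans (Real.exp_le_exp.mpr ?_)
      have e1 : ‖(-(1 / (ε : ℂ)))‖ = 1 / ε := by
        rw [norm_neg, norm_div, norm_one, Complex.norm_of_nonneg hε.le]
      rw [norm_mul, e1]
      have := mul_le_mul_of_nonneg_left (quad h2 h3) (by positivity : 0 ≤ 1 / ε)
      refine this.trans (le_of_eq ?_)
      field_simp
  set bd : Ω → ℝ := fun x => (d * (4 * τ x) ^ d + (4 * τ x) ^ d * (1 / ε * (4 * τ x))) *
    Real.exp (τ x / (2 * ε)) * ‖w x‖ with hbd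
  have hbdI : Integrable bd μ := by
    have h1 := ((hint d).const_mul (d * 4 ^ d)).add ((hint (d + 1)).const_mul (4 ^ (d + 1) / ε))
    refine h1.congr (Filter.Eventually.of_forall fun x => ?_)
    simp only [hbd, Pi.add_apply]
    ring
  have hprod : ∀ x, w x ≠ 0 → ∀ t : ℝ, |t| ≤ 1 / 16 → ‖∏ e, m t e x‖ ≤ (4 * τ x) ^ d := by
    intro x hx t ht
    rw [norm_prod]
    refine (Finset.prod_le_prod (fun e _ => norm_nonneg _)
      fun e _ => ((hest x hx t ht).1 e).1).trans (le_of_eq ?_)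
    simp
  have hle : ∀ x, ∀ t : ℝ, |t| ≤ 1 / 16 → ‖F' t x‖ ≤ bd x := by
    intro x t ht
    by_cases hx : w x = 0
    · simp [hF', hbd, hx]
    obtain ⟨h1, h2, h3⟩ := hest x hx t ht
    have hτ := ((hbound x).resolve_left hx).1
    have s1 : ‖∑ e, (∏ e' ∈ Finset.univ.erase e, m t e' x) * m' t e x‖ ≤ d * (4 * τ x) ^ d := by
      refine (norm_sum_le _ _).trans ?_
      refine (Finset.sum_le_card_nsmul _ _ ((4 * τ x) ^ d) fun e _ => ?_).trans
        (le_of_eq (by simp))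
      rw [norm_mul, norm_prod]
      calc (∏ e' ∈ Finset.univ.erase e, ‖m t e' x‖) * ‖m' t e x‖
          ≤ (∏ e' ∈ Finset.univ.erase e, 4 * τ x) * (4 * τ x) :=
            mul_le_mul (Finset.prod_le_prod (fun _ _ => norm_nonneg _) fun e' _ => (h1 e').1)
              (h1 e).2 (norm_nonneg _) (Finset.prod_nonneg fun _ _ => by positivity)
        _ = (4 * τ x) ^ d := by
            rw [Finset.prod_erase_mul _ _ (Finset.mem_univ e)]
            simp
    have s2 : ‖-(1 / (ε : ℂ)) * (u x + 2 * t * v x)‖ ≤ 1 / ε * (4 * τ x) := by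
      rw [norm_mul, norm_neg, norm_div, norm_one, Complex.norm_of_nonneg hε.le]
      exact mul_le_mul_of_nonneg_left h3 (by positivity)
    refine (norm_add_le _ _).trans ?_
    rw [norm_mul, norm_mul, norm_mul, norm_mul, norm_mul]
    have s3 := hprod x hx t ht
    calc _ ≤ d * (4 * τ x) ^ d * ‖w x‖ * Real.exp (τ x / (2 * ε)) +
          (4 * τ x) ^ d * ‖w x‖ * (Real.exp (τ x / (2 * ε)) * (1 / ε * (4 * τ x))) := by gcongr
      _ = bd x := by simp only [hbd]; ring
  have hF0 : Integrable (F 0) μ := by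
    refine Integrable.mono' ((hint d).const_mul (4 ^ d)) (hFm 0).aestronglyMeasurable
      (Filter.Eventually.of_forall fun x => ?_)
    by_cases hx : w x = 0
    · simp [hF, hx]
    have s1 := hprod x hx 0 (by norm_num)
    have s2 := (hest x hx 0 (by norm_num)).2.1
    simp only [hF]
    rw [norm_mul, norm_mul]
    calc _ ≤ (4 * τ x) ^ d * ‖w x‖ * Real.exp (τ x / (2 * ε)) := by
          have := ((hbound x).resolve_left hx).1
          gcongr
      _ = _ := by ring
  have key := (hasDerivAt_integral_of_dominated_loc_of_deriv_le (μ := μ) (F := F) (F' := F')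
    (bound := bd) (Metric.closedBall_mem_nhds (0 : ℝ) (by norm_num : (0 : ℝ) < 1 / 16))
    (Filter.Eventually.of_forall fun t => (hFm t).aestronglyMeasurable) hF0
    hFm'.aestronglyMeasurable
    (Filter.Eventually.of_forall fun x t ht => hle x t (by
      simpa [Real.norm_eq_abs] using mem_closedBall_zero_iff.mp ht)) hbdI
    (Filter.Eventually.of_forall fun x t _ => hder t x)).2
  refine key.congr_deriv (integral_congr_ae (Filter.Eventually.of_forall fun x => ?_))
  simp [hF', hm, hm', hE]
  ring

/-- The integral of a product of matrix entries against the Laguerre density. -/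
def lueMoment {n d : ℕ} (α : ℂ) (ε : ℝ) (i j : Fin d → Fin n) : ℂ :=
  ∫ c : HermitianCoord n, (∏ e, hermitianMatrix c (i e) (j e)) * lueWeight α ε c

lemma integrable_prod_entries {n d : ℕ} {α : ℂ} (hα : -1 < α.re) {ε : ℝ} (hε : 0 < ε)
    (i j : Fin d → Fin n) : Integrable fun c : HermitianCoord n =>
      (∏ e, hermitianMatrix c (i e) (j e)) * lueWeight α ε c := by
  refine Integrable.mono' (integrable_trace_pow_mul_exp n hα hε d) ?_
    (Filter.Eventually.of_forall fun c => ?_)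
  · exact ((Finset.measurable_prod _ fun e _ => (continuous_entry _ _).measurable).mul
      (measurable_lueWeight n α ε)).aestronglyMeasurable
  · by_cases hc : c ∈ positiveHermitian n
    swap
    · simp [lueWeight_eq_zero _ _ hc]
    have hpsd : (hermitianMatrix c).PosSemidef := PosDef.posSemidef hc
    have hτ := (trace_eq_ofReal hpsd).1
    rw [norm_mul, norm_prod]
    refine mul_le_mul_of_nonneg_right ?_ (norm_nonneg _)
    calc _ ≤ ∏ _e : Fin d, (hermitianMatrix c).trace.re :=
          Finset.prod_le_prod (fun _ _ => norm_nonneg _) fun e _ => norm_entry_le_trace hpsd _ _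
      _ = (hermitianMatrix c).trace.re ^ d := by simp
      _ ≤ _ := le_mul_of_one_le_right (by positivity) (Real.one_le_exp (by positivity))

end

section

open Matrix Topology

/-! ### The Schwinger–Dyson equation of the Laguerre ensemble -/

lemma one_add_single_mul_apply {n : ℕ} (p q : Fin n) (z : ℂ) (M : Matrix (Fin n) (Fin n) ℂ)
    (i j : Fin n) :
    ((1 + single q p z) * M) i j = M i j + if i = q then z * M p j else 0 := by
  rw [Matrix.add_mul, Matrix.one_mul, Matrix.add_apply]
  congr 1
  split_ifs with h
  · rw [h, single_mul_apply_same]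
  · rw [single_mul_apply_of_ne _ _ _ _ _ h]

lemma mul_one_add_single_conjTranspose_apply {n : ℕ} (p q : Fin n) (z : ℂ)
    (M : Matrix (Fin n) (Fin n) ℂ) (i j : Fin n) :
    (M * (1 + single q p z : Matrix (Fin n) (Fin n) ℂ)ᴴ) i j = M i j + if j = q then star z * M i p else 0 := by
  have h := one_add_single_mul_apply p q z Mᴴ j i
  rw [← conjTranspose_conjTranspose M, ← conjTranspose_mul, conjTranspose_apply, h, star_add,
    conjTranspose_conjTranspose, conjTranspose_apply, star_star]
  split_ifs
  · rw [star_mul', conjTranspose_apply, star_star]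
  · rw [star_zero]

/-- The first order term of the congruence action of `1 + t z E_{qp}`. -/
def congruenceFirst {n : ℕ} (p q : Fin n) (z : ℂ) (M : Matrix (Fin n) (Fin n) ℂ) (i j : Fin n) : ℂ :=
  (if i = q then z * M p j else 0) + if j = q then star z * M i p else 0

/-- The second order term of the congruence action of `1 + t z E_{qp}`. -/
def congruenceSecond {n : ℕ} (p q : Fin n) (z : ℂ) (M : Matrix (Fin n) (Fin n) ℂ) (i j : Fin n) :
    ℂ :=
  if i = q then if j = q then z * star z * M p p else 0 else 0

section Expansion

variable {n : ℕ} (p q : Fin n) (z : ℂ) (t : ℝ) (M : Matrix (Fin n) (Fin n) ℂ)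

lemma congruence_expansion (i j : Fin n) :
    ((1 + single q p (t * z)) * M * (1 + single q p (t * z) : Matrix (Fin n) (Fin n) ℂ)ᴴ) i j =
      M i j + t * congruenceFirst p q z M i j + t ^ 2 * congruenceSecond p q z M i j := by
  have hs : star ((t : ℂ) * z) = t * star z := by
    rw [star_mul', Complex.star_def, Complex.conj_ofReal]
  rw [mul_one_add_single_conjTranspose_apply, one_add_single_mul_apply, one_add_single_mul_apply,
    congruenceFirst, congruenceSecond, hs]
  split_ifs <;> ring

lemma sum_congruenceFirst : ∑ i, congruenceFirst p q z M i i = z * M p q + star z * M q p := by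
  simp only [congruenceFirst, Finset.sum_add_distrib, Finset.sum_ite_eq', Finset.mem_univ, if_true]

lemma sum_congruenceSecond : ∑ i, congruenceSecond p q z M i i = z * star z * M p p := by
  simp [congruenceSecond]

lemma trace_congruence_expansion :
    ((1 + single q p (t * z)) * M * (1 + single q p (t * z) : Matrix (Fin n) (Fin n) ℂ)ᴴ).trace - M.trace =
      t * (z * M p q + star z * M q p) + t ^ 2 * (z * star z * M p p) := by
  rw [← sum_congruenceFirst, ← sum_congruenceSecond, Finset.mul_sum, Finset.mul_sum, Matrix.trace,
    Matrix.trace, ← Finset.sum_sub_distrib, ← Finset.sum_add_distrib]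
  refine Finset.sum_congr rfl fun i _ => ?_
  rw [diag_apply, diag_apply, congruence_expansion]
  ring

variable {z M}

lemma norm_add_mul_entries_le (hz : ‖z‖ = 1) (hM : M.PosSemidef) (i j k l : Fin n) :
    ‖z * M i j + star z * M k l‖ ≤ 2 * M.trace.re := by
  refine (norm_add_le _ _).trans ?_
  rw [norm_mul, norm_mul, norm_star, hz]
  linarith [norm_entry_le_trace hM i j, norm_entry_le_trace hM k l]

lemma norm_congruenceFirst_le (hz : ‖z‖ = 1) (hM : M.PosSemidef) (i j : Fin n) :
    ‖congruenceFirst p q z M i j‖ ≤ 2 * M.trace.re := by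
  have h0 := (trace_eq_ofReal hM).1
  have h1 := norm_entry_le_trace hM p j
  have h2 := norm_entry_le_trace hM i p
  refine (norm_add_le _ _).trans ?_
  split_ifs <;> simp only [norm_mul, norm_star, hz, norm_zero] <;> linarith

lemma norm_mul_diag_le (hz : ‖z‖ = 1) (hM : M.PosSemidef) :
    ‖z * star z * M p p‖ ≤ 2 * M.trace.re := by
  have h0 := (trace_eq_ofReal hM).1
  have h1 := norm_entry_le_trace hM p p
  simp only [norm_mul, norm_star, hz]
  linarith

lemma norm_congruenceSecond_le (hz : ‖z‖ = 1) (hM : M.PosSemidef) (i j : Fin n) :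
    ‖congruenceSecond p q z M i j‖ ≤ 2 * M.trace.re := by
  have h0 := (trace_eq_ofReal hM).1
  have h1 := norm_mul_diag_le p hz hM
  rw [congruenceSecond]
  split_ifs
  · exact h1
  all_goals rw [norm_zero]; linarith

end Expansion

lemma hasDerivAt_norm_sq_cpow (ζ s : ℂ) :
    HasDerivAt (fun t : ℝ => ((‖1 + t * ζ‖ ^ 2 : ℝ) : ℂ) ^ s) (s * (ζ + star ζ)) 0 := by
  have h1 : ∀ t : ℝ, ((‖1 + t * ζ‖ ^ 2 : ℝ) : ℂ) = (1 + t * ζ) * (1 + t * star ζ) := fun t => by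
    rw [Complex.ofReal_pow, ← Complex.mul_conj', map_add, map_mul, map_one, Complex.conj_ofReal,
      Complex.star_def]
  simp only [h1]
  have hl : ∀ w : ℂ, HasDerivAt (fun t : ℂ => 1 + t * w) w 0 := fun w => by
    simpa using ((hasDerivAt_id (0 : ℂ)).mul_const w).const_add 1
  have h2 : HasDerivAt (fun t : ℂ => ((1 + t * ζ) * (1 + t * star ζ)) ^ s)
      (s * (ζ + star ζ)) ((0 : ℝ) : ℂ) := by
    rw [Complex.ofReal_zero]
    refine (((hl ζ).mul (hl (star ζ))).cpow_const (c := s) ?_).congr_deriv ?_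
    · simp
    · simp
  exact h2.comp_ofReal

lemma prod_update_entries {n d : ℕ} (M : Matrix (Fin n) (Fin n) ℂ) (i j : Fin d → Fin n)
    (p : Fin n) (e : Fin d) :
    (∏ e' ∈ Finset.univ.erase e, M (i e') (j e')) * M p (j e) =
      ∏ e', M (Function.update i e p e') (j e') := by
  rw [← Finset.prod_erase_mul _ _ (Finset.mem_univ e), Function.update_self]
  congr 1
  refine Finset.prod_congr rfl fun e' he' => ?_
  rw [Function.update_of_ne (Finset.ne_of_mem_erase he')]

lemma prod_cons_entries {n d : ℕ} (M : Matrix (Fin n) (Fin n) ℂ) (i j : Fin d → Fin n)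
    (p q : Fin n) :
    ∏ e, M ((Fin.cons p i : Fin (d + 1) → Fin n) e) ((Fin.cons q j : Fin (d + 1) → Fin n) e) =
      M p q * ∏ e, M (i e) (j e) := by
  rw [Fin.prod_univ_succ]
  simp only [Fin.cons_zero, Fin.cons_succ]

/-- The variation of the integrand under a change of the row indices, in terms of integrands of
moments: an entry in row `q` moves to row `p`, and the exponential contributes a new entry. -/
lemma rowDerivative_eq {n d : ℕ} (α : ℂ) (ε : ℝ) (p q : Fin n) (i j : Fin d → Fin n)
    (c : HermitianCoord n) :
    ((∑ e, if i e = q then (∏ e' ∈ Finset.univ.erase e, hermitianMatrix c (i e') (j e')) *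
        hermitianMatrix c p (j e) else 0) -
      (1 / (ε : ℂ)) * (hermitianMatrix c p q * ∏ e, hermitianMatrix c (i e) (j e))) *
        lueWeight α ε c =
    (∑ e, if i e = q then (∏ e', hermitianMatrix c (Function.update i e p e') (j e')) *
        lueWeight α ε c else 0) -
      (1 / (ε : ℂ)) * ((∏ e, hermitianMatrix c ((Fin.cons p i : Fin (d + 1) → Fin n) e)
        ((Fin.cons q j : Fin (d + 1) → Fin n) e)) * lueWeight α ε c) := by
  rw [prod_cons_entries, sub_mul, Finset.sum_mul, mul_assoc (1 / (ε : ℂ))]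
  simp only [ite_mul, zero_mul, prod_update_entries]

/-- The analogue of `rowDerivative_eq` for the column indices. -/
lemma columnDerivative_eq {n d : ℕ} (α : ℂ) (ε : ℝ) (p q : Fin n) (i j : Fin d → Fin n)
    (c : HermitianCoord n) :
    ((∑ e, if j e = q then (∏ e' ∈ Finset.univ.erase e, hermitianMatrix c (i e') (j e')) *
        hermitianMatrix c (i e) p else 0) -
      (1 / (ε : ℂ)) * (hermitianMatrix c q p * ∏ e, hermitianMatrix c (i e) (j e))) *
        lueWeight α ε c =
    (∑ e, if j e = q then (∏ e', hermitianMatrix c (i e') (Function.update j e p e')) *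
        lueWeight α ε c else 0) -
      (1 / (ε : ℂ)) * ((∏ e, hermitianMatrix c ((Fin.cons q i : Fin (d + 1) → Fin n) e)
        ((Fin.cons p j : Fin (d + 1) → Fin n) e)) * lueWeight α ε c) := by
  have h : ∀ e, (∏ e' ∈ Finset.univ.erase e, hermitianMatrix c (i e') (j e')) *
      hermitianMatrix c (i e) p =
        ∏ e', hermitianMatrix c (i e') (Function.update j e p e') := fun e =>
    prod_update_entries (hermitianMatrix c)ᵀ j i p e
  rw [prod_cons_entries, sub_mul, Finset.sum_mul, mul_assoc (1 / (ε : ℂ))]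
  simp only [ite_mul, zero_mul, h]

lemma integrable_ite {Ω : Type*} [MeasurableSpace Ω] {μ : Measure Ω} (P : Prop) [Decidable P]
    {f : Ω → ℂ} (hf : Integrable f μ) : Integrable (fun x => if P then f x else 0) μ := by
  split_ifs
  · exact hf
  · exact integrable_zero _ _ _

lemma integrable_rowDerivative {n d : ℕ} {α : ℂ} (hα : -1 < α.re) {ε : ℝ} (hε : 0 < ε)
    (p q : Fin n) (i j : Fin d → Fin n) : Integrable fun c : HermitianCoord n =>
    ((∑ e, if i e = q then (∏ e' ∈ Finset.univ.erase e, hermitianMatrix c (i e') (j e')) *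
        hermitianMatrix c p (j e) else 0) -
      (1 / (ε : ℂ)) * (hermitianMatrix c p q * ∏ e, hermitianMatrix c (i e) (j e))) *
        lueWeight α ε c := by
  simp only [rowDerivative_eq]
  exact (integrable_finsetSum _ fun e _ => integrable_ite _ (integrable_prod_entries hα hε _ _)).sub
    ((integrable_prod_entries hα hε _ _).const_mul _)

lemma integrable_columnDerivative {n d : ℕ} {α : ℂ} (hα : -1 < α.re) {ε : ℝ} (hε : 0 < ε)
    (p q : Fin n) (i j : Fin d → Fin n) : Integrable fun c : HermitianCoord n =>
    ((∑ e, if j e = q then (∏ e' ∈ Finset.univ.erase e, hermitianMatrix c (i e') (j e')) *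
        hermitianMatrix c (i e) p else 0) -
      (1 / (ε : ℂ)) * (hermitianMatrix c q p * ∏ e, hermitianMatrix c (i e) (j e))) *
        lueWeight α ε c := by
  simp only [columnDerivative_eq]
  exact (integrable_finsetSum _ fun e _ => integrable_ite _ (integrable_prod_entries hα hε _ _)).sub
    ((integrable_prod_entries hα hε _ _).const_mul _)

lemma integral_rowDerivative {n d : ℕ} {α : ℂ} (hα : -1 < α.re) {ε : ℝ} (hε : 0 < ε)
    (p q : Fin n) (i j : Fin d → Fin n) : ∫ c : HermitianCoord n,
    ((∑ e, if i e = q then (∏ e' ∈ Finset.univ.erase e, hermitianMatrix c (i e') (j e')) *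
        hermitianMatrix c p (j e) else 0) -
      (1 / (ε : ℂ)) * (hermitianMatrix c p q * ∏ e, hermitianMatrix c (i e) (j e))) *
        lueWeight α ε c =
    (∑ e, if i e = q then lueMoment α ε (Function.update i e p) j else 0) -
      (1 / (ε : ℂ)) * lueMoment α ε (Fin.cons p i : Fin (d + 1) → Fin n)
        (Fin.cons q j : Fin (d + 1) → Fin n) := by
  have h1 : ∀ e, Integrable fun c : HermitianCoord n => if i e = q then
      (∏ e', hermitianMatrix c (Function.update i e p e') (j e')) * lueWeight α ε c else 0 :=
    fun e => integrable_ite _ (integrable_prod_entries hα hε _ _)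
  simp only [rowDerivative_eq]
  rw [integral_sub (integrable_finsetSum _ fun e _ => h1 e)
    ((integrable_prod_entries hα hε _ _).const_mul _), integral_const_mul,
    integral_finsetSum _ fun e _ => h1 e]
  congr 1
  refine Finset.sum_congr rfl fun e _ => ?_
  split_ifs
  · rfl
  · exact integral_zero _ _

/-- Invariance of the integral under `M ↦ A M Aᴴ` for `A = 1 + t z E_{qp}`, differentiated at
`t = 0`. The terms linear in `z` and in its conjugate are kept apart. -/
lemma derivative_identity {n d : ℕ} {α : ℂ} (hα : -1 < α.re) {ε : ℝ} (hε : 0 < ε) (p q : Fin n)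
    (i j : Fin d → Fin n) {z : ℂ} (hz : ‖z‖ = 1) :
    z * (∫ c : HermitianCoord n, ((∑ e, if i e = q then (∏ e' ∈ Finset.univ.erase e,
        hermitianMatrix c (i e') (j e')) * hermitianMatrix c p (j e) else 0) -
        (1 / (ε : ℂ)) * (hermitianMatrix c p q * ∏ e, hermitianMatrix c (i e) (j e))) *
          lueWeight α ε c) +
      star z * (∫ c : HermitianCoord n, ((∑ e, if j e = q then (∏ e' ∈ Finset.univ.erase e,
        hermitianMatrix c (i e') (j e')) * hermitianMatrix c (i e) p else 0) -
        (1 / (ε : ℂ)) * (hermitianMatrix c q p * ∏ e, hermitianMatrix c (i e) (j e))) *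
          lueWeight α ε c) +
      (α + n) * ((if p = q then z else 0) + star (if p = q then z else 0)) * lueMoment α ε i j =
        0 := by
  have hent : ∀ k l, Measurable fun c : HermitianCoord n => hermitianMatrix c k l :=
    fun k l => (continuous_entry k l).measurable
  have hder := hasDerivAt_integral_prod_mul_exp (μ := (volume : Measure (HermitianCoord n))) hε
    (τ := fun c => (hermitianMatrix c).trace.re) (a := fun e c => hermitianMatrix c (i e) (j e))
    (b := fun e c => congruenceFirst p q z (hermitianMatrix c) (i e) (j e))
    (g := fun e c => congruenceSecond p q z (hermitianMatrix c) (i e) (j e))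
    (u := fun c => z * hermitianMatrix c p q + star z * hermitianMatrix c q p)
    (v := fun c => z * star z * hermitianMatrix c p p) (w := lueWeight α ε)
    (fun e => hent _ _)
    (fun e => by
      unfold congruenceFirst
      refine Measurable.add ?_ ?_ <;> split_ifs
      exacts [(hent _ _).const_mul _, measurable_const, (hent _ _).const_mul _, measurable_const])
    (fun e => by
      unfold congruenceSecond
      split_ifs
      exacts [(hent _ _).const_mul _, measurable_const, measurable_const])
    (((hent _ _).const_mul _).add ((hent _ _).const_mul _)) ((hent _ _).const_mul _)
    (measurable_lueWeight n α ε) (fun k => integrable_trace_pow_mul_exp n hα hε k)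
    (fun c => by
      by_cases hc : c ∈ positiveHermitian n
      · have hM : (hermitianMatrix c).PosSemidef := PosDef.posSemidef hc
        have hτ := (trace_eq_ofReal hM).1
        refine Or.inr ⟨hτ, fun e => ⟨?_, norm_congruenceFirst_le p q hz hM _ _,
          norm_congruenceSecond_le p q hz hM _ _⟩, norm_add_mul_entries_le hz hM _ _ _ _,
          norm_mul_diag_le p hz hM⟩
        linarith [norm_entry_le_trace hM (i e) (j e)]
      · exact Or.inl (lueWeight_eq_zero _ _ hc))
  set ζ : ℂ := if p = q then z else 0 with hζ
  have hζn : ‖ζ‖ ≤ 1 := by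
    rw [hζ]
    split_ifs
    · exact hz.le
    · simp
  have hconst : ∀ᶠ t : ℝ in 𝓝 0, ((‖1 + t * ζ‖ ^ 2 : ℝ) : ℂ) ^ (α + n) *
      (∫ c : HermitianCoord n, (∏ e, (hermitianMatrix c (i e) (j e) +
        t * congruenceFirst p q z (hermitianMatrix c) (i e) (j e) +
        t ^ 2 * congruenceSecond p q z (hermitianMatrix c) (i e) (j e))) * lueWeight α ε c *
        Complex.exp (-(1 / (ε : ℂ)) * (t * (z * hermitianMatrix c p q +
          star z * hermitianMatrix c q p) + t ^ 2 * (z * star z * hermitianMatrix c p p)))) =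
      lueMoment α ε i j := by
    filter_upwards [Metric.ball_mem_nhds (0 : ℝ) one_pos] with t ht
    have ht1 : |t| < 1 := by simpa [Real.norm_eq_abs] using mem_ball_zero_iff.mp ht
    have hdet : (1 + single q p (t * z) : Matrix (Fin n) (Fin n) ℂ).det = 1 + t * ζ := by
      rw [det_one_add_single, hζ, mul_ite, mul_zero]
    have hne : (1 + single q p (t * z) : Matrix (Fin n) (Fin n) ℂ).det ≠ 0 := by
      rw [hdet]
      intro h0
      have h1 : ‖(t : ℂ) * ζ‖ = 1 := by
        rw [eq_neg_of_add_eq_zero_right h0, norm_neg, norm_one]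
      rw [norm_mul, Complex.norm_real, Real.norm_eq_abs] at h1
      nlinarith [abs_nonneg t, norm_nonneg ζ]
    have := integral_congruence α ε hne (det_congruence_one_add_single p q (t * z))
      (f := fun c => ∏ e, hermitianMatrix c (i e) (j e))
      (Finset.measurable_prod _ fun e _ => hent _ _)
    rw [hdet] at this
    refine Eq.trans ?_ this
    simp only [hermitianMatrix_congruence, congruence_expansion, trace_congruence_expansion]
  have hφ := hasDerivAt_norm_sq_cpow ζ (α + n)
  have hprod := (hφ.mul hder).unique ((hasDerivAt_const (0 : ℝ) _).congr_of_eventuallyEq hconst)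
  have hsplit : ∀ c : HermitianCoord n,
      (∑ e, (∏ e' ∈ Finset.univ.erase e, hermitianMatrix c (i e') (j e')) *
        congruenceFirst p q z (hermitianMatrix c) (i e) (j e)) * lueWeight α ε c -
      (1 / (ε : ℂ)) * ((z * hermitianMatrix c p q + star z * hermitianMatrix c q p) *
        (∏ e, hermitianMatrix c (i e) (j e)) * lueWeight α ε c) =
      z * (((∑ e, if i e = q then (∏ e' ∈ Finset.univ.erase e,
        hermitianMatrix c (i e') (j e')) * hermitianMatrix c p (j e) else 0) -
        (1 / (ε : ℂ)) * (hermitianMatrix c p q * ∏ e, hermitianMatrix c (i e) (j e))) *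
          lueWeight α ε c) +
      star z * (((∑ e, if j e = q then (∏ e' ∈ Finset.univ.erase e,
        hermitianMatrix c (i e') (j e')) * hermitianMatrix c (i e) p else 0) -
        (1 / (ε : ℂ)) * (hermitianMatrix c q p * ∏ e, hermitianMatrix c (i e) (j e))) *
          lueWeight α ε c) := by
    intro c
    have hs : ∑ e, (∏ e' ∈ Finset.univ.erase e, hermitianMatrix c (i e') (j e')) *
        congruenceFirst p q z (hermitianMatrix c) (i e) (j e) =
      z * (∑ e, if i e = q then (∏ e' ∈ Finset.univ.erase e,
        hermitianMatrix c (i e') (j e')) * hermitianMatrix c p (j e) else 0) +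
      star z * ∑ e, if j e = q then (∏ e' ∈ Finset.univ.erase e,
        hermitianMatrix c (i e') (j e')) * hermitianMatrix c (i e) p else 0 := by
      rw [Finset.mul_sum, Finset.mul_sum, ← Finset.sum_add_distrib]
      refine Finset.sum_congr rfl fun e _ => ?_
      rw [congruenceFirst]
      split_ifs <;> ring
    rw [hs]
    ring
  simp only [hsplit] at hprod
  rw [integral_add ((integrable_rowDerivative hα hε p q i j).const_mul _)
    ((integrable_columnDerivative hα hε p q i j).const_mul _), integral_const_mul,
    integral_const_mul] at hprod
  have h0 : (∫ c : HermitianCoord n, (∏ e, (hermitianMatrix c (i e) (j e) +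
        ((0 : ℝ) : ℂ) * congruenceFirst p q z (hermitianMatrix c) (i e) (j e) +
        ((0 : ℝ) : ℂ) ^ 2 * congruenceSecond p q z (hermitianMatrix c) (i e) (j e))) *
          lueWeight α ε c *
        Complex.exp (-(1 / (ε : ℂ)) * (((0 : ℝ) : ℂ) * (z * hermitianMatrix c p q +
          star z * hermitianMatrix c q p) +
          ((0 : ℝ) : ℂ) ^ 2 * (z * star z * hermitianMatrix c p p)))) = lueMoment α ε i j := by
    simp [lueMoment]
  rw [h0, Complex.ofReal_zero, zero_mul, add_zero, norm_one, one_pow, Complex.ofReal_one,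
    Complex.one_cpow, one_mul] at hprod
  exact (add_comm _ _).trans hprod

/-- The Schwinger–Dyson equation: a moment of `d + 1` entries in terms of moments of `d` entries. -/
lemma lueMoment_cons {n d : ℕ} {α : ℂ} (hα : -1 < α.re) {ε : ℝ} (hε : 0 < ε) (p q : Fin n)
    (i j : Fin d → Fin n) :
    lueMoment α ε (Fin.cons p i : Fin (d + 1) → Fin n) (Fin.cons q j : Fin (d + 1) → Fin n) =
      ε * ((if p = q then (α + n) * lueMoment α ε i j else 0) +
        ∑ e, if i e = q then lueMoment α ε (Function.update i e p) j else 0) := by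
  have h1 := derivative_identity hα hε p q i j (z := 1) (by simp)
  have h2 := derivative_identity hα hε p q i j (z := Complex.I) (by simp)
  have h3 := integral_rowDerivative hα hε p q i j
  set P : ℂ := ∫ c : HermitianCoord n, ((∑ e, if i e = q then (∏ e' ∈ Finset.univ.erase e,
        hermitianMatrix c (i e') (j e')) * hermitianMatrix c p (j e) else 0) -
        (1 / (ε : ℂ)) * (hermitianMatrix c p q * ∏ e, hermitianMatrix c (i e) (j e))) *
          lueWeight α ε c
  set Q : ℂ := ∫ c : HermitianCoord n, ((∑ e, if j e = q then (∏ e' ∈ Finset.univ.erase e,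
        hermitianMatrix c (i e') (j e')) * hermitianMatrix c (i e) p else 0) -
        (1 / (ε : ℂ)) * (hermitianMatrix c q p * ∏ e, hermitianMatrix c (i e) (j e))) *
          lueWeight α ε c
  -- the identities for `z = 1` and `z = I` determine the term linear in `z`
  have hPe : P = -(if p = q then (α + n) * lueMoment α ε i j else 0) := by
    simp only [star_one, Complex.star_def, Complex.conj_I] at h1 h2
    split_ifs at h1 h2 ⊢ with h
    · simp only [map_one, Complex.conj_I] at h1 h2
      linear_combination (1 / 2 : ℂ) * h1 - (Complex.I / 2) * h2 +
        ((1 / 2 : ℂ) * (P - Q)) * Complex.I_mul_I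
    · simp only [map_zero] at h1 h2
      linear_combination (1 / 2 : ℂ) * h1 - (Complex.I / 2) * h2 +
        ((1 / 2 : ℂ) * (P - Q)) * Complex.I_mul_I
  have hε' : (ε : ℂ) ≠ 0 := by exact_mod_cast hε.ne'
  rw [hPe] at h3
  field_simp at h3
  linear_combination h3

/-- Moments of the Laguerre ensemble as sums over permutations. By `lueMoment_cons`, both sides satisfy
the same recursion in `d`: the first point of a permutation is a fixed point, which adds a cycle, or
it is inserted before another point of the permutation of the remaining points. -/
theorem lueMoment_eq {n d : ℕ} {α : ℂ} (hα : -1 < α.re) {ε : ℝ} (hε : 0 < ε)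
    (i j : Fin d → Fin n) :
    lueMoment α ε i j = ε ^ d * (∑ w : Equiv.Perm (Fin d),
      if ∀ e, i (w e) = j e then ((n : ℂ) + α) ^ cyc w else 0) *
        ∫ c : HermitianCoord n, lueWeight α ε c := by
  induction d with
  | zero =>
    simp [lueMoment, cyc_of_isEmpty]
  | succ d ih =>
    have hcons : lueMoment α ε i j = lueMoment α ε (Fin.cons (i 0) (Fin.tail i) : Fin (d + 1) → _)
        (Fin.cons (j 0) (Fin.tail j) : Fin (d + 1) → _) := by
      rw [Fin.cons_self_tail, Fin.cons_self_tail]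
    rw [hcons, lueMoment_cons hα hε]
    simp only [ih]
    rw [← Equiv.sum_comp Equiv.Perm.decomposeFin.symm, Fintype.sum_prod_type, Fin.sum_univ_succ]
    have h0 : (∑ τ : Equiv.Perm (Fin d), if ∀ e, i (insertZero 0 τ e) = j e then
        ((n : ℂ) + α) ^ cyc (insertZero 0 τ) else 0) = if i 0 = j 0 then (α + n) *
          ∑ τ : Equiv.Perm (Fin d), (if ∀ e, Fin.tail i (τ e) = Fin.tail j e then
            ((n : ℂ) + α) ^ cyc τ else 0) else 0 := by
      simp only [Fin.forall_fin_succ, insertZero_zero, insertZero_fixed, cyc_insertZero_zero]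
      split_ifs with h
      · rw [Finset.mul_sum]
        refine Finset.sum_congr rfl fun τ _ => ?_
        by_cases hτ : ∀ e, Fin.tail i (τ e) = Fin.tail j e
        · rw [if_pos ⟨h, hτ⟩, if_pos hτ]
          ring
        · rw [if_neg fun hh => hτ hh.2, if_neg hτ, mul_zero]
      · simp [h]
    have hs : ∀ p : Fin d, (∑ τ : Equiv.Perm (Fin d), if ∀ e, i (insertZero p.succ τ e) = j e then
        ((n : ℂ) + α) ^ cyc (insertZero p.succ τ) else 0) = if Fin.tail i p = j 0 then
          ∑ τ : Equiv.Perm (Fin d), (if ∀ e, Function.update (Fin.tail i) p (i 0) (τ e) =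
            Fin.tail j e then ((n : ℂ) + α) ^ cyc τ else 0) else 0 := by
      intro p
      have hu : ∀ (τ : Equiv.Perm (Fin d)) e, i (if τ e = p then 0 else (τ e).succ) =
          Function.update (Fin.tail i) p (i 0) (τ e) := fun τ e => by
        rw [Function.update_apply]
        split_ifs <;> rfl
      simp only [Fin.forall_fin_succ, insertZero_zero, insertZero_succ, cyc_insertZero_succ, hu]
      by_cases h : Fin.tail i p = j 0
      · have h' : i p.succ = j 0 := h
        simp only [h, h', true_and, if_true]
        rfl
      · have h' : ¬ i p.succ = j 0 := h
        simp [h, h']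
    rw [h0, Finset.sum_congr rfl fun p _ => hs p, pow_succ]
    have e1 : ∀ (c : Prop) [Decidable c] (x y : ℂ), (if c then x * y else 0) =
        (if c then x else 0) * y := fun c _ x y => by rw [ite_mul, zero_mul]
    have e2 : ∀ (c : Prop) [Decidable c] (x y : ℂ), (if c then x * y else 0) =
        x * (if c then y else 0) := fun c _ x y => by rw [mul_ite, mul_zero]
    simp only [mul_assoc, mul_left_comm _ ((ε : ℂ) ^ d), e2 _ ((ε : ℂ) ^ d), ← Finset.mul_sum]
    simp only [← mul_assoc, e1 _ _ (∫ c : HermitianCoord n, lueWeight α ε c), ← Finset.sum_mul]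
    ring

end

/-! ### The coefficients of the LUE partition function -/

/-- The free index functions `i` that satisfy the constraints of `w` are those constant on the cycles of
`σ * w⁻¹`, so that each of these cycles contributes a factor `n`. -/
lemma sum_perm_index {n d : ℕ} (s : ℂ) (σ : Equiv.Perm (Fin d)) :
    ∑ i : Fin d → Fin n, (∑ w : Equiv.Perm (Fin d), if ∀ e, i (w e) = i (σ e) then s ^ cyc w else 0)
      = ∑ w : Equiv.Perm (Fin d), s ^ cyc w * (n : ℂ) ^ cyc (σ * w⁻¹) := by
  rw [Finset.sum_comm]
  refine Finset.sum_congr rfl fun w _ => ?_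
  rw [← Finset.sum_filter, Finset.sum_const, nsmul_eq_mul, mul_comm]
  congr 1
  have h : ∀ i : Fin d → Fin n,
      (∀ e, i (w e) = i (σ e)) ↔ ∀ x, i ((σ * w⁻¹) x) = i x := fun i => by
    constructor
    · intro h x
      have := h (w⁻¹ x)
      rw [← Equiv.Perm.mul_apply, mul_inv_cancel, Equiv.Perm.one_apply] at this
      exact this.symm
    · intro h e
      have := h (w e)
      rw [← Equiv.Perm.mul_apply, mul_assoc, inv_mul_cancel, mul_one] at this
      exact this.symm
  rw [← Nat.cast_pow, ← card_invariantFun, Nat.card_eq_fintype_card, Fintype.card_subtype]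
  simp only [h]

lemma integrable_traceProd {n d : ℕ} {α : ℂ} (hα : -1 < α.re) {ε : ℝ} (hε : 0 < ε)
    (σ : Equiv.Perm (Fin d)) : Integrable fun c : HermitianCoord n =>
      traceProd (hermitianMatrix c) σ * lueWeight α ε c := by
  simp only [traceProd_eq, Finset.sum_mul]
  exact integrable_finsetSum _ fun i _ => integrable_prod_entries hα hε i fun e => i (σ e)

/-- The expectation of a product of traces: each pair of permutations with product `σ` contributes
`n` for each cycle of the first and `n + α` for each cycle of the second. -/
lemma integral_traceProd {n d : ℕ} {α : ℂ} (hα : -1 < α.re) {ε : ℝ} (hε : 0 < ε)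
    (σ : Equiv.Perm (Fin d)) :
    ∫ c : HermitianCoord n, traceProd (hermitianMatrix c) σ * lueWeight α ε c =
      ε ^ d * (∑ w : Equiv.Perm (Fin d), ((n : ℂ) + α) ^ cyc w * (n : ℂ) ^ cyc (σ * w⁻¹)) *
        ∫ c : HermitianCoord n, lueWeight α ε c := by
  simp only [traceProd_eq, Finset.sum_mul]
  rw [integral_finsetSum _ fun i _ => integrable_prod_entries hα hε i fun e => i (σ e)]
  have h : ∀ i : Fin d → Fin n, ∫ c : HermitianCoord n,
      (∏ e, hermitianMatrix c (i e) (i (σ e))) * lueWeight α ε c = _ := fun i =>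
    lueMoment_eq hα hε i fun e => i (σ e)
  simp only [h]
  rw [← Finset.sum_mul, ← Finset.mul_sum, sum_perm_index]

lemma constantCoeff_linearSeries {R : Type*} [CommRing R] (a : ℕ+ → R) :
    MvPowerSeries.constantCoeff (linearSeries a) = 0 := by
  rw [← MvPowerSeries.coeff_zero_eq_constantCoeff_apply]
  exact Finset.sum_empty (f := fun j : ℕ+ => if (0 : ℕ+ →₀ ℕ) = Finsupp.single j 1 then a j else 0)

lemma C_mul_linearSeries {R : Type*} [CommRing R] (r : R) (a : ℕ+ → R) :
    MvPowerSeries.C r * linearSeries a = linearSeries fun j => r * a j := by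
  refine MvPowerSeries.ext fun e => ?_
  rw [MvPowerSeries.coeff_C_mul]
  change r * ∑ j ∈ e.support, _ = ∑ j ∈ e.support, _
  rw [Finset.mul_sum]
  refine Finset.sum_congr rfl fun j _ => ?_
  rw [mul_ite, mul_zero]

lemma lueIntegrand_eq {n : ℕ} (α : ℂ) (ε : ℝ) (c : HermitianCoord n) :
    lueIntegrand α ε (hermitianMatrix c) = MvPowerSeries.C (lueDensity α ε c) *
      formalExp (linearSeries fun j =>
        (1 / (ε : ℂ)) * ((hermitianMatrix c ^ (j : ℕ)).trace / (j : ℂ))) := by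
  have h0 : MvPowerSeries.constantCoeff (MvPowerSeries.C (-(1 / (ε : ℂ))) *
      traceV (hermitianMatrix c)) = -(1 / (ε : ℂ)) * (hermitianMatrix c).trace := by
    rw [traceV, map_mul, map_sub, constantCoeff_linearSeries, MvPowerSeries.constantCoeff_C,
      MvPowerSeries.constantCoeff_C, sub_zero]
  rw [lueIntegrand, complexFormalExp, h0, ← mul_assoc, ← map_mul, ← C_mul_linearSeries]
  congr 2
  rw [traceV, map_mul, map_neg]
  ring

lemma coeff_lueIntegrand {n : ℕ} (α : ℂ) (ε : ℝ) (e : ℕ+ →₀ ℕ) (c : HermitianCoord n) :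
    MvPowerSeries.coeff e (lueIntegrand α ε (hermitianMatrix c)) =
      (((wt e).factorial : ℚ)⁻¹) • ∑ σ : Equiv.Perm (Fin (wt e)), if cycExp σ = e then
        (1 / (ε : ℂ)) ^ e.degree * (traceProd (hermitianMatrix c) σ * lueDensity α ε c) else 0 := by
  rw [lueIntegrand_eq, MvPowerSeries.coeff_C_mul, coeff_formalExp_trace, mul_smul_comm,
    Finset.mul_sum]
  congr 1
  refine Finset.sum_congr rfl fun σ _ => ?_
  split_ifs
  · ring
  · ring

/-- The integrand of a coefficient, extended by zero. -/
lemma indicator_coeff_lueIntegrand {n : ℕ} (α : ℂ) (ε : ℝ) (e : ℕ+ →₀ ℕ) :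
    (positiveHermitian n).indicator
      (fun c => MvPowerSeries.coeff e (lueIntegrand α ε (hermitianMatrix c))) = fun c =>
      (((wt e).factorial : ℚ)⁻¹) • ∑ σ : Equiv.Perm (Fin (wt e)), if cycExp σ = e then
        (1 / (ε : ℂ)) ^ e.degree * (traceProd (hermitianMatrix c) σ * lueWeight α ε c) else 0 := by
  funext c
  by_cases hc : c ∈ positiveHermitian n
  · rw [Set.indicator_of_mem hc, coeff_lueIntegrand, lueWeight, Set.indicator_of_mem hc]
  · rw [Set.indicator_of_notMem hc, lueWeight_eq_zero _ _ hc]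
    simp

lemma integrable_term {n : ℕ} {α : ℂ} (hα : -1 < α.re) {ε : ℝ} (hε : 0 < ε) (e : ℕ+ →₀ ℕ)
    (σ : Equiv.Perm (Fin (wt e))) : Integrable fun c : HermitianCoord n => if cycExp σ = e then
      (1 / (ε : ℂ)) ^ e.degree * (traceProd (hermitianMatrix c) σ * lueWeight α ε c) else 0 :=
  integrable_ite _ ((integrable_traceProd hα hε σ).const_mul _)

theorem integrableOn_coeff_lueIntegrand {n : ℕ} {α : ℂ} (hα : -1 < α.re) {ε : ℝ} (hε : 0 < ε)
    (e : ℕ+ →₀ ℕ) : IntegrableOn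
      (fun c => MvPowerSeries.coeff e (lueIntegrand α ε (hermitianMatrix c)))
      (positiveHermitian n) := by
  rw [← integrable_indicator_iff (measurableSet_positiveHermitian n),
    indicator_coeff_lueIntegrand]
  exact (integrable_finsetSum _ fun σ _ => integrable_term hα hε e σ).smul _

lemma integral_coeff_lueIntegrand {n : ℕ} {α : ℂ} (hα : -1 < α.re) {ε : ℝ} (hε : 0 < ε)
    (e : ℕ+ →₀ ℕ) : ∫ c in positiveHermitian n,
      MvPowerSeries.coeff e (lueIntegrand α ε (hermitianMatrix c)) =
    ((((wt e).factorial : ℚ)⁻¹) • ∑ σ : Equiv.Perm (Fin (wt e)), if cycExp σ = e then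
      (1 / (ε : ℂ)) ^ e.degree * (ε ^ wt e * ∑ w : Equiv.Perm (Fin (wt e)),
        ((n : ℂ) + α) ^ cyc w * (n : ℂ) ^ cyc (σ * w⁻¹)) else 0) *
      ∫ c : HermitianCoord n, lueWeight α ε c := by
  rw [← integral_indicator (measurableSet_positiveHermitian n), indicator_coeff_lueIntegrand,
    integral_smul, integral_finsetSum _ fun σ _ => integrable_term hα hε e σ, smul_mul_assoc,
    Finset.sum_mul]
  congr 1
  refine Finset.sum_congr rfl fun σ _ => ?_
  split_ifs
  · rw [integral_const_mul, integral_traceProd hα hε]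
    ring
  · rw [integral_zero, zero_mul]

/-- The normalization of the LUE partition function. -/
lemma normalization_mul_integral (n : ℕ) {α : ℂ} (hα : -1 < α.re) {ε : ℝ} (hε : 0 < ε) :
    barnesG (α + 1) * (ε : ℂ) ^ (-(n : ℂ) ^ 2 - α * n) /
      ((Real.pi : ℂ) ^ (n * (n - 1) / 2 : ℕ) * barnesG (n + α + 1)) *
        ∫ c : HermitianCoord n, lueWeight α ε c = 1 := by
  have hε' : (ε : ℂ) ≠ 0 := by exact_mod_cast hε.ne'
  have hpi : (Real.pi : ℂ) ≠ 0 := by exact_mod_cast Real.pi_ne_zero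
  have hG := barnesG_ne_zero hα
  have hΓ : ∏ j ∈ Finset.range n, Complex.Gamma (α + j + 1) ≠ 0 := by
    refine Finset.prod_ne_zero_iff.mpr fun j _ => Complex.Gamma_ne_zero_of_re_pos ?_
    simp only [Complex.add_re, Complex.natCast_re, Complex.one_re]
    linarith [(Nat.cast_nonneg j : (0 : ℝ) ≤ j)]
  have hpow : (ε : ℂ) ^ (-(n : ℂ) ^ 2 - α * n) = ((ε : ℂ) ^ ((n : ℂ) ^ 2 + α * n))⁻¹ := by
    rw [← Complex.cpow_neg]
    congr 1
    ring
  have hne : (ε : ℂ) ^ ((n : ℂ) ^ 2 + α * n) ≠ 0 := by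
    rw [Complex.cpow_def_of_ne_zero hε']
    exact Complex.exp_ne_zero _
  rw [(lueWeight_integral n hα hε).2, barnesG_add_nat hα, hpow]
  set E := (ε : ℂ) ^ ((n : ℂ) ^ 2 + α * n)
  field_simp

/-- The identity of partition functions: coefficients are compared as sums over pairs of
permutations. -/
theorem dessinPartitionFunction_eq_lue (n : ℕ) {α : ℂ} (hα : -1 < α.re) {ε : ℝ} (hε : 0 < ε) :
    dessinPartitionFunction ((n : ℂ) * ε) (n * ε + α * ε) (realUnit ε hε.ne') =
      luePartitionFunction n α ε := by
  have hε' : (ε : ℂ) ≠ 0 := by exact_mod_cast hε.ne'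
  refine MvPowerSeries.ext fun e => ?_
  have hR : MvPowerSeries.coeff e (luePartitionFunction n α ε) =
      barnesG (α + 1) * (ε : ℂ) ^ (-(n : ℂ) ^ 2 - α * n) /
        ((Real.pi : ℂ) ^ (n * (n - 1) / 2 : ℕ) * barnesG (n + α + 1)) *
      ∫ c in positiveHermitian n,
        MvPowerSeries.coeff e (lueIntegrand α ε (hermitianMatrix c)) := rfl
  rw [hR, integral_coeff_lueIntegrand hα hε, mul_left_comm, normalization_mul_integral n hα hε,
    mul_one, coeff_dessinPartitionFunction, Fintype.sum_prod_type_right]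
  congr 1
  have hσ : ∀ σ : Equiv.Perm (Fin (wt e)), (if cycExp σ = e then
      (1 / (ε : ℂ)) ^ e.degree * (ε ^ wt e * ∑ w : Equiv.Perm (Fin (wt e)),
        ((n : ℂ) + α) ^ cyc w * (n : ℂ) ^ cyc (σ * w⁻¹)) else 0) =
      ∑ w : Equiv.Perm (Fin (wt e)), if cycExp σ = e then (1 / (ε : ℂ)) ^ e.degree * (ε ^ wt e *
        (((n : ℂ) + α) ^ cyc w * (n : ℂ) ^ cyc (σ * w⁻¹))) else 0 := fun σ => by
    split_ifs
    · rw [Finset.mul_sum, Finset.mul_sum]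
    · rw [Finset.sum_const_zero]
  rw [Finset.sum_congr rfl fun σ _ => hσ σ]
  conv_rhs => rw [Finset.sum_comm]
  refine Finset.sum_congr rfl fun w _ => ?_
  -- for fixed `w`, the pairs `(b, w)` correspond to their products `σ = b * w`
  refine Fintype.sum_equiv (Equiv.mulRight w) _ _ fun b => ?_
  rw [Equiv.coe_mulRight, mul_inv_cancel_right]
  refine if_congr Iff.rfl ?_ rfl
  rw [Units.val_zpow_eq_zpow_val]
  change _ * (ε : ℂ) ^ _ = _
  rw [zpow_sub₀ hε', zpow_sub₀ hε', zpow_sub₀ hε', zpow_natCast, zpow_natCast, zpow_natCast,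
    zpow_natCast, ← add_mul, mul_pow, mul_pow, one_div, inv_pow]
  field_simp

end DessinLUE

end

open MeasureTheory DessinLUE in
theorem mainTheorem2 :
    -- the identity for each matrix size `n`, at `x = n ε`, `a = α ε`; all integrals converge
    (∀ (n : ℕ) (α : ℂ) (ε : ℝ) (hε : 0 < ε), 1 ≤ n → -1 < α.re →
      (∀ e : ℕ+ →₀ ℕ, IntegrableOn
        (fun c => MvPowerSeries.coeff e (lueIntegrand α ε (hermitianMatrix c)))
        (positiveHermitian n)) ∧
      dessinPartitionFunction ((n : ℂ) * ε) (n * ε + α * ε) (realUnit ε hε.ne') =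
        luePartitionFunction n α ε) ∧
    -- the identity with `x`, `a`, `ε` as indeterminates
    (∃! Z : MvPowerSeries ℕ+ CoeffRing, IsFormalLUE Z) ∧
    (∀ Z : MvPowerSeries ℕ+ CoeffRing, IsFormalLUE Z →
      dessinPartitionFunction xVar (xVar + aVar) epsVar = Z) := by
  have hZ : IsFormalLUE (dessinPartitionFunction xVar (xVar + aVar) epsVar) :=
    fun n α ε hε _ hα => by
      rw [map_specialize_dessin, dessinPartitionFunction_eq_lue n hα hε]
  exact ⟨fun n α ε hε _ hα => ⟨fun e => integrableOn_coeff_lueIntegrand hα hε e,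
    dessinPartitionFunction_eq_lue n hα hε⟩, ⟨_, hZ, fun Z' h => h.unique hZ⟩,
    fun Z h => hZ.unique h⟩
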